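/- For $(u,v,w)\in\mathbb C^3$ put $\psi=u^3+v^3+w^3$, $\chi=u^3v^3+u^3w^3+v^3w^3$, $\lambda=216\,u^3v^3w^3$, and let $I_9(u,v,w)=(u^3-v^3)(u^3-w^3)(v^3-w^3)$ be the value of the invariant $I_9$ at the Vinberg normal form of a three-qutrit state with parameters $(u,v,w)$. For $a,b,c\in\mathbb C$ consider the system $$\psi^2-12\chi-a=0,\qquad \psi^4+\lambda\psi-b=0,\qquad \psi^6-\tfrac52\lambda\psi^3-\tfrac18\lambda^2-c=0 .$$ Let $\varepsilon=e^{2\pi i/3}$, and let $K\subset GL_3(\mathbb C)$ be the group (number 25 of Shephard and Todd) generated by $(u,v,w)\mapsto(v,w,u)$, $(u,\varepsilon v,\varepsilon^2w)$, $(u,\varepsilon v,\varepsilon w)$ and $\frac1{i\sqrt3}(u+v+w,\;u+\varepsilon v+\varepsilon^2w,\;u+\varepsilon^2v+\varepsilon w)$. 1. If $(b^3-c^2)(a^3-3ab+2c)\neq0$ (the generic case), the system has exactly $1296$ solutions $(u,v,w)$. 2. The solutions are obtained by solving a chain of equations of degree at most $4$: for all $a,b,c$, the coordinates of all solutions lie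 in a field obtained from $\mathbb Q(a,b,c)$ by successively adjoining roots of nonzero polynomials of degree at most $4$ with coefficients in the field already constructed. Explicitly, if $b\ne0$, then $(u,v,w)$ is a solution if and only if there are $X,s\in\mathbb C$ with $27X^4-18bX^2-8cX-b^2=0$ and $s^2=X$ such that $u^3,v^3,w^3$ are the three roots, with multiplicity, of $T^3-sT^2+\frac{s^2-a}{12}T-\frac{b-s^4}{216\,s}$. 3. Let $d\in\mathbb C$ satisfy $432d^2=a^3-3ab+2c$ (the prescribed value of $I_9$). Every solution has $I_9=d$ or $I_9=-d$; let $S$ be the set of solutions with the correct sign, $I_9=d$. Then $S$ is a single $K$-orbit, and: * if $b^3\ne c^2$, then $|S|=648$ and all stabilizers in $K$ are trivial; * if $b^3=c^2\neq0$ and not both $b=a^2$ and $c=a^3$, then $|S|=216$ and the stabilizers are cyclic groups $C_3$; * if $b=a^2$, $c=a^3$, $a\ne0$, then $|S|=72$ and the stabilizers are isomorphic to $C_3\times C_3$; * if $b=c=0$, $a\neq0$, then $|S|=27$ and the stabilizers are the Shephard–Todd reflection group $G_4$ (acting as such on a plane complementary to the fixed line); * if $a=b=c=0$, then $S=\{0\}$,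 with stabilizer $K$. (These cases are exhaustive; in particular $|S|\in\{648,216,72,27,1\}$.) 4. In the following degenerate cases $S$ is a configuration of regular complex polyhedra in the unitary space $\mathbb C^3$ (in Coxeter's notation; a Hessian polyhedron is one of type $3\{3\}3\{3\}3$, and the centre of an edge is the centroid of the vertices on it): * if $b=a^2/4$, $c=-a^3/8$, $a\neq0$, then $S$ (with $|S|=216$) is the set of centres of the edges of a polyhedron of type $2\{4\}3\{3\}3$, whose vertices are the vertices of two disjoint reciprocal Hessian polyhedra, and each of whose edges has exactly two vertices, one from each of these; each vertex of one of them is joined by edges to exactly $8$ vertices of the other, and no vertex of the other is closer to it than these; * if $b=a^2$, $c=a^3$, $a\ne0$, then $S$ (with $|S|=72$) is the set of centres of the edges of a Hessian polyhedron, and also the set of vertices of a polyhedron of type $3\{3\}3\{4\}2$; * if $b=c=0$, $a\neq0$, then $S$ (with $|S|=27$) is the set of vertices of a Hessian polyhedron. -/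

import Mathlib

open scoped Matrix
open Polynomial

noncomputable section

namespace Qutrit

/-- The space `ℂ³` of parameters `(u, v, w)`, with its standard unitary structure. -/
abbrev E3 := EuclideanSpace ℂ (Fin 3)

/-- The primitive cube root of unity `ε = exp (2πi/3)`. -/
def eps : ℂ := Complex.exp (2 * Real.pi * Complex.I / 3)

/-! ### The system of equations -/

/-- `ψ = u³ + v³ + w³`. -/
def psi (x : E3) : ℂ := x 0 ^ 3 + x 1 ^ 3 + x 2 ^ 3

/-- `χ = u³v³ + u³w³ + v³w³`. -/
def chi (x : E3) : ℂ := x 0 ^ 3 * x 1 ^ 3 + x 0 ^ 3 * x 2 ^ 3 + x 1 ^ 3 * x 2 ^ 3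

/-- `λ = 216 u³v³w³`. -/
def lam (x : E3) : ℂ := 216 * x 0 ^ 3 * x 1 ^ 3 * x 2 ^ 3

/-- The value of the invariant `I₉` on the normal form with parameters `(u, v, w)`. -/
def C9 (x : E3) : ℂ :=
  (x 0 ^ 3 - x 1 ^ 3) * (x 0 ^ 3 - x 2 ^ 3) * (x 1 ^ 3 - x 2 ^ 3)

/-- The solutions `(u, v, w)` of the system. -/
def solutions (a b c : ℂ) : Set E3 :=
  {x | psi x ^ 2 - 12 * chi x - a = 0 ∧
    psi x ^ 4 + lam x * psi x - b = 0 ∧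
    psi x ^ 6 - 5 / 2 * lam x * psi x ^ 3 - 1 / 8 * lam x ^ 2 - c = 0}

/-- The solutions `(u, v, w)` of the system at which `I₉` takes the prescribed value `d`. -/
def signedSolutions (a b c d : ℂ) : Set E3 :=
  {x | x ∈ solutions a b c ∧ C9 x = d}

/-- `ChainField k F`: the field `F` is obtained from `k` by successively adjoining roots of
nonzero polynomials of degree at most `4`, each with coefficients in the field already
constructed. -/
inductive ChainField (k : Subfield ℂ) : Subfield ℂ → Prop
  | base : ChainField k k
  | step (F : Subfield ℂ) (p : ℂ[X]) (t : ℂ) : ChainField k F → (∀ i, p.coeff i ∈ F) →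
      p ≠ 0 → p.natDegree ≤ 4 → p.IsRoot t → ChainField k (F ⊔ Subfield.closure {t})

/-! ### The groups -/

/-- Cyclic permutation of the coordinates. -/
def matA : Matrix (Fin 3) (Fin 3) ℂ := !![0, 1, 0; 0, 0, 1; 1, 0, 0]

def matC : Matrix (Fin 3) (Fin 3) ℂ := !![1, 0, 0; 0, eps, 0; 0, 0, eps ^ 2]

def matD : Matrix (Fin 3) (Fin 3) ℂ := !![1, 0, 0; 0, eps, 0; 0, 0, eps]

def matE : Matrix (Fin 3) (Fin 3) ℂ :=
  (1 / (Complex.I * (Real.sqrt 3 : ℂ))) • !![1, 1, 1; 1, eps, eps ^ 2; 1, eps ^ 2, eps]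

/-- The group `K` generated by the (invertible) matrices `A, C, D, E`: the complex reflection
group number 25 in the classification of Shephard and Todd. -/
def groupK : Subgroup (GL (Fin 3) ℂ) :=
  Subgroup.closure {g | (g : Matrix (Fin 3) (Fin 3) ℂ) ∈
    ({matA, matC, matD, matE} : Set (Matrix (Fin 3) (Fin 3) ℂ))}

/-- The reflection group number 4 in the classification of Shephard and Todd, generated by two
reflections `r, s` of order three, with nontrivial eigenvalue `ε`, such that `r s r = s r s`. -/
def groupG4 : Subgroup (GL (Fin 2) ℂ) :=
  Subgroup.closure {g | (g : Matrix (Fin 2) (Fin 2) ℂ) ∈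
    ({!![eps, 1; 0, 1], !![1, 0; -eps, eps]} : Set (Matrix (Fin 2) (Fin 2) ℂ))}

/-- The linear action of matrices on `ℂ³`. -/
def act (g : GL (Fin 3) ℂ) (x : E3) : E3 :=
  WithLp.toLp 2 ((g : Matrix (Fin 3) (Fin 3) ℂ) *ᵥ x.ofLp)

theorem act_one (x : E3) : act 1 x = x := by
  simp [act]

theorem act_mul (g h : GL (Fin 3) ℂ) (x : E3) : act (g * h) x = act g (act h x) := by
  simp [act, Matrix.mulVec_mulVec]

/-- The `K`-orbit of a point. -/
def orbitK (x : E3) : Set E3 := {y | ∃ g ∈ groupK, y = act g x}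

/-- The isotropy group (stabilizer) of a point in `K`. -/
def isotropy (x : E3) : Subgroup (GL (Fin 3) ℂ) where
  carrier := {g | g ∈ groupK ∧ act g x = x}
  one_mem' := ⟨groupK.one_mem, act_one x⟩
  mul_mem' := fun {g h} hg hh =>
    ⟨groupK.mul_mem hg.1 hh.1, by rw [act_mul, hh.2, hg.2]⟩
  inv_mem' := fun {g} hg =>
    ⟨groupK.inv_mem hg.1, by
      conv_lhs => rw [← hg.2]
      rw [← act_mul, inv_mul_cancel, act_one]⟩

/-- The isotropy group of `x` is the reflection group `G₄`: it is isomorphic to `G₄`, by an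
isomorphism under which its action on a plane complementary to the line through `x` is the
defining two-dimensional representation of `G₄`. -/
def HasIsotropyG4 (x : E3) : Prop :=
  ∃ (φ : isotropy x ≃* groupG4) (j : (Fin 2 → ℂ) →ₗ[ℂ] E3),
    Function.Injective j ∧ x ∉ LinearMap.range j ∧
    ∀ (g : isotropy x) (y : Fin 2 → ℂ),
      j (((φ g : GL (Fin 2) ℂ) : Matrix (Fin 2) (Fin 2) ℂ) *ᵥ y) = act g (j y)

/-! ### Regular complex polyhedra -/

/-- Flats of `ℂ³`: the empty flat, points, complex lines, complex planes, the whole space. -/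
abbrev Flat := AffineSubspace ℂ E3

/-- The complex dimension of a flat; the empty flat has dimension `-1`. -/
def adim (F : Flat) : ℤ :=
  open scoped Classical in if F = ⊥ then -1 else (Module.finrank ℂ F.direction : ℤ)

/-- The elements of `S` strictly between `F` and `G`. -/
def between (S : Set Flat) (F G : Flat) : Set Flat := {H | H ∈ S ∧ F < H ∧ H < G}

/-- A complex polyhedron: a finite system of flats in `ℂ³`, containing the
empty flat and the whole space, such that there are at least two elements strictly between
incident elements whose dimensions differ by two, and such that the elements strictly between
incident elements whose dimensions differ by more than two are connected by chains of
successively incident elements. Incidence is inclusion. -/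
structure ComplexPolyhedron where
  elts : Set Flat
  finite : elts.Finite
  bot_mem : ⊥ ∈ elts
  top_mem : ⊤ ∈ elts
  two_between : ∀ F ∈ elts, ∀ G ∈ elts, F < G → adim G = adim F + 2 →
    ∃ H ∈ between elts F G, ∃ H' ∈ between elts F G, H ≠ H'
  nonempty_between : ∀ F ∈ elts, ∀ G ∈ elts, F < G → adim F + 2 < adim G →
    (between elts F G).Nonempty
  connected : ∀ F ∈ elts, ∀ G ∈ elts, F < G → adim F + 2 < adim G →
    ∀ H ∈ between elts F G, ∀ H' ∈ between elts F G,
      Relation.ReflTransGen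
        (fun M N : Flat => N ∈ between elts F G ∧ (M ≤ N ∨ N ≤ M)) H H'

namespace ComplexPolyhedron

variable (P : ComplexPolyhedron)

/-- The vertices, as points. -/
def verts : Set E3 := {v | affineSpan ℂ {v} ∈ P.elts}

/-- The edges, as complex lines. -/
def edges : Set Flat := {e | e ∈ P.elts ∧ adim e = 1}

/-- The vertices lying on a flat. -/
def vertsOn (e : Flat) : Set E3 := {v | v ∈ P.verts ∧ v ∈ e}

/-- The centre of an edge: the centroid of the vertices on it. -/
def edgeCenter (e : Flat) : E3 :=
  ((P.vertsOn e).ncard : ℂ)⁻¹ • ∑ᶠ v ∈ P.vertsOn e, v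

/-- The set of centres of the edges. -/
def edgeCenters : Set E3 := P.edgeCenter '' P.edges

/-- The image of a flat under a unitary affine transformation. -/
def mapFlat (g : E3 ≃ᵃⁱ[ℂ] E3) (F : Flat) : Flat := F.map g.toAffineEquiv.toAffineMap

/-- Symmetries: unitary affine transformations that permute the elements. -/
def IsSymmetry (g : E3 ≃ᵃⁱ[ℂ] E3) : Prop := mapFlat g '' P.elts = P.elts

/-- A flag: a vertex, an edge and a face that are mutually incident. -/
def IsFlag (v e f : Flat) : Prop :=
  v ∈ P.elts ∧ e ∈ P.elts ∧ f ∈ P.elts ∧ adim v = 0 ∧ adim e = 1 ∧ adim f = 2 ∧ v < e ∧ e < f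

/-- Regular: the symmetries are transitive on the flags. -/
def IsRegular : Prop :=
  ∀ v e f v' e' f', P.IsFlag v e f → P.IsFlag v' e' f' →
    ∃ g, P.IsSymmetry g ∧ mapFlat g v = v' ∧ mapFlat g e = e' ∧ mapFlat g f = f'

end ComplexPolyhedron

/-- The alternating product `g h g h ⋯` with `n` factors. -/
def altProd {G : Type*} [Group G] : G → G → ℕ → G
  | _, _, 0 => 1
  | g, h, n + 1 => g * altProd h g n

/-- `q` is the least positive number of factors for which `g h g ⋯ = h g h ⋯`. -/
def IsBraidLength {G : Type*} [Group G] (g h : G) (q : ℕ) : Prop :=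
  IsLeast {n : ℕ | 0 < n ∧ altProd g h n = altProd h g n} q

/-- `R` generates the group `S` of transformations, has order `p`, and rotates by the angle
`2π/p`. -/
def IsRotationGenerator (R : E3 ≃ᵃⁱ[ℂ] E3) (p : ℕ) (S : Set (E3 ≃ᵃⁱ[ℂ] E3)) : Prop :=
  (Subgroup.zpowers R : Set (E3 ≃ᵃⁱ[ℂ] E3)) = S ∧ orderOf R = p ∧
  LinearMap.det (R.linearIsometryEquiv.toLinearEquiv : E3 →ₗ[ℂ] E3) =
    Complex.exp (2 * Real.pi * Complex.I / p)

/-- `P` is a regular complex polyhedron of type `p₁{q₁}p₂{q₂}p₃`: it is regular and, for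
some flag, the symmetries fixing the two elements of the flag other than the vertex
(resp. the edge, the face) form a cyclic group of order `p₁` (resp. `p₂`, `p₃`), whose
distinguished generators `R₁, R₂, R₃` satisfy `R₁R₂R₁⋯ = R₂R₁R₂⋯` (`q₁` factors),
`R₂R₃R₂⋯ = R₃R₂R₃⋯` (`q₂` factors) and `R₁R₃ = R₃R₁`. -/
def ComplexPolyhedron.IsRegularOfType (P : ComplexPolyhedron) (p₁ q₁ p₂ q₂ p₃ : ℕ) : Prop :=
  P.IsRegular ∧
  ∃ (v e f : Flat) (R₁ R₂ R₃ : E3 ≃ᵃⁱ[ℂ] E3), P.IsFlag v e f ∧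
    IsRotationGenerator R₁ p₁ {g | P.IsSymmetry g ∧ mapFlat g e = e ∧ mapFlat g f = f} ∧
    IsRotationGenerator R₂ p₂ {g | P.IsSymmetry g ∧ mapFlat g v = v ∧ mapFlat g f = f} ∧
    IsRotationGenerator R₃ p₃ {g | P.IsSymmetry g ∧ mapFlat g v = v ∧ mapFlat g e = e} ∧
    IsBraidLength R₁ R₂ q₁ ∧ IsBraidLength R₂ R₃ q₂ ∧ R₁ * R₃ = R₃ * R₁

/-- A Hessian polyhedron: a regular complex polyhedron of type `3{3}3{3}3`. -/
def ComplexPolyhedron.IsHessian (P : ComplexPolyhedron) : Prop :=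
  P.IsRegularOfType 3 3 3 3 3

/-- `P` and `Q` are reciprocal: the elements of `Q` are the polars of the elements of `P` with
respect to a sphere with centre `o` and squared radius `r`. -/
def ComplexPolyhedron.IsReciprocal (P Q : ComplexPolyhedron) : Prop :=
  ∃ (o : E3) (r : ℝ), 0 < r ∧ ∀ F : Flat, F ∈ Q.elts ↔
    ∃ G ∈ P.elts, (F : Set E3) = {y | ∀ x ∈ G, inner ℂ (x - o) (y - o) = (r : ℂ)}

/-- Every vertex of `H` is joined by edges of `P` to exactly eight vertices of `H'`, and
no vertex of `H'` is closer to it than these. -/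
def ComplexPolyhedron.JoinsToEightClosest (P H H' : ComplexPolyhedron) : Prop :=
  ∀ v ∈ H.verts,
    {w | w ∈ H'.verts ∧ affineSpan ℂ {v, w} ∈ P.edges}.ncard = 8 ∧
    ∀ w ∈ H'.verts, affineSpan ℂ {v, w} ∈ P.edges → ∀ w' ∈ H'.verts, dist v w ≤ dist v w'

/-- The vertices of `P` are those of the two reciprocal Hessian polyhedra `H` and `H'`,
and the edges of `P` join each vertex of one of them to eight closest vertices of the other. -/
def ComplexPolyhedron.IsSpannedBy (P H H' : ComplexPolyhedron) : Prop :=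
  H.IsHessian ∧ H'.IsHessian ∧ H.IsReciprocal H' ∧ Disjoint H.verts H'.verts ∧
  P.verts = H.verts ∪ H'.verts ∧
  (∀ e ∈ P.edges, ∃ v ∈ H.verts, ∃ w ∈ H'.verts, P.vertsOn e = {v, w}) ∧
  P.JoinsToEightClosest H H' ∧ P.JoinsToEightClosest H' H

end Qutrit

end

/-!
# Solutions of the system and complex polyhedra

*The algebra.* The left-hand sides of the system are the invariants `C₆`, `C₁₂`, `C₁₈` of `K`, and
`432 I₉² = C₆³ - 3 C₆ C₁₂ + 2 C₁₈`. Put `M = 6uvw`, so that `λ = M³`. The elements of `K` are the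
monomial matrices `n` of a group of order `162` (permutations with their signs, times diagonal
matrices of order three), and the products `n E D` with `D = diag(εᵏ, 1, 1)`; this gives
`|K| = 648` (`normalForm`, `card_groupK`). The elements `E D` carry `ψ` to `-(ψ + εᵏ M) / θ`, where
`θ = 1 + 2ε`, and the four values that `ψ²` takes on an orbit are exactly the roots of the quartic
`27 X⁴ - 18 C₁₂ X² - 8 C₁₈ X - C₁₂²` (`quartic_psi`). Hence two solutions with the same `I₉` can be
moved by `K` so that first their values of `ψ²`, then their values of `ψ`, and finally their triples
of cubes agree, and so `K` is transitive on them (`exists_act_eq`). The same quartic yields the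
explicit chain of equations. The orbits are small exactly on the mirrors of the reflections of order
three, which are cut out by `λ (8ψ³ - λ)³ = 64 (C₁₂³ - C₁₈²)`; every point of a mirror can be moved
to `u = 0`, where the isotropy groups are read off the normal form, and orbit-stabilizer gives the
sizes (`orbit_types`).

*The polyhedra.* A `RegularSystem` consists of a flag and three unitary maps, each of which moves a
single element of the flag, with finitely many conditions on the vertices and faces incident with
the flag. The orbits of the elements of the flag under the generated group then form a regular
complex polyhedron (`RegularSystem.poly`), whose flag stabilizers are generated by the three maps
(`RegularSystem.isRegularOfType`). For the three polyhedra needed here the three maps are among four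
reflections that preserve a lattice over the Eisenstein integers, so that the conditions, as well as
the orders and braid relations of the reflections, become decidable statements about integers
(`ModelSystem`). Up to sign, the group generated by the reflections acts on `ℂ³` as `K`
(`groupK_le_realized`, `exists_act_doubleHessian`); it therefore suffices to compare a single vertex,
or the centre of a single edge, with a single solution.
-/

noncomputable section

namespace Qutrit

/-! ### Flats and their images under unitary maps -/

open ComplexPolyhedron (mapFlat)

/-- A unitary linear map, as a unitary affine transformation. -/
def aff : (E3 ≃ₗᵢ[ℂ] E3) →* (E3 ≃ᵃⁱ[ℂ] E3) where
  toFun g := g.toAffineIsometryEquiv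
  map_one' := by ext; rfl
  map_mul' g h := by ext; rfl

@[simp] lemma aff_apply (g : E3 ≃ₗᵢ[ℂ] E3) (x : E3) : aff g x = g x := rfl

lemma aff_injective : Function.Injective aff := by
  intro g h hgh
  ext1 x
  simpa using congrArg (fun s : E3 ≃ᵃⁱ[ℂ] E3 => s x) hgh

/-- A point, as a flat of dimension `0`. -/
abbrev ptFlat (v : E3) : Flat := affineSpan ℂ {v}

/-- The plane `⟨n, y⟩ = 1`, the polar of `n` with respect to the unit sphere. -/
def polarPlane (n : E3) : Flat where
  carrier := {y | inner ℂ n y = 1}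
  smul_vsub_vadd_mem' c p q r hp hq hr := by
    simp only [Set.mem_ofPred_eq, vsub_eq_sub, vadd_eq_add, inner_add_right, inner_smul_right,
      inner_sub_right] at *
    rw [hp, hq, hr]; ring

@[simp] lemma mem_polarPlane {n y : E3} : y ∈ polarPlane n ↔ inner ℂ n y = 1 := Iff.rfl

lemma mem_mapFlat {g : E3 ≃ᵃⁱ[ℂ] E3} {F : Flat} {y : E3} :
    y ∈ mapFlat g F ↔ ∃ x ∈ F, g x = y := Iff.rfl

lemma apply_mem_mapFlat {g : E3 ≃ᵃⁱ[ℂ] E3} {F : Flat} {x : E3} : g x ∈ mapFlat g F ↔ x ∈ F := by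
  rw [mem_mapFlat]
  exact ⟨fun ⟨y, hy, e⟩ => g.injective e ▸ hy, fun h => ⟨x, h, rfl⟩⟩

lemma mapFlat_mul (g h : E3 ≃ᵃⁱ[ℂ] E3) (F : Flat) : mapFlat (g * h) F = mapFlat g (mapFlat h F) := by
  ext y; simp [mem_mapFlat]

lemma mapFlat_one (F : Flat) : mapFlat 1 F = F := by
  ext y; simp [mem_mapFlat]

lemma mapFlat_mono (g : E3 ≃ᵃⁱ[ℂ] E3) {F H : Flat} (h : F ≤ H) : mapFlat g F ≤ mapFlat g H := by
  rintro _ ⟨x, hx, rfl⟩; exact ⟨x, h hx, rfl⟩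

lemma mapFlat_inv_mapFlat (g : E3 ≃ᵃⁱ[ℂ] E3) (F : Flat) : mapFlat g⁻¹ (mapFlat g F) = F := by
  rw [← mapFlat_mul, inv_mul_cancel, mapFlat_one]

lemma mapFlat_injective (g : E3 ≃ᵃⁱ[ℂ] E3) : Function.Injective (mapFlat g) :=
  Function.LeftInverse.injective (mapFlat_inv_mapFlat g)


lemma mapFlat_bot (g : E3 ≃ᵃⁱ[ℂ] E3) : mapFlat g ⊥ = ⊥ := AffineSubspace.map_bot _

lemma mapFlat_top (g : E3 ≃ᵃⁱ[ℂ] E3) : mapFlat g ⊤ = ⊤ :=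
  eq_top_iff.2 fun y _ => mem_mapFlat.2 ⟨g.symm y, AffineSubspace.mem_top ℂ E3 _, by simp⟩

lemma mapFlat_ptFlat (g : E3 ≃ᵃⁱ[ℂ] E3) (v : E3) : mapFlat g (ptFlat v) = ptFlat (g v) := by
  rw [mapFlat, AffineSubspace.map_span, Set.image_singleton]; rfl

lemma mapFlat_line (g : E3 ≃ᵃⁱ[ℂ] E3) (v w : E3) :
    mapFlat g (line[ℂ, v, w]) = line[ℂ, g v, g w] := by
  rw [mapFlat, AffineSubspace.map_span, Set.image_pair]; rfl

lemma mapFlat_polarPlane (g : E3 ≃ₗᵢ[ℂ] E3) (n : E3) :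
    mapFlat (aff g) (polarPlane n) = polarPlane (g n) := by
  ext y
  rw [mem_mapFlat]
  constructor
  · rintro ⟨x, hx, rfl⟩
    simpa [g.inner_map_map] using hx
  · intro h
    refine ⟨g.symm y, ?_, by simp⟩
    rw [mem_polarPlane, ← g.inner_map_map]; simpa using h

lemma ptFlat_le {v : E3} {F : Flat} : ptFlat v ≤ F ↔ v ∈ F := by
  rw [affineSpan_le]; simp

lemma mem_ptFlat {v w : E3} : v ∈ ptFlat w ↔ v = w := AffineSubspace.mem_affineSpan_singleton ℂ E3

lemma ptFlat_injective : Function.Injective ptFlat := fun v w h => by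
  have : v ∈ ptFlat w := h ▸ mem_ptFlat.2 rfl
  exact mem_ptFlat.1 this

lemma line_le {v w : E3} {F : Flat} : line[ℂ, v, w] ≤ F ↔ v ∈ F ∧ w ∈ F := by
  rw [affineSpan_le]; simp [Set.insert_subset_iff]

lemma polarPlane_injOn {n m : E3} (hn : n ≠ 0) (h : polarPlane n = polarPlane m) : n = m := by
  have key : ∀ z, inner ℂ n z = 1 → inner ℂ m z = 1 := fun z hz => by
    have : z ∈ polarPlane m := h ▸ mem_polarPlane.2 hz
    exact this
  have hnn : inner ℂ n n ≠ 0 := inner_self_ne_zero.2 hn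
  have h0 := key ((inner ℂ n n)⁻¹ • n) (by rw [inner_smul_right, inv_mul_cancel₀ hnn])
  refine ext_inner_right ℂ fun y => ?_
  have h1 := key (y + (1 - inner ℂ n y) • ((inner ℂ n n)⁻¹ • n)) (by
    rw [inner_add_right, inner_smul_right, inner_smul_right, inv_mul_cancel₀ hnn]; ring)
  rw [inner_add_right, inner_smul_right, h0] at h1
  linear_combination -h1

/-! ### Dimensions of flats -/

lemma adim_bot : adim ⊥ = -1 := by simp [adim]

lemma adim_of_mem {F : Flat} {x : E3} (h : x ∈ F) : adim F = Module.finrank ℂ F.direction := by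
  rw [adim, if_neg]
  rintro rfl
  exact AffineSubspace.notMem_bot ℂ E3 x h

lemma adim_top : adim ⊤ = 3 := by
  rw [adim_of_mem (AffineSubspace.mem_top ℂ E3 0), AffineSubspace.direction_top]; simp

lemma adim_ptFlat (v : E3) : adim (ptFlat v) = 0 := by
  rw [adim_of_mem (mem_ptFlat.2 rfl), direction_affineSpan]; simp

lemma adim_line {v w : E3} (h : v ≠ w) : adim (line[ℂ, v, w]) = 1 := by
  rw [adim_of_mem (left_mem_affineSpan_pair ℂ v w), direction_affineSpan, vectorSpan_pair]
  rw [finrank_span_singleton (by simpa [sub_eq_zero] using h)]; rfl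

lemma adim_polarPlane {n : E3} (hn : n ≠ 0) : adim (polarPlane n) = 2 := by
  have hnn : inner ℂ n n ≠ 0 := inner_self_ne_zero.2 hn
  have hm : (inner ℂ n n)⁻¹ • n ∈ polarPlane n := by
    rw [mem_polarPlane, inner_smul_right, inv_mul_cancel₀ hnn]
  have hd : (polarPlane n).direction = (ℂ ∙ n)ᗮ := by
    ext y
    rw [Submodule.mem_orthogonal_singleton_iff_inner_right,
      ← AffineSubspace.vadd_mem_iff_mem_direction y hm,
      mem_polarPlane, vadd_eq_add, inner_add_right, mem_polarPlane.1 hm]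
    simp
  have : Fact (Module.finrank ℂ E3 = 2 + 1) := ⟨by simp⟩
  rw [adim_of_mem hm, hd, Submodule.finrank_orthogonal_span_singleton (n := 2) hn]; rfl

lemma adim_lt {F H : Flat} (h : F < H) : adim F < adim H := by
  obtain ⟨x, hx⟩ : (H : Set E3).Nonempty := by
    rw [AffineSubspace.nonempty_iff_ne_bot]; exact ne_bot_of_gt h
  rw [adim_of_mem hx]
  by_cases hF : F = ⊥
  · rw [hF, adim_bot]; omega
  · obtain ⟨y, hy⟩ := (AffineSubspace.nonempty_iff_ne_bot F).2 hF
    rw [adim_of_mem hy]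
    exact_mod_cast Submodule.finrank_lt_finrank_of_lt
      (AffineSubspace.direction_lt_of_nonempty h ⟨y, hy⟩)

lemma lt_of_le_of_adim_lt {F H : Flat} (h : F ≤ H) (hd : adim F < adim H) : F < H :=
  lt_of_le_of_ne h (by rintro rfl; exact lt_irrefl _ hd)

lemma eq_of_le_of_adim_eq {F H : Flat} (h : F ≤ H) (hd : adim F = adim H) : F = H := by
  by_contra hne
  exact (adim_lt (lt_of_le_of_ne h hne)).ne hd

lemma adim_mapFlat (g : E3 ≃ᵃⁱ[ℂ] E3) (F : Flat) : adim (mapFlat g F) = adim F := by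
  by_cases hF : F = ⊥
  · rw [hF, mapFlat_bot]
  · obtain ⟨y, hy⟩ := (AffineSubspace.nonempty_iff_ne_bot F).2 hF
    rw [adim_of_mem hy, adim_of_mem (apply_mem_mapFlat.2 hy), mapFlat, AffineSubspace.map_direction]
    congr 1
    exact LinearEquiv.finrank_map_eq g.linearIsometryEquiv.toLinearEquiv _

/-! ### Regular polyhedra generated by three reflections -/

/-- A base flag and three generating unitary maps of a regular polyhedron with centre `0`. The base
vertex is `v₀`, the base edge is the line joining `v₀` to `R₁ v₀`, and the base face is the plane
`⟨n₀, y⟩ = 1`. The map `R₁` moves only the vertex of the base flag, `R₂` only the edge, and `R₃`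
only the face. The last fields describe the vertices and faces incident with elements of the base
flag; they are finite verifications for a concrete polyhedron. -/
structure RegularSystem where
  (R₁ R₂ R₃ : E3 ≃ₗᵢ[ℂ] E3)
  (v₀ n₀ : E3)
  R₁_n : R₁ n₀ = n₀
  R₂_v : R₂ v₀ = v₀
  R₂_n : R₂ n₀ = n₀
  R₃_v : R₃ v₀ = v₀
  R₃_w : R₃ (R₁ v₀) = R₁ v₀
  comm : R₁ * R₃ = R₃ * R₁
  inner_n_v : inner ℂ n₀ v₀ = 1
  R₁_v_ne : R₁ v₀ ≠ v₀
  R₃_n_ne : R₃ n₀ ≠ n₀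
  R₁_w : R₁ (R₁ v₀) ∈ line[ℂ, v₀, R₁ v₀]
  R₂_w : R₂ (R₁ v₀) ∉ line[ℂ, v₀, R₁ v₀]
  span : Submodule.span ℂ {v₀, R₁ v₀, n₀} = ⊤
  fixed : ∀ x, R₁ x = x → R₂ x = x → R₃ x = x → x = 0
  finite_v : {v | ∃ g ∈ Subgroup.closure {R₁, R₂, R₃}, v = g v₀}.Finite
  finite_n : {n | ∃ g ∈ Subgroup.closure {R₁, R₂, R₃}, n = g n₀}.Finite
  vert_edge : ∀ g ∈ Subgroup.closure {R₁, R₂, R₃}, g v₀ ∈ line[ℂ, v₀, R₁ v₀] →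
    ∃ k : ℕ, g v₀ = (R₁ ^ k) v₀
  vert_edge_inner : ∀ g ∈ Subgroup.closure {R₁, R₂, R₃}, g v₀ ∈ line[ℂ, v₀, R₁ v₀] →
    inner ℂ v₀ (g v₀) = inner ℂ v₀ (R₁ v₀) → g v₀ = R₁ v₀
  edge_face : ∀ g ∈ Subgroup.closure {R₁, R₂, R₃}, inner ℂ (g n₀) v₀ = 1 →
    inner ℂ (g n₀) (R₁ v₀) = 1 → ∃ k : ℕ, g n₀ = (R₃ ^ k) n₀
  vert_face : ∀ g ∈ Subgroup.closure {R₁, R₂, R₃}, inner ℂ (g n₀) v₀ = 1 →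
    ∃ h ∈ Subgroup.closure {R₂, R₃}, g n₀ = h n₀
  face_vert : ∀ g ∈ Subgroup.closure {R₁, R₂, R₃}, inner ℂ n₀ (g v₀) = 1 →
    ∃ h ∈ Subgroup.closure {R₁, R₂}, g v₀ = h v₀
  face_vert_inner : ∀ g ∈ Subgroup.closure {R₁, R₂, R₃}, inner ℂ n₀ (g v₀) = 1 →
    inner ℂ v₀ (g v₀) = inner ℂ v₀ (R₁ v₀) → ∃ k : ℕ, g v₀ = (R₂ ^ k) (R₁ v₀)

namespace RegularSystem

variable (D : RegularSystem)

/-- The group generated by the three maps. -/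
def G : Subgroup (E3 ≃ₗᵢ[ℂ] E3) := Subgroup.closure {D.R₁, D.R₂, D.R₃}

lemma R₁_mem : D.R₁ ∈ D.G := Subgroup.subset_closure (by simp)
lemma R₂_mem : D.R₂ ∈ D.G := Subgroup.subset_closure (by simp)
lemma R₃_mem : D.R₃ ∈ D.G := Subgroup.subset_closure (by simp)

/-- The vertex obtained from the base vertex by `g`. -/
def vert (g : E3 ≃ₗᵢ[ℂ] E3) : Flat := ptFlat (g D.v₀)

/-- The edge obtained from the base edge by `g`. -/
def edge (g : E3 ≃ₗᵢ[ℂ] E3) : Flat := line[ℂ, g D.v₀, g (D.R₁ D.v₀)]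

/-- The face obtained from the base face by `g`. -/
def face (g : E3 ≃ₗᵢ[ℂ] E3) : Flat := polarPlane (g D.n₀)

/-- The elements of the polyhedron. -/
def flats : Set Flat := {F | F = ⊥ ∨ F = ⊤ ∨ (∃ g ∈ D.G, F = D.vert g) ∨ (∃ g ∈ D.G, F = D.edge g) ∨
  ∃ g ∈ D.G, F = D.face g}

lemma vert_mem {g : E3 ≃ₗᵢ[ℂ] E3} (hg : g ∈ D.G) : D.vert g ∈ D.flats :=
  Or.inr (Or.inr (Or.inl ⟨g, hg, rfl⟩))
lemma edge_mem {g : E3 ≃ₗᵢ[ℂ] E3} (hg : g ∈ D.G) : D.edge g ∈ D.flats :=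
  Or.inr (Or.inr (Or.inr (Or.inl ⟨g, hg, rfl⟩)))
lemma face_mem {g : E3 ≃ₗᵢ[ℂ] E3} (hg : g ∈ D.G) : D.face g ∈ D.flats :=
  Or.inr (Or.inr (Or.inr (Or.inr ⟨g, hg, rfl⟩)))

lemma n₀_ne : D.n₀ ≠ 0 := by
  intro h; have := D.inner_n_v; rw [h, inner_zero_left] at this; exact zero_ne_one this


lemma map_n₀_ne (g : E3 ≃ₗᵢ[ℂ] E3) : g D.n₀ ≠ 0 := by simpa using D.n₀_ne

lemma inner_n_w : inner ℂ D.n₀ (D.R₁ D.v₀) = 1 := by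
  conv_lhs => rw [← D.R₁_n]
  rw [LinearIsometryEquiv.inner_map_map, D.inner_n_v]

lemma adim_vert (g) : adim (D.vert g) = 0 := adim_ptFlat _
lemma adim_edge (g : E3 ≃ₗᵢ[ℂ] E3) : adim (D.edge g) = 1 :=
  adim_line fun h => D.R₁_v_ne (g.injective h).symm
lemma adim_face (g) : adim (D.face g) = 2 := adim_polarPlane (D.map_n₀_ne g)

lemma map_vert (g h : E3 ≃ₗᵢ[ℂ] E3) : mapFlat (aff g) (D.vert h) = D.vert (g * h) := by
  simp [vert, mapFlat_ptFlat]
lemma map_edge (g h : E3 ≃ₗᵢ[ℂ] E3) : mapFlat (aff g) (D.edge h) = D.edge (g * h) := by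
  simp [edge, mapFlat_line]
lemma map_face (g h : E3 ≃ₗᵢ[ℂ] E3) : mapFlat (aff g) (D.face h) = D.face (g * h) := by
  simp [face, mapFlat_polarPlane]

lemma flats_cases {F : Flat} (hF : F ∈ D.flats) :
    (F = ⊥ ∧ adim F = -1) ∨ (F = ⊤ ∧ adim F = 3) ∨ (∃ g ∈ D.G, F = D.vert g ∧ adim F = 0) ∨
      (∃ g ∈ D.G, F = D.edge g ∧ adim F = 1) ∨ ∃ g ∈ D.G, F = D.face g ∧ adim F = 2 := by
  rcases hF with rfl | rfl | ⟨g, hg, rfl⟩ | ⟨g, hg, rfl⟩ | ⟨g, hg, rfl⟩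
  · exact Or.inl ⟨rfl, adim_bot⟩
  · exact Or.inr (Or.inl ⟨rfl, adim_top⟩)
  · exact Or.inr (Or.inr (Or.inl ⟨g, hg, rfl, D.adim_vert g⟩))
  · exact Or.inr (Or.inr (Or.inr (Or.inl ⟨g, hg, rfl, D.adim_edge g⟩)))
  · exact Or.inr (Or.inr (Or.inr (Or.inr ⟨g, hg, rfl, D.adim_face g⟩)))

lemma exists_vert {F : Flat} (hF : F ∈ D.flats) (hd : adim F = 0) : ∃ g ∈ D.G, F = D.vert g := by
  rcases D.flats_cases hF with h | h | ⟨g, hg, h, _⟩ | ⟨g, hg, h⟩ | ⟨g, hg, h⟩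
  iterate 2 omega
  · exact ⟨g, hg, h⟩
  all_goals omega

lemma exists_edge {F : Flat} (hF : F ∈ D.flats) (hd : adim F = 1) : ∃ g ∈ D.G, F = D.edge g := by
  rcases D.flats_cases hF with h | h | ⟨g, hg, h⟩ | ⟨g, hg, h, _⟩ | ⟨g, hg, h⟩
  iterate 3 omega
  · exact ⟨g, hg, h⟩
  all_goals omega

lemma exists_face {F : Flat} (hF : F ∈ D.flats) (hd : adim F = 2) : ∃ g ∈ D.G, F = D.face g := by
  rcases D.flats_cases hF with h | h | ⟨g, hg, h⟩ | ⟨g, hg, h⟩ | ⟨g, hg, h, _⟩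
  iterate 4 omega
  · exact ⟨g, hg, h⟩

lemma vert_le_edge (g) : D.vert g ≤ D.edge g := ptFlat_le.2 (left_mem_affineSpan_pair ℂ _ _)

lemma vert_R₁_le_edge (g : E3 ≃ₗᵢ[ℂ] E3) : D.vert (g * D.R₁) ≤ D.edge g :=
  ptFlat_le.2 (right_mem_affineSpan_pair ℂ _ _)

lemma edge_le_face (g : E3 ≃ₗᵢ[ℂ] E3) : D.edge g ≤ D.face g :=
  line_le.2 ⟨by rw [face, mem_polarPlane, g.inner_map_map, D.inner_n_v],
    by rw [face, mem_polarPlane, g.inner_map_map, D.inner_n_w]⟩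

lemma edge_mul_R₁ (g : E3 ≃ₗᵢ[ℂ] E3) : D.edge (g * D.R₁) = D.edge g := by
  refine eq_of_le_of_adim_eq ?_ (by rw [adim_edge, adim_edge])
  have : D.edge D.R₁ ≤ D.edge 1 := line_le.2 ⟨right_mem_affineSpan_pair ℂ _ _, D.R₁_w⟩
  have := mapFlat_mono (aff g) this
  rwa [map_edge, map_edge, mul_one] at this

lemma edge_mul_R₃ (g : E3 ≃ₗᵢ[ℂ] E3) : D.edge (g * D.R₃) = D.edge g := by
  simp [edge, D.R₃_v, D.R₃_w]

lemma face_mul_R₁ (g : E3 ≃ₗᵢ[ℂ] E3) : D.face (g * D.R₁) = D.face g := by simp [face, D.R₁_n]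
lemma face_mul_R₂ (g : E3 ≃ₗᵢ[ℂ] E3) : D.face (g * D.R₂) = D.face g := by simp [face, D.R₂_n]
lemma vert_mul_R₂ (g : E3 ≃ₗᵢ[ℂ] E3) : D.vert (g * D.R₂) = D.vert g := by simp [vert, D.R₂_v]
lemma vert_mul_R₃ (g : E3 ≃ₗᵢ[ℂ] E3) : D.vert (g * D.R₃) = D.vert g := by simp [vert, D.R₃_v]

lemma edge_mul_R₁_pow (g : E3 ≃ₗᵢ[ℂ] E3) (k : ℕ) : D.edge (g * D.R₁ ^ k) = D.edge g := by
  induction k with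
  | zero => simp
  | succ k ih => rw [pow_succ, ← mul_assoc, edge_mul_R₁, ih]

lemma edge_mul_R₃_pow (g : E3 ≃ₗᵢ[ℂ] E3) (k : ℕ) : D.edge (g * D.R₃ ^ k) = D.edge g := by
  induction k with
  | zero => simp
  | succ k ih => rw [pow_succ, ← mul_assoc, edge_mul_R₃, ih]

lemma face_mul_R₁_pow (g : E3 ≃ₗᵢ[ℂ] E3) (k : ℕ) : D.face (g * D.R₁ ^ k) = D.face g := by
  induction k with
  | zero => simp
  | succ k ih => rw [pow_succ, ← mul_assoc, face_mul_R₁, ih]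

lemma vert_mul_R₃_pow (g : E3 ≃ₗᵢ[ℂ] E3) (k : ℕ) : D.vert (g * D.R₃ ^ k) = D.vert g := by
  induction k with
  | zero => simp
  | succ k ih => rw [pow_succ, ← mul_assoc, vert_mul_R₃, ih]

/-- An element of a finitely generated group is reached from `1` by right multiplication by
generators, in both directions. -/
lemma closure_induction_step {Γ : Type*} [Group Γ] {S : Set Γ} {p : Γ → Prop} (one : p 1)
    (step : ∀ h ∈ Subgroup.closure S, ∀ r ∈ S, p h ↔ p (h * r)) :
    ∀ h ∈ Subgroup.closure S, p h := fun h hh => by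
  induction hh using Subgroup.closure_induction_right with
  | one => exact one
  | mul_right x hx y hy ih => exact (step x hx y hy).1 ih
  | mul_inv_cancel x hx y hy ih =>
    refine (step _ (mul_mem hx (inv_mem (Subgroup.subset_closure hy))) y hy).2 ?_
    rwa [inv_mul_cancel_right]

lemma face_mul_of_mem (g : E3 ≃ₗᵢ[ℂ] E3) :
    ∀ h ∈ Subgroup.closure {D.R₁, D.R₂}, D.face (g * h) = D.face g := by
  refine closure_induction_step (by rw [mul_one]) ?_
  rintro h _ r (rfl | rfl)
  · rw [← mul_assoc, face_mul_R₁]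
  · rw [← mul_assoc, face_mul_R₂]

lemma vert_mul_of_mem (g : E3 ≃ₗᵢ[ℂ] E3) :
    ∀ h ∈ Subgroup.closure {D.R₂, D.R₃}, D.vert (g * h) = D.vert g := by
  refine closure_induction_step (by rw [mul_one]) ?_
  rintro h _ r (rfl | rfl)
  · rw [← mul_assoc, vert_mul_R₂]
  · rw [← mul_assoc, vert_mul_R₃]

lemma closure₁₂_le : Subgroup.closure {D.R₁, D.R₂} ≤ D.G :=
  Subgroup.closure_mono (by intro x; simp; tauto)
lemma closure₂₃_le : Subgroup.closure {D.R₂, D.R₃} ≤ D.G :=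
  Subgroup.closure_mono (by intro x; simp; tauto)

/-- Incident vertices and faces are simultaneously images of the base ones. -/
lemma exists_of_vert_le_face {g k : E3 ≃ₗᵢ[ℂ] E3} (hg : g ∈ D.G) (hk : k ∈ D.G)
    (h : D.vert g ≤ D.face k) :
    ∃ w ∈ Subgroup.closure {D.R₂, D.R₃}, D.face k = D.face (g * w) := by
  have h1 : inner ℂ ((g⁻¹ * k) D.n₀) D.v₀ = 1 := by
    rw [← g.inner_map_map]; simpa using mem_polarPlane.1 (ptFlat_le.1 h)
  obtain ⟨w, hw, e⟩ := D.vert_face _ (mul_mem (inv_mem hg) hk) h1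
  refine ⟨w, hw, ?_⟩
  have : k D.n₀ = g (w D.n₀) := by rw [← e]; simp
  simp [face, this]

lemma exists_of_vert_le_face' {g k : E3 ≃ₗᵢ[ℂ] E3} (hg : g ∈ D.G) (hk : k ∈ D.G)
    (h : D.vert g ≤ D.face k) :
    ∃ w ∈ Subgroup.closure {D.R₁, D.R₂}, D.vert g = D.vert (k * w) := by
  have h1 : inner ℂ D.n₀ ((k⁻¹ * g) D.v₀) = 1 := by
    rw [← k.inner_map_map]; simpa using mem_polarPlane.1 (ptFlat_le.1 h)
  obtain ⟨w, hw, e⟩ := D.face_vert _ (mul_mem (inv_mem hk) hg) h1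
  refine ⟨w, hw, ?_⟩
  have : g D.v₀ = k (w D.v₀) := by rw [← e]; simp
  simp [vert, this]

/-- The group is transitive on the flags: every flag is an image of the base flag. -/
lemma exists_of_flag {g h k : E3 ≃ₗᵢ[ℂ] E3} (hg : g ∈ D.G) (hh : h ∈ D.G) (hk : k ∈ D.G)
    (h1 : D.vert g ≤ D.edge h) (h2 : D.edge h ≤ D.face k) :
    ∃ x ∈ D.G, D.vert g = D.vert x ∧ D.edge h = D.edge x ∧ D.face k = D.face x := by
  have e1 : (h⁻¹ * g) D.v₀ ∈ line[ℂ, D.v₀, D.R₁ D.v₀] := by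
    have := mapFlat_mono (aff h⁻¹) h1
    rw [map_vert, map_edge, inv_mul_cancel] at this
    exact ptFlat_le.1 this
  have e2 : D.edge 1 ≤ D.face (h⁻¹ * k) := by
    have := mapFlat_mono (aff h⁻¹) h2
    rwa [map_face, map_edge, inv_mul_cancel] at this
  obtain ⟨i, hi⟩ := D.vert_edge _ (mul_mem (inv_mem hh) hg) e1
  obtain ⟨j, hj⟩ := D.edge_face _ (mul_mem (inv_mem hh) hk) (line_le.1 e2).1 (line_le.1 e2).2
  have c : D.R₁ ^ i * D.R₃ ^ j = D.R₃ ^ j * D.R₁ ^ i := Commute.pow_pow D.comm i j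
  refine ⟨h * D.R₁ ^ i * D.R₃ ^ j,
    mul_mem (mul_mem hh (pow_mem D.R₁_mem i)) (pow_mem D.R₃_mem j), ?_, ?_, ?_⟩
  · rw [vert_mul_R₃_pow]
    have : g D.v₀ = h ((D.R₁ ^ i) D.v₀) := by rw [← hi]; simp
    rw [vert, this]; rfl
  · rw [edge_mul_R₃_pow, edge_mul_R₁_pow]
  · rw [mul_assoc, c, ← mul_assoc, face_mul_R₁_pow]
    have : k D.n₀ = h ((D.R₃ ^ j) D.n₀) := by rw [← hj]; simp
    rw [face, this]; rfl

lemma vert_R₁_ne (g : E3 ≃ₗᵢ[ℂ] E3) : D.vert (g * D.R₁) ≠ D.vert g := fun h =>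
  D.R₁_v_ne (g.injective (ptFlat_injective h))

lemma face_R₃_ne (g : E3 ≃ₗᵢ[ℂ] E3) : D.face (g * D.R₃) ≠ D.face g := fun h =>
  D.R₃_n_ne (g.injective (polarPlane_injOn (D.map_n₀_ne (g * D.R₃)) h))

lemma edge_R₂_ne (g : E3 ≃ₗᵢ[ℂ] E3) : D.edge (g * D.R₂) ≠ D.edge g := fun h => by
  rw [← map_edge D g, show D.edge g = mapFlat (aff g) (D.edge 1) by rw [map_edge, mul_one]] at h
  have h' := mapFlat_injective _ h
  have : D.R₂ (D.R₁ D.v₀) ∈ D.edge D.R₂ := right_mem_affineSpan_pair ℂ _ _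
  rw [h'] at this
  exact D.R₂_w this

lemma mem_between {F H K : Flat} (hK : K ∈ D.flats) (h1 : F ≤ K) (h2 : K ≤ H)
    (d1 : adim F < adim K) (d2 : adim K < adim H) : K ∈ between D.flats F H :=
  ⟨hK, lt_of_le_of_adim_lt h1 d1, lt_of_le_of_adim_lt h2 d2⟩

lemma two_between {F H : Flat} (hF : F ∈ D.flats) (hH : H ∈ D.flats) (hlt : F < H)
    (hd : adim H = adim F + 2) :
    ∃ K ∈ between D.flats F H, ∃ K' ∈ between D.flats F H, K ≠ K' := by
  rcases D.flats_cases hF with ⟨rfl, d⟩ | ⟨rfl, d⟩ | ⟨g, hg, rfl, d⟩ | ⟨g, hg, rfl, d⟩ | ⟨g, hg, rfl, d⟩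
  · obtain ⟨h, hh, rfl⟩ := D.exists_edge hH (by omega)
    have hR := mul_mem hh D.R₁_mem
    refine ⟨_, D.mem_between (D.vert_mem hR) bot_le (D.vert_R₁_le_edge h) ?_ ?_,
      _, D.mem_between (D.vert_mem hh) bot_le (D.vert_le_edge h) ?_ ?_, D.vert_R₁_ne h⟩ <;>
    rw [adim_vert] <;> omega
  · have := D.flats_cases hH; omega
  · obtain ⟨k, hk, rfl⟩ := D.exists_face hH (by omega)
    obtain ⟨w, hw, e⟩ := D.exists_of_vert_le_face hg hk hlt.le
    have hgw := mul_mem hg (D.closure₂₃_le hw)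
    rw [e, ← D.vert_mul_of_mem g w hw] at hd ⊢
    refine ⟨_, D.mem_between (D.edge_mem (mul_mem hgw D.R₂_mem))
        (by rw [← D.vert_mul_R₂]; exact D.vert_le_edge _)
        (by rw [← D.face_mul_R₂]; exact D.edge_le_face _) ?_ ?_,
      _, D.mem_between (D.edge_mem hgw) (D.vert_le_edge _) (D.edge_le_face _) ?_ ?_,
      D.edge_R₂_ne (g * w)⟩ <;> simp only [adim_vert, adim_edge, adim_face] <;> omega
  · have hT : H = ⊤ := by
      rcases D.flats_cases hH with h | h | ⟨_, _, h⟩ | ⟨_, _, h⟩ | ⟨_, _, h⟩ <;> first | omega | exact h.1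
    subst hT
    refine ⟨_, D.mem_between (D.face_mem (mul_mem hg D.R₃_mem))
        (by rw [← D.edge_mul_R₃]; exact D.edge_le_face _) le_top ?_ ?_,
      _, D.mem_between (D.face_mem hg) (D.edge_le_face _) le_top ?_ ?_, D.face_R₃_ne g⟩ <;>
    rw [adim_face] <;> omega
  · rcases D.flats_cases hH with h | h | ⟨_, _, h⟩ | ⟨_, _, h⟩ | ⟨_, _, h⟩ <;> omega

end RegularSystem

/-- Two flats are joined if a chain of successively incident elements of `S` strictly between `F`
and `H` leads from the first to the second. -/
def Joined (S : Set Flat) (F H : Flat) : Flat → Flat → Prop :=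
  Relation.ReflTransGen (fun M N : Flat => N ∈ between S F H ∧ (M ≤ N ∨ N ≤ M))

lemma Joined.symm {S : Set Flat} {F H M N : Flat} (h : Joined S F H M N)
    (hM : M ∈ between S F H) : Joined S F H N M := by
  suffices N ∈ between S F H ∧ Joined S F H N M from this.2
  induction h with
  | refl => exact ⟨hM, .refl⟩
  | tail _ h2 ih => exact ⟨h2.1, .head ⟨ih.1, h2.2.symm⟩ ih.2⟩

/-- If all elements strictly between `F` and `H` are joined to one of them, then any two are. -/
lemma joined_of_base {S : Set Flat} {F H B : Flat}
    (h : ∀ M ∈ between S F H, Joined S F H M B) :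
    ∀ M ∈ between S F H, ∀ N ∈ between S F H, Joined S F H M N :=
  fun M hM N hN => (h M hM).trans ((h N hN).symm hN)

lemma joined_of_le {S : Set Flat} {F H M N : Flat} (hN : N ∈ between S F H)
    (h : M ≤ N ∨ N ≤ M) : Joined S F H M N := .single ⟨hN, h⟩

namespace RegularSystem

variable (D : RegularSystem)

lemma joined_step {F H M N K : Flat} (hM : M ∈ between D.flats F H) (hN : N ∈ between D.flats F H)
    (hK : K ∈ between D.flats F H) (h1 : M ≤ K ∨ K ≤ M) (h2 : K ≤ N ∨ N ≤ K) (B : Flat) :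
    Joined D.flats F H M B ↔ Joined D.flats F H N B :=
  ⟨fun h => (joined_of_le hK h2.symm).trans ((joined_of_le hM h1.symm).trans h),
    fun h => (joined_of_le hK h1).trans ((joined_of_le hN h2).trans h)⟩

/-- The vertices and edges in a face are connected. -/
lemma connected_bot_face {k : E3 ≃ₗᵢ[ℂ] E3} (hk : k ∈ D.G) :
    ∀ M ∈ between D.flats ⊥ (D.face k), ∀ N ∈ between D.flats ⊥ (D.face k),
      Joined D.flats ⊥ (D.face k) M N := by
  have bv : ∀ w ∈ Subgroup.closure {D.R₁, D.R₂}, D.vert (k * w) ∈ between D.flats ⊥ (D.face k) := by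
    intro w hw
    refine D.mem_between (D.vert_mem (mul_mem hk (D.closure₁₂_le hw))) bot_le ?_ ?_ ?_
    · rw [← D.face_mul_of_mem k w hw]; exact (D.vert_le_edge _).trans (D.edge_le_face _)
    · rw [adim_bot, adim_vert]; omega
    · rw [adim_face, adim_vert]; omega
  have be : ∀ w ∈ Subgroup.closure {D.R₁, D.R₂}, D.edge (k * w) ∈ between D.flats ⊥ (D.face k) := by
    intro w hw
    refine D.mem_between (D.edge_mem (mul_mem hk (D.closure₁₂_le hw))) bot_le ?_ ?_ ?_
    · rw [← D.face_mul_of_mem k w hw]; exact D.edge_le_face _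
    · rw [adim_bot, adim_edge]; omega
    · rw [adim_face, adim_edge]; omega
  have base : ∀ w ∈ Subgroup.closure {D.R₁, D.R₂},
      Joined D.flats ⊥ (D.face k) (D.vert (k * w)) (D.vert k) := by
    refine closure_induction_step (by rw [mul_one]; exact .refl) ?_
    rintro w hw r hr
    have hwr := bv _ (mul_mem hw (Subgroup.subset_closure hr))
    rcases hr with rfl | rfl
    · rw [← mul_assoc] at *
      exact D.joined_step (bv w hw) hwr (be w hw) (.inl (D.vert_le_edge _))
        (.inr (D.vert_R₁_le_edge _)) _
    · rw [← mul_assoc, D.vert_mul_R₂]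
  have hvert : ∀ g ∈ D.G, D.vert g ≤ D.face k →
      D.vert g ∈ between D.flats ⊥ (D.face k) ∧ Joined D.flats ⊥ (D.face k) (D.vert g) (D.vert k) := by
    intro g hg h
    obtain ⟨w, hw, e⟩ := D.exists_of_vert_le_face' hg hk h
    rw [e]; exact ⟨bv w hw, base w hw⟩
  refine joined_of_base (B := D.vert k) ?_
  rintro M ⟨hM, h1, h2⟩
  have d1 := adim_lt h1
  have d2 := adim_lt h2
  rw [adim_bot] at d1
  rw [adim_face] at d2
  rcases D.flats_cases hM with h | h | ⟨g, hg, rfl, _⟩ | ⟨g, hg, rfl, _⟩ | ⟨_, _, h⟩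
  iterate 2 omega
  · exact (hvert g hg h2.le).2
  · obtain ⟨a, b⟩ := hvert g hg ((D.vert_le_edge g).trans h2.le)
    exact (joined_of_le a (.inr (D.vert_le_edge g))).trans b
  · omega

/-- The edges and faces at a vertex are connected. -/
lemma connected_vert_top {k : E3 ≃ₗᵢ[ℂ] E3} (hk : k ∈ D.G) :
    ∀ M ∈ between D.flats (D.vert k) ⊤, ∀ N ∈ between D.flats (D.vert k) ⊤,
      Joined D.flats (D.vert k) ⊤ M N := by
  have bv : ∀ w ∈ Subgroup.closure {D.R₂, D.R₃}, D.face (k * w) ∈ between D.flats (D.vert k) ⊤ := by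
    intro w hw
    refine D.mem_between (D.face_mem (mul_mem hk (D.closure₂₃_le hw))) ?_ le_top ?_ ?_
    · rw [← D.vert_mul_of_mem k w hw]; exact (D.vert_le_edge _).trans (D.edge_le_face _)
    · rw [adim_vert, adim_face]; omega
    · rw [adim_face, adim_top]; omega
  have be : ∀ w ∈ Subgroup.closure {D.R₂, D.R₃}, D.edge (k * w) ∈ between D.flats (D.vert k) ⊤ := by
    intro w hw
    refine D.mem_between (D.edge_mem (mul_mem hk (D.closure₂₃_le hw))) ?_ le_top ?_ ?_
    · rw [← D.vert_mul_of_mem k w hw]; exact D.vert_le_edge _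
    · rw [adim_vert, adim_edge]; omega
    · rw [adim_edge, adim_top]; omega
  have base : ∀ w ∈ Subgroup.closure {D.R₂, D.R₃},
      Joined D.flats (D.vert k) ⊤ (D.face (k * w)) (D.face k) := by
    refine closure_induction_step (by rw [mul_one]; exact .refl) ?_
    rintro w hw r hr
    have hwr := bv _ (mul_mem hw (Subgroup.subset_closure hr))
    rcases hr with rfl | rfl
    · rw [← mul_assoc, D.face_mul_R₂]
    · rw [← mul_assoc] at *
      refine D.joined_step (bv w hw) hwr (be w hw) (.inr (D.edge_le_face _)) (.inl ?_) _
      rw [← D.edge_mul_R₃]; exact D.edge_le_face _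
  have hface : ∀ g ∈ D.G, D.vert k ≤ D.face g →
      D.face g ∈ between D.flats (D.vert k) ⊤ ∧ Joined D.flats (D.vert k) ⊤ (D.face g) (D.face k) := by
    intro g hg h
    obtain ⟨w, hw, e⟩ := D.exists_of_vert_le_face hk hg h
    rw [e]; exact ⟨bv w hw, base w hw⟩
  refine joined_of_base (B := D.face k) ?_
  rintro M ⟨hM, h1, h2⟩
  have d1 := adim_lt h1
  have d2 := adim_lt h2
  rw [adim_vert] at d1
  rw [adim_top] at d2
  rcases D.flats_cases hM with h | h | ⟨_, _, h⟩ | ⟨g, hg, rfl, _⟩ | ⟨g, hg, rfl, _⟩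
  iterate 3 omega
  · obtain ⟨a, b⟩ := hface g hg (h1.le.trans (D.edge_le_face g))
    exact (joined_of_le a (.inl (D.edge_le_face g))).trans b
  · exact (hface g hg h1.le).2

/-- All proper elements are connected. -/
lemma connected_bot_top :
    ∀ M ∈ between D.flats ⊥ ⊤, ∀ N ∈ between D.flats ⊥ ⊤, Joined D.flats ⊥ ⊤ M N := by
  have bv : ∀ w ∈ D.G, D.vert w ∈ between D.flats ⊥ ⊤ := by
    intro w hw
    refine D.mem_between (D.vert_mem hw) bot_le le_top ?_ ?_
    · rw [adim_bot, adim_vert]; omega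
    · rw [adim_top, adim_vert]; omega
  have be : ∀ w ∈ D.G, D.edge w ∈ between D.flats ⊥ ⊤ := by
    intro w hw
    refine D.mem_between (D.edge_mem hw) bot_le le_top ?_ ?_
    · rw [adim_bot, adim_edge]; omega
    · rw [adim_top, adim_edge]; omega
  have base : ∀ w ∈ D.G, Joined D.flats ⊥ ⊤ (D.vert w) (D.vert 1) := by
    refine closure_induction_step .refl ?_
    rintro w hw r hr
    have hwr := bv _ (mul_mem hw (Subgroup.subset_closure hr))
    rcases hr with rfl | rfl | rfl
    · exact D.joined_step (bv w hw) hwr (be w hw) (.inl (D.vert_le_edge _))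
        (.inr (D.vert_R₁_le_edge _)) _
    · rw [D.vert_mul_R₂]
    · rw [D.vert_mul_R₃]
  refine joined_of_base (B := D.vert 1) ?_
  rintro M ⟨hM, h1, h2⟩
  have d1 := adim_lt h1
  have d2 := adim_lt h2
  rw [adim_bot] at d1
  rw [adim_top] at d2
  rcases D.flats_cases hM with h | h | ⟨g, hg, rfl, _⟩ | ⟨g, hg, rfl, _⟩ | ⟨g, hg, rfl, _⟩
  iterate 2 omega
  · exact base g hg
  · exact (joined_of_le (bv g hg) (.inr (D.vert_le_edge g))).trans (base g hg)
  · exact (joined_of_le (bv g hg) (.inr ((D.vert_le_edge g).trans (D.edge_le_face g)))).trans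
      (base g hg)

/-- The three cases in which the dimensions of incident elements differ by more than two. -/
lemma gap_cases {F H : Flat} (hF : F ∈ D.flats) (hH : H ∈ D.flats)
    (hd : adim F + 2 < adim H) :
    (F = ⊥ ∧ ∃ g ∈ D.G, H = D.face g) ∨ (H = ⊤ ∧ ∃ g ∈ D.G, F = D.vert g) ∨ (F = ⊥ ∧ H = ⊤) := by
  rcases D.flats_cases hF with ⟨rfl, _⟩ | ⟨rfl, _⟩ | ⟨g, hg, rfl, _⟩ | ⟨g, hg, rfl, _⟩ |
      ⟨g, hg, rfl, _⟩ <;>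
    rcases D.flats_cases hH with ⟨rfl, _⟩ | ⟨rfl, _⟩ | ⟨h, hh, rfl, _⟩ | ⟨h, hh, rfl, _⟩ |
      ⟨h, hh, rfl, _⟩ <;> first | omega | skip
  · exact .inr (.inr ⟨rfl, rfl⟩)
  · exact .inl ⟨rfl, h, hh, rfl⟩
  · exact .inr (.inl ⟨rfl, g, hg, rfl⟩)

lemma nonempty_between {F H : Flat} (hF : F ∈ D.flats) (hH : H ∈ D.flats)
    (hd : adim F + 2 < adim H) : (between D.flats F H).Nonempty := by
  rcases D.gap_cases hF hH hd with ⟨rfl, g, hg, rfl⟩ | ⟨rfl, g, hg, rfl⟩ | ⟨rfl, rfl⟩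
  · refine ⟨_, D.mem_between (D.edge_mem hg) bot_le (D.edge_le_face g) ?_ ?_⟩
    · rw [adim_bot, adim_edge]; omega
    · rw [adim_face, adim_edge]; omega
  · refine ⟨_, D.mem_between (D.edge_mem hg) (D.vert_le_edge g) le_top ?_ ?_⟩
    · rw [adim_vert, adim_edge]; omega
    · rw [adim_top, adim_edge]; omega
  · refine ⟨_, D.mem_between (D.edge_mem (one_mem _)) bot_le le_top ?_ ?_⟩
    · rw [adim_bot, adim_edge]; omega
    · rw [adim_top, adim_edge]; omega

lemma connected {F H : Flat} (hF : F ∈ D.flats) (hH : H ∈ D.flats)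
    (hd : adim F + 2 < adim H) :
    ∀ M ∈ between D.flats F H, ∀ N ∈ between D.flats F H, Joined D.flats F H M N := by
  rcases D.gap_cases hF hH hd with ⟨rfl, g, hg, rfl⟩ | ⟨rfl, g, hg, rfl⟩ | ⟨rfl, rfl⟩
  · exact D.connected_bot_face hg
  · exact D.connected_vert_top hg
  · exact D.connected_bot_top

/-- The points that are vertices. -/
def points : Set E3 := {v | ∃ g ∈ D.G, v = g D.v₀}

lemma finite_flats : D.flats.Finite := by
  have hv : D.points.Finite := D.finite_v
  have h1 : (ptFlat '' D.points).Finite := hv.image _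
  have h2 : ((fun p : E3 × E3 => line[ℂ, p.1, p.2]) '' (D.points ×ˢ D.points)).Finite :=
    (hv.prod hv).image _
  have h3 : (polarPlane '' {n | ∃ g ∈ D.G, n = g D.n₀}).Finite := Set.Finite.image _ D.finite_n
  refine ((Set.finite_singleton ⊥).union ((Set.finite_singleton ⊤).union
    (h1.union (h2.union h3)))).subset ?_
  rintro F (rfl | rfl | ⟨g, hg, rfl⟩ | ⟨g, hg, rfl⟩ | ⟨g, hg, rfl⟩)
  · exact .inl rfl
  · exact .inr (.inl rfl)
  · exact .inr (.inr (.inl ⟨_, ⟨g, hg, rfl⟩, rfl⟩))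
  · exact .inr (.inr (.inr (.inl ⟨(_, _), ⟨⟨g, hg, rfl⟩, ⟨g * D.R₁, mul_mem hg D.R₁_mem, rfl⟩⟩, rfl⟩)))
  · exact .inr (.inr (.inr (.inr ⟨_, ⟨g, hg, rfl⟩, rfl⟩)))

/-- The polyhedron generated by the system. -/
def poly : ComplexPolyhedron where
  elts := D.flats
  finite := D.finite_flats
  bot_mem := .inl rfl
  top_mem := .inr (.inl rfl)
  two_between _ hF _ hH hlt hd := D.two_between hF hH hlt hd
  nonempty_between _ hF _ hH _ hd := D.nonempty_between hF hH hd
  connected _ hF _ hH _ hd := D.connected hF hH hd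

lemma map_flats {g : E3 ≃ₗᵢ[ℂ] E3} (hg : g ∈ D.G) {F : Flat} (hF : F ∈ D.flats) :
    mapFlat (aff g) F ∈ D.flats := by
  rcases hF with rfl | rfl | ⟨h, hh, rfl⟩ | ⟨h, hh, rfl⟩ | ⟨h, hh, rfl⟩
  · rw [mapFlat_bot]; exact .inl rfl
  · rw [mapFlat_top]; exact .inr (.inl rfl)
  · rw [map_vert]; exact D.vert_mem (mul_mem hg hh)
  · rw [map_edge]; exact D.edge_mem (mul_mem hg hh)
  · rw [map_face]; exact D.face_mem (mul_mem hg hh)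

lemma isSymmetry {g : E3 ≃ₗᵢ[ℂ] E3} (hg : g ∈ D.G) : D.poly.IsSymmetry (aff g) := by
  refine Set.Subset.antisymm ?_ fun F hF => ⟨mapFlat (aff g⁻¹) F, D.map_flats (inv_mem hg) hF, ?_⟩
  · rintro _ ⟨F, hF, rfl⟩; exact D.map_flats hg hF
  · rw [← mapFlat_mul, ← map_mul, mul_inv_cancel, map_one, mapFlat_one]

lemma exists_of_isFlag {v e f : Flat} (h : D.poly.IsFlag v e f) :
    ∃ x ∈ D.G, v = D.vert x ∧ e = D.edge x ∧ f = D.face x := by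
  obtain ⟨hv, he, hf, dv, de, df, h1, h2⟩ := h
  obtain ⟨a, ha, rfl⟩ := D.exists_vert hv dv
  obtain ⟨b, hb, rfl⟩ := D.exists_edge he de
  obtain ⟨c, hc, rfl⟩ := D.exists_face hf df
  exact D.exists_of_flag ha hb hc h1.le h2.le

lemma isFlag_base : D.poly.IsFlag (D.vert 1) (D.edge 1) (D.face 1) :=
  ⟨D.vert_mem (one_mem _), D.edge_mem (one_mem _), D.face_mem (one_mem _), D.adim_vert 1,
    D.adim_edge 1, D.adim_face 1,
    lt_of_le_of_adim_lt (D.vert_le_edge 1) (by rw [adim_vert, adim_edge]; omega),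
    lt_of_le_of_adim_lt (D.edge_le_face 1) (by rw [adim_face, adim_edge]; omega)⟩

lemma isRegular : D.poly.IsRegular := by
  intro v e f v' e' f' h h'
  obtain ⟨x, hx, rfl, rfl, rfl⟩ := D.exists_of_isFlag h
  obtain ⟨y, hy, rfl, rfl, rfl⟩ := D.exists_of_isFlag h'
  refine ⟨aff (y * x⁻¹), D.isSymmetry (mul_mem hy (inv_mem hx)), ?_, ?_, ?_⟩ <;>
  simp only [map_vert, map_edge, map_face, inv_mul_cancel_right]

lemma verts_poly : D.poly.verts = D.points := by
  ext v
  constructor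
  · intro h
    obtain ⟨g, hg, e⟩ := D.exists_vert h (adim_ptFlat v)
    exact ⟨g, hg, ptFlat_injective e⟩
  · rintro ⟨g, hg, rfl⟩
    exact D.vert_mem hg

/-! ### Symmetries and the type of the polyhedron -/

lemma symm_mem {s : E3 ≃ᵃⁱ[ℂ] E3} (hs : D.poly.IsSymmetry s) {F : Flat} (hF : F ∈ D.flats) :
    mapFlat s F ∈ D.flats := by
  have h : mapFlat s '' D.flats = D.flats := hs
  rw [← h]; exact ⟨F, hF, rfl⟩

lemma symm_points {s : E3 ≃ᵃⁱ[ℂ] E3} (hs : D.poly.IsSymmetry s) {v : E3} (hv : v ∈ D.points) :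
    s v ∈ D.points := by
  rw [← verts_poly] at *
  have := D.symm_mem hs hv
  rwa [mapFlat_ptFlat] at this

lemma sum_eq_of_injective {s : E3 → E3} (hi : Function.Injective s)
    (h : ∀ v ∈ D.points, s v ∈ D.points) :
    ∑ v ∈ D.finite_v.toFinset, s v = ∑ v ∈ D.finite_v.toFinset, v := by
  have hm : ∀ v, v ∈ D.finite_v.toFinset ↔ v ∈ D.points := fun v => D.finite_v.mem_toFinset
  have himg : D.finite_v.toFinset.image s = D.finite_v.toFinset := by
    refine Finset.eq_of_subset_of_card_le ?_ (Finset.card_image_of_injective _ hi).ge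
    intro x hx
    obtain ⟨v, hv, rfl⟩ := Finset.mem_image.1 hx
    exact (hm _).2 (h v ((hm v).1 hv))
  conv_rhs => rw [← himg]
  rw [Finset.sum_image fun a _ b _ hab => hi hab]

lemma sum_points : ∑ v ∈ D.finite_v.toFinset, v = 0 := by
  have key : ∀ g ∈ D.G, g (∑ v ∈ D.finite_v.toFinset, v) = ∑ v ∈ D.finite_v.toFinset, v := by
    intro g hg
    rw [map_sum]
    refine D.sum_eq_of_injective g.injective ?_
    rintro _ ⟨h, hh, rfl⟩
    exact ⟨g * h, mul_mem hg hh, rfl⟩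
  exact D.fixed _ (key _ D.R₁_mem) (key _ D.R₂_mem) (key _ D.R₃_mem)

/-- Every symmetry fixes the centroid of the vertices, so it is linear. -/
lemma symm_linear {s : E3 ≃ᵃⁱ[ℂ] E3} (hs : D.poly.IsSymmetry s) : ∃ g, s = aff g := by
  have hlin : ∀ x, s x = s.linearIsometryEquiv x + s 0 := fun x => by
    have := s.map_vadd 0 x; simpa using this
  have h1 := D.sum_eq_of_injective s.injective fun v => D.symm_points hs
  rw [Finset.sum_congr rfl fun v _ => hlin v, Finset.sum_add_distrib, ← map_sum, D.sum_points, map_zero,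
    zero_add, Finset.sum_const,
    ← Nat.cast_smul_eq_nsmul ℂ, smul_eq_zero] at h1
  have h0 : s 0 = 0 := h1.resolve_left <| by
    have : D.v₀ ∈ D.finite_v.toFinset := D.finite_v.mem_toFinset.2 ⟨1, one_mem _, rfl⟩
    exact_mod_cast Finset.card_ne_zero_of_mem this
  refine ⟨s.linearIsometryEquiv, ?_⟩
  ext1 x
  rw [hlin, h0, add_zero]; rfl

lemma symm_normals {g : E3 ≃ₗᵢ[ℂ] E3} (hs : D.poly.IsSymmetry (aff g)) :
    ∃ h ∈ D.G, g D.n₀ = h D.n₀ := by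
  have h1 := D.symm_mem hs (D.face_mem (one_mem _))
  obtain ⟨h, hh, e⟩ := D.exists_face h1 (by rw [adim_mapFlat, adim_face])
  refine ⟨h, hh, ?_⟩
  rw [map_face, mul_one] at e
  exact polarPlane_injOn (D.map_n₀_ne _) e

/-- A unitary map fixing the base flag and one further vertex on the base edge is trivial. -/
lemma eq_one {g : E3 ≃ₗᵢ[ℂ] E3} (h1 : g D.v₀ = D.v₀) (h2 : g (D.R₁ D.v₀) = D.R₁ D.v₀)
    (h3 : g D.n₀ = D.n₀) : g = 1 := by
  have : (g.toLinearEquiv : E3 →ₗ[ℂ] E3) = LinearMap.id := by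
    refine LinearMap.ext_on D.span ?_
    rintro x (rfl | rfl | rfl) <;> simpa
  ext1 x
  exact LinearMap.congr_fun this x


lemma pow_R₂_n (k : ℕ) : (D.R₂ ^ k) D.n₀ = D.n₀ := by
  induction k with
  | zero => rfl
  | succ k ih => rw [pow_succ, LinearIsometryEquiv.coe_mul, Function.comp, D.R₂_n, ih]

lemma pow_R₂_v (k : ℕ) : (D.R₂ ^ k) D.v₀ = D.v₀ := by
  induction k with
  | zero => rfl
  | succ k ih => rw [pow_succ, LinearIsometryEquiv.coe_mul, Function.comp, D.R₂_v, ih]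

lemma pow_R₃_v (k : ℕ) : (D.R₃ ^ k) D.v₀ = D.v₀ := by
  induction k with
  | zero => rfl
  | succ k ih => rw [pow_succ, LinearIsometryEquiv.coe_mul, Function.comp, D.R₃_v, ih]

lemma pow_R₃_w (k : ℕ) : (D.R₃ ^ k) (D.R₁ D.v₀) = D.R₁ D.v₀ := by
  induction k with
  | zero => rfl
  | succ k ih => rw [pow_succ, LinearIsometryEquiv.coe_mul, Function.comp, D.R₃_w, ih]

lemma isSymmetry_mul {s t : E3 ≃ᵃⁱ[ℂ] E3} (hs : D.poly.IsSymmetry s) (ht : D.poly.IsSymmetry t) :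
    D.poly.IsSymmetry (s * t) := by
  have hs' : mapFlat s '' D.poly.elts = D.poly.elts := hs
  have ht' : mapFlat t '' D.poly.elts = D.poly.elts := ht
  have : mapFlat (s * t) = mapFlat s ∘ mapFlat t := funext fun F => mapFlat_mul s t F
  rw [ComplexPolyhedron.IsSymmetry, this, Set.image_comp, ht', hs']

/-- A symmetry fixing the base vertex and the base edge fixes the base edge pointwise. -/
lemma symm_w {g : E3 ≃ₗᵢ[ℂ] E3} (hs : D.poly.IsSymmetry (aff g)) (hv : g D.v₀ = D.v₀)
    (he : mapFlat (aff g) (D.edge 1) = D.edge 1) : g (D.R₁ D.v₀) = D.R₁ D.v₀ := by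
  obtain ⟨h, hh, e⟩ := D.symm_points hs (v := D.R₁ D.v₀) ⟨_, D.R₁_mem, rfl⟩
  rw [aff_apply] at e
  rw [e]
  refine D.vert_edge_inner h hh ?_ ?_
  · rw [← e, ← aff_apply]
    have : aff g (D.R₁ D.v₀) ∈ mapFlat (aff g) (D.edge 1) :=
      apply_mem_mapFlat.2 (right_mem_affineSpan_pair ℂ _ _)
    rw [he] at this
    exact this
  · have := g.inner_map_map D.v₀ (D.R₁ D.v₀)
    rwa [hv, e] at this

lemma fix_n {g : E3 ≃ₗᵢ[ℂ] E3} (hf : mapFlat (aff g) (D.face 1) = D.face 1) : g D.n₀ = D.n₀ := by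
  rw [map_face] at hf
  exact polarPlane_injOn (D.map_n₀_ne _) hf

lemma fix_v {g : E3 ≃ₗᵢ[ℂ] E3} (hf : mapFlat (aff g) (D.vert 1) = D.vert 1) : g D.v₀ = D.v₀ := by
  rw [map_vert] at hf
  exact ptFlat_injective hf

lemma coe_zpowers_eq (R : E3 ≃ₗᵢ[ℂ] E3) (S : Set (E3 ≃ᵃⁱ[ℂ] E3))
    (h1 : ∀ k : ℤ, aff (R ^ k) ∈ S) (h2 : ∀ s ∈ S, ∃ g, s = aff g)
    (h3 : ∀ g, aff g ∈ S → ∃ k : ℕ, g = R ^ k) :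
    (Subgroup.zpowers (aff R) : Set (E3 ≃ᵃⁱ[ℂ] E3)) = S := by
  refine Set.Subset.antisymm ?_ fun s hs => ?_
  · rintro _ ⟨k, rfl⟩
    simpa using h1 k
  · obtain ⟨g, rfl⟩ := h2 s hs
    obtain ⟨k, rfl⟩ := h3 g hs
    exact ⟨k, by simp⟩

lemma zpowers_R₁ : (Subgroup.zpowers (aff D.R₁) : Set (E3 ≃ᵃⁱ[ℂ] E3)) =
    {s | D.poly.IsSymmetry s ∧ mapFlat s (D.edge 1) = D.edge 1 ∧ mapFlat s (D.face 1) = D.face 1} := by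
  have hk : ∀ k : ℤ, aff (D.R₁ ^ k) ∈ {s | D.poly.IsSymmetry s ∧ mapFlat s (D.edge 1) = D.edge 1 ∧
      mapFlat s (D.face 1) = D.face 1} := by
    intro k
    have : ∀ h ∈ Subgroup.closure {D.R₁}, D.edge h = D.edge 1 ∧ D.face h = D.face 1 := by
      refine closure_induction_step
        (p := fun h => D.edge h = D.edge 1 ∧ D.face h = D.face 1) ⟨rfl, rfl⟩ ?_
      rintro h _ r rfl
      rw [edge_mul_R₁, face_mul_R₁]
    have h := this (D.R₁ ^ k) (zpow_mem (Subgroup.subset_closure (Set.mem_singleton _)) k)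
    exact ⟨D.isSymmetry (zpow_mem D.R₁_mem k), by rw [map_edge, mul_one, h.1],
      by rw [map_face, mul_one, h.2]⟩
  refine coe_zpowers_eq _ _ hk (fun s hs => D.symm_linear hs.1) ?_
  rintro g ⟨hs, he, hf⟩
  obtain ⟨h, hh, e⟩ := D.symm_points hs (v := D.v₀) ⟨1, one_mem _, rfl⟩
  rw [aff_apply] at e
  obtain ⟨k, hk'⟩ := D.vert_edge h hh <| by
    rw [← e, ← aff_apply]
    have : aff g D.v₀ ∈ mapFlat (aff g) (D.edge 1) :=
      apply_mem_mapFlat.2 (left_mem_affineSpan_pair ℂ _ _)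
    rw [he] at this
    exact this
  refine ⟨k, ?_⟩
  obtain ⟨s1, s2, s3⟩ := hk (-k)
  have hv : ((D.R₁ ^ (-k : ℤ)) * g) D.v₀ = D.v₀ := by
    rw [LinearIsometryEquiv.coe_mul, Function.comp, e, hk', zpow_neg, zpow_natCast]; simp
  have := D.eq_one hv (D.symm_w (by rw [map_mul]; exact D.isSymmetry_mul s1 hs) hv
    (by rw [map_mul, mapFlat_mul, he, s2])) (D.fix_n (by rw [map_mul, mapFlat_mul, hf, s3]))
  rw [zpow_neg, zpow_natCast] at this
  exact (inv_mul_eq_one.1 this).symm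

lemma zpowers_R₂ : (Subgroup.zpowers (aff D.R₂) : Set (E3 ≃ᵃⁱ[ℂ] E3)) =
    {s | D.poly.IsSymmetry s ∧ mapFlat s (D.vert 1) = D.vert 1 ∧ mapFlat s (D.face 1) = D.face 1} := by
  have hk : ∀ k : ℤ, aff (D.R₂ ^ k) ∈ {s | D.poly.IsSymmetry s ∧ mapFlat s (D.vert 1) = D.vert 1 ∧
      mapFlat s (D.face 1) = D.face 1} := by
    intro k
    have : ∀ h ∈ Subgroup.closure {D.R₂}, D.vert h = D.vert 1 ∧ D.face h = D.face 1 := by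
      refine closure_induction_step
        (p := fun h => D.vert h = D.vert 1 ∧ D.face h = D.face 1) ⟨rfl, rfl⟩ ?_
      rintro h _ r rfl
      rw [vert_mul_R₂, face_mul_R₂]
    have h := this (D.R₂ ^ k) (zpow_mem (Subgroup.subset_closure (Set.mem_singleton _)) k)
    exact ⟨D.isSymmetry (zpow_mem D.R₂_mem k), by rw [map_vert, mul_one, h.1],
      by rw [map_face, mul_one, h.2]⟩
  refine coe_zpowers_eq _ _ hk (fun s hs => D.symm_linear hs.1) ?_
  rintro g ⟨hs, he, hf⟩
  have hv := D.fix_v he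
  have hn := D.fix_n hf
  obtain ⟨h, hh, e⟩ := D.symm_points hs (v := D.R₁ D.v₀) ⟨_, D.R₁_mem, rfl⟩
  rw [aff_apply] at e
  obtain ⟨k, hk'⟩ := D.face_vert_inner h hh
    (by rw [← e]; nth_rw 1 [← hn]; rw [g.inner_map_map, D.inner_n_w])
    (by rw [← e]; nth_rw 1 [← hv]; rw [g.inner_map_map])
  refine ⟨k, (inv_mul_eq_one.1 (D.eq_one ?_ ?_ ?_)).symm⟩
  · simp only [LinearIsometryEquiv.coe_mul, Function.comp, hv]
    nth_rw 1 [← D.pow_R₂_v k]; simp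
  · simp only [LinearIsometryEquiv.coe_mul, Function.comp, e, hk']; simp
  · simp only [LinearIsometryEquiv.coe_mul, Function.comp, hn]
    nth_rw 1 [← D.pow_R₂_n k]; simp

lemma zpowers_R₃ : (Subgroup.zpowers (aff D.R₃) : Set (E3 ≃ᵃⁱ[ℂ] E3)) =
    {s | D.poly.IsSymmetry s ∧ mapFlat s (D.vert 1) = D.vert 1 ∧ mapFlat s (D.edge 1) = D.edge 1} := by
  have hk : ∀ k : ℤ, aff (D.R₃ ^ k) ∈ {s | D.poly.IsSymmetry s ∧ mapFlat s (D.vert 1) = D.vert 1 ∧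
      mapFlat s (D.edge 1) = D.edge 1} := by
    intro k
    have : ∀ h ∈ Subgroup.closure {D.R₃}, D.vert h = D.vert 1 ∧ D.edge h = D.edge 1 := by
      refine closure_induction_step
        (p := fun h => D.vert h = D.vert 1 ∧ D.edge h = D.edge 1) ⟨rfl, rfl⟩ ?_
      rintro h _ r rfl
      rw [vert_mul_R₃, edge_mul_R₃]
    have h := this (D.R₃ ^ k) (zpow_mem (Subgroup.subset_closure (Set.mem_singleton _)) k)
    exact ⟨D.isSymmetry (zpow_mem D.R₃_mem k), by rw [map_vert, mul_one, h.1],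
      by rw [map_edge, mul_one, h.2]⟩
  refine coe_zpowers_eq _ _ hk (fun s hs => D.symm_linear hs.1) ?_
  rintro g ⟨hs, hv', he⟩
  have hv := D.fix_v hv'
  have hw := D.symm_w hs hv he
  obtain ⟨h, hh, e⟩ := D.symm_normals hs
  obtain ⟨k, hk'⟩ := D.edge_face h hh
    (by rw [← e]; nth_rw 1 [← hv]; rw [g.inner_map_map, D.inner_n_v])
    (by rw [← e]; nth_rw 1 [← hw]; rw [g.inner_map_map, D.inner_n_w])
  refine ⟨k, (inv_mul_eq_one.1 (D.eq_one ?_ ?_ ?_)).symm⟩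
  · simp only [LinearIsometryEquiv.coe_mul, Function.comp, hv]
    nth_rw 1 [← D.pow_R₃_v k]; simp
  · simp only [LinearIsometryEquiv.coe_mul, Function.comp, hw]
    nth_rw 1 [← D.pow_R₃_w k]; simp
  · simp only [LinearIsometryEquiv.coe_mul, Function.comp, e, hk']; simp

lemma altProd_map {Γ Δ : Type*} [Group Γ] [Group Δ] (f : Γ →* Δ) (g h : Γ) (n : ℕ) :
    altProd (f g) (f h) n = f (altProd g h n) := by
  induction n generalizing g h with
  | zero => simp [altProd]
  | succ n ih => simp [altProd, ih]

lemma isBraidLength_aff {g h : E3 ≃ₗᵢ[ℂ] E3} {q : ℕ} (H : IsBraidLength g h q) :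
    IsBraidLength (aff g) (aff h) q := by
  simpa only [IsBraidLength, altProd_map, aff_injective.eq_iff] using H

lemma isRotationGenerator_aff {R : E3 ≃ₗᵢ[ℂ] E3} {p : ℕ} {S : Set (E3 ≃ᵃⁱ[ℂ] E3)}
    (h1 : (Subgroup.zpowers (aff R) : Set (E3 ≃ᵃⁱ[ℂ] E3)) = S) (h2 : orderOf R = p)
    (h3 : LinearMap.det (R.toLinearEquiv : E3 →ₗ[ℂ] E3) = Complex.exp (2 * Real.pi * Complex.I / p)) :
    IsRotationGenerator (aff R) p S :=
  ⟨h1, by rw [orderOf_injective aff aff_injective, h2], h3⟩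

theorem isRegularOfType {p₁ q₁ p₂ q₂ p₃ : ℕ} (o₁ : orderOf D.R₁ = p₁) (o₂ : orderOf D.R₂ = p₂)
    (o₃ : orderOf D.R₃ = p₃)
    (d₁ : LinearMap.det (D.R₁.toLinearEquiv : E3 →ₗ[ℂ] E3) = Complex.exp (2 * Real.pi * Complex.I / p₁))
    (d₂ : LinearMap.det (D.R₂.toLinearEquiv : E3 →ₗ[ℂ] E3) = Complex.exp (2 * Real.pi * Complex.I / p₂))
    (d₃ : LinearMap.det (D.R₃.toLinearEquiv : E3 →ₗ[ℂ] E3) = Complex.exp (2 * Real.pi * Complex.I / p₃))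
    (b₁ : IsBraidLength D.R₁ D.R₂ q₁) (b₂ : IsBraidLength D.R₂ D.R₃ q₂) :
    D.poly.IsRegularOfType p₁ q₁ p₂ q₂ p₃ :=
  ⟨D.isRegular, _, _, _, aff D.R₁, aff D.R₂, aff D.R₃, D.isFlag_base,
    isRotationGenerator_aff D.zpowers_R₁ o₁ d₁, isRotationGenerator_aff D.zpowers_R₂ o₂ d₂,
    isRotationGenerator_aff D.zpowers_R₃ o₃ d₃, isBraidLength_aff b₁, isBraidLength_aff b₂, by
      rw [← map_mul, ← map_mul, D.comm]⟩

/-! ### Edges, their vertices and their centres -/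

lemma edges_poly : D.poly.edges = {e | ∃ g ∈ D.G, e = D.edge g} := by
  ext e
  constructor
  · rintro ⟨h, hd⟩
    exact D.exists_edge h hd
  · rintro ⟨g, hg, rfl⟩
    exact ⟨D.edge_mem hg, D.adim_edge g⟩

lemma vertsOn_edge {g : E3 ≃ₗᵢ[ℂ] E3} (hg : g ∈ D.G) :
    D.poly.vertsOn (D.edge g) = g '' Set.range fun k : ℕ => (D.R₁ ^ k) D.v₀ := by
  ext v
  rw [ComplexPolyhedron.vertsOn, D.verts_poly]
  constructor
  · rintro ⟨⟨h, hh, rfl⟩, hv⟩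
    obtain ⟨k, hk⟩ := D.vert_edge (g⁻¹ * h) (mul_mem (inv_mem hg) hh) <| by
      have := mapFlat_mono (aff g⁻¹) (ptFlat_le.2 hv)
      rw [mapFlat_ptFlat, map_edge, inv_mul_cancel] at this
      exact ptFlat_le.1 this
    exact ⟨_, ⟨k, rfl⟩, by dsimp only; rw [← hk]; simp⟩
  · rintro ⟨_, ⟨k, rfl⟩, rfl⟩
    refine ⟨⟨g * D.R₁ ^ k, mul_mem hg (pow_mem D.R₁_mem k), rfl⟩, ?_⟩
    rw [← D.edge_mul_R₁_pow g k]
    exact left_mem_affineSpan_pair ℂ _ _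

lemma edgeCenter_edge {g : E3 ≃ₗᵢ[ℂ] E3} (hg : g ∈ D.G) :
    D.poly.edgeCenter (D.edge g) = g (D.poly.edgeCenter (D.edge 1)) := by
  rw [ComplexPolyhedron.edgeCenter, ComplexPolyhedron.edgeCenter, D.vertsOn_edge hg,
    D.vertsOn_edge (one_mem _), LinearIsometryEquiv.coe_one, Set.image_id,
    Set.ncard_image_of_injective _ g.injective, finsum_mem_image g.injective.injOn, map_smul]
  congr 1
  have hf : (Set.range fun k : ℕ => (D.R₁ ^ k) D.v₀).Finite := by
    refine Set.Finite.subset D.finite_v ?_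
    rintro _ ⟨k, rfl⟩
    exact ⟨_, pow_mem D.R₁_mem k, rfl⟩
  exact ((g.toLinearEquiv : E3 →+ E3).map_finsum_mem _ hf).symm

lemma edgeCenters_poly :
    D.poly.edgeCenters = {x | ∃ g ∈ D.G, x = g (D.poly.edgeCenter (D.edge 1))} := by
  rw [ComplexPolyhedron.edgeCenters, D.edges_poly]
  ext x
  constructor
  · rintro ⟨_, ⟨g, hg, rfl⟩, rfl⟩
    exact ⟨g, hg, D.edgeCenter_edge hg⟩
  · rintro ⟨g, hg, rfl⟩
    exact ⟨_, ⟨g, hg, rfl⟩, D.edgeCenter_edge hg⟩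

end RegularSystem

/-! ### The cube root of unity -/

lemma eps_prim : IsPrimitiveRoot eps 3 := by
  have := Complex.isPrimitiveRoot_exp 3 (by norm_num)
  simpa [eps] using this

lemma eps_cube : eps ^ 3 = 1 := eps_prim.pow_eq_one

lemma eps_sum : eps ^ 2 + eps + 1 = 0 := by
  have h1 : eps - 1 ≠ 0 := sub_ne_zero.2 (eps_prim.ne_one (by norm_num))
  have h2 : (eps - 1) * (eps ^ 2 + eps + 1) = 0 := by linear_combination eps_cube
  exact (mul_eq_zero.1 h2).resolve_left h1

lemma eps_eq : eps = -1 / 2 + (Real.sqrt 3 : ℂ) / 2 * Complex.I := by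
  have h : (2 * Real.pi * Complex.I / 3 : ℂ) = ((Real.pi - Real.pi / 3 : ℝ) : ℂ) * Complex.I := by
    push_cast; ring
  rw [eps, h, Complex.exp_mul_I, ← Complex.ofReal_cos, ← Complex.ofReal_sin, Real.cos_pi_sub,
    Real.sin_pi_sub, Real.cos_pi_div_three, Real.sin_pi_div_three]
  push_cast; ring

/-- `i√3 = 1 + 2ε`. -/
lemma I_sqrt_three : Complex.I * (Real.sqrt 3 : ℂ) = 1 + 2 * eps := by rw [eps_eq]; ring

lemma star_eps : (starRingEnd ℂ) eps = -1 - eps := by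
  rw [eps_eq]; simp only [map_add, map_mul, map_div₀, map_neg, map_one, map_ofNat, Complex.conj_I,
    Complex.conj_ofReal]; ring

lemma scale_E : (1 / (Complex.I * (Real.sqrt 3 : ℂ))) = -(1 + 2 * eps) / 3 := by
  have h : (1 + 2 * eps) * (1 + 2 * eps) = -3 := by linear_combination 4 * eps_sum
  have h0 : (1 + 2 * eps) ≠ 0 := fun h0 => by rw [h0] at h; norm_num at h
  rw [I_sqrt_three, div_eq_div_iff h0 (by norm_num)]
  linear_combination h

/-- The character `k ↦ ε ^ k` of `ℤ/3`. -/
def w (k : ZMod 3) : ℂ := eps ^ k.val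

lemma w_zero : w 0 = 1 := by simp [w]
lemma w_one : w 1 = eps := by simp [w, ZMod.val_one]
lemma w_two : w 2 = eps ^ 2 := rfl

lemma w_add (a b : ZMod 3) : w (a + b) = w a * w b := by
  rw [w, w, w, ← pow_add, ZMod.val_add]
  conv_rhs => rw [← pow_mod_orderOf, ← eps_prim.eq_orderOf]

lemma w_cube (a : ZMod 3) : w a ^ 3 = 1 := by
  rw [w, ← pow_mul, mul_comm, pow_mul, eps_cube, one_pow]

lemma w_ne_zero (a : ZMod 3) : w a ≠ 0 := fun h => by simpa [h] using w_cube a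

lemma w_injective : Function.Injective w := fun a b h =>
  ZMod.val_injective 3 (eps_prim.pow_inj (ZMod.val_lt a) (ZMod.val_lt b) h)

lemma exists_w {z : ℂ} (h : z ^ 3 = 1) : ∃ k, z = w k := by
  obtain ⟨i, hi, rfl⟩ := eps_prim.eq_pow_of_pow_eq_one h
  exact ⟨(i : ZMod 3), by rw [w, ZMod.val_natCast, Nat.mod_eq_of_lt hi]⟩

lemma exists_w_mul {y z : ℂ} (h : y ^ 3 = z ^ 3) : ∃ k, y = w k * z := by
  by_cases hz : z = 0
  · refine ⟨0, ?_⟩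
    rw [hz, zero_pow (by norm_num)] at h
    rw [hz, mul_zero]; exact pow_eq_zero_iff (by norm_num) |>.1 h
  · obtain ⟨k, hk⟩ := exists_w (z := y / z) (by rw [div_pow, h, div_self (pow_ne_zero _ hz)])
    exact ⟨k, by rw [← hk, div_mul_cancel₀ _ hz]⟩

/-! ### The monomial elements of `K` -/

lemma act_ext {g h : GL (Fin 3) ℂ} (H : ∀ x, act g x = act h x) : g = h := by
  ext i j
  have := congrFun (congrArg WithLp.ofLp (H (WithLp.toLp 2 (Pi.single j 1)))) i
  simpa [act] using this

lemma act_apply (g : GL (Fin 3) ℂ) (x : E3) (i : Fin 3) :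
    act g x i = g i 0 * x 0 + g i 1 * x 1 + g i 2 * x 2 := by
  simp [act, Matrix.mulVec, dotProduct, Fin.sum_univ_three]

lemma act_smul (g : GL (Fin 3) ℂ) (c : ℂ) (x : E3) : act g (c • x) = c • act g x := by
  ext i; simp only [act_apply, PiLp.smul_apply, smul_eq_mul]; ring

lemma act_neg (g : GL (Fin 3) ℂ) (x : E3) : act g (-x) = -act g x := by
  ext i; simp only [act_apply, PiLp.neg_apply]; ring

lemma act_inv_act (g : GL (Fin 3) ℂ) (x : E3) : act g⁻¹ (act g x) = x := by
  rw [← act_mul, inv_mul_cancel, act_one]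

/-- The sign of a permutation, as a complex number. -/
def sg (σ : Equiv.Perm (Fin 3)) : ℂ := ((Equiv.Perm.sign σ : ℤˣ) : ℤ)

lemma sg_mul (σ τ : Equiv.Perm (Fin 3)) : sg (σ * τ) = sg σ * sg τ := by simp [sg]
lemma sg_one : sg 1 = 1 := by simp [sg]
lemma sg_sq (σ : Equiv.Perm (Fin 3)) : sg σ ^ 2 = 1 := by
  rw [sq, ← sg_mul, sg, Equiv.Perm.sign_mul, Int.units_mul_self]; simp

/-- The monomial matrix with entries `± ε ^ α i` in the places `(i, σ i)`, the sign being that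
of `σ`. -/
def monoMat (σ : Equiv.Perm (Fin 3)) (α : Fin 3 → ZMod 3) : Matrix (Fin 3) (Fin 3) ℂ :=
  Matrix.of fun i j => if j = σ i then sg σ * w (α i) else 0

lemma monoMat_mul (σ τ : Equiv.Perm (Fin 3)) (α β : Fin 3 → ZMod 3) :
    monoMat σ α * monoMat τ β = monoMat (τ * σ) (α + β ∘ σ) := by
  ext i j
  simp only [Matrix.mul_apply, monoMat, Matrix.of_apply, ite_mul, zero_mul, Finset.sum_ite_eq',
    Finset.mem_univ, if_true, Equiv.Perm.mul_apply, Pi.add_apply,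
    Function.comp, w_add, sg_mul]
  split_ifs <;> ring

lemma monoMat_one : monoMat 1 0 = 1 := by
  ext i j
  simp [monoMat, Matrix.one_apply, sg_one, w_zero, eq_comm]

/-- The invertible monomial matrices. -/
def mono (σ : Equiv.Perm (Fin 3)) (α : Fin 3 → ZMod 3) : GL (Fin 3) ℂ where
  val := monoMat σ α
  inv := monoMat σ⁻¹ (-(α ∘ ⇑σ⁻¹))
  val_inv := by
    rw [monoMat_mul, inv_mul_cancel, ← monoMat_one]; congr 1; ext i; simp
  inv_val := by
    rw [monoMat_mul, mul_inv_cancel, ← monoMat_one]; congr 1; ext i; simp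

lemma mono_mul (σ τ : Equiv.Perm (Fin 3)) (α β : Fin 3 → ZMod 3) :
    mono σ α * mono τ β = mono (τ * σ) (α + β ∘ σ) := Units.ext (monoMat_mul σ τ α β)

lemma mono_one : mono 1 0 = 1 := Units.ext monoMat_one

lemma act_mono (σ : Equiv.Perm (Fin 3)) (α : Fin 3 → ZMod 3) (x : E3) (i : Fin 3) :
    act (mono σ α) x i = sg σ * w (α i) * x (σ i) := by
  simp [act, Matrix.mulVec, dotProduct, mono, monoMat, ite_mul]

/-- The diagonal matrix with entries `ε ^ k, 1, 1`. -/
def gD (k : ZMod 3) : GL (Fin 3) ℂ := mono 1 ![k, 0, 0]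

/-- The cyclic permutation `i ↦ i + 1`. -/
abbrev rot : Equiv.Perm (Fin 3) := finRotate 3

/-- The transposition of the last two indices. -/
abbrev tr : Equiv.Perm (Fin 3) := Equiv.swap 1 2

lemma sg_rot : sg rot = 1 := by
  have : Equiv.Perm.sign rot = 1 := by decide
  simp [sg, this]
lemma sg_rot' : sg (rot * rot) = 1 := by rw [sg_mul, sg_rot, one_mul]
lemma sg_tr : sg tr = -1 := by
  have : Equiv.Perm.sign tr = -1 := by decide
  simp [sg, this]

lemma matE_eq : matE = (-(1 + 2 * eps) / 3) • !![1, 1, 1; 1, eps, eps ^ 2; 1, eps ^ 2, eps] := by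
  rw [matE, scale_E]

lemma det_matE : matE.det ≠ 0 := by
  have : matE.det = 1 := by
    rw [matE_eq, Matrix.det_smul, Matrix.det_fin_three]
    simp
    have := eps_sum
    grind
  rw [this]; exact one_ne_zero

def gE : GL (Fin 3) ℂ := Matrix.GeneralLinearGroup.mkOfDetNeZero matE det_matE

lemma gE_coe : (gE : Matrix (Fin 3) (Fin 3) ℂ) = matE := rfl

lemma act_E (x : E3) (i : Fin 3) : act gE x i =
    -(1 + 2 * eps) / 3 * ![x 0 + x 1 + x 2, x 0 + eps * x 1 + eps ^ 2 * x 2,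
      x 0 + eps ^ 2 * x 1 + eps * x 2] i := by
  rw [act_apply, gE_coe, matE_eq]
  fin_cases i <;> simp <;> ring

lemma mono_rot_coe : (mono rot 0 : Matrix (Fin 3) (Fin 3) ℂ) = matA := by
  ext i j
  change monoMat _ _ _ _ = _
  fin_cases i <;> fin_cases j <;> simp [monoMat, matA, sg_rot, w_zero] 

lemma mono_C_coe : (mono 1 ![0, 1, 2] : Matrix (Fin 3) (Fin 3) ℂ) = matC := by
  ext i j
  change monoMat _ _ _ _ = _
  fin_cases i <;> fin_cases j <;> simp [monoMat, matC, sg_one, w_zero, w_one, w_two]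

lemma mono_D_coe : (mono 1 ![0, 1, 1] : Matrix (Fin 3) (Fin 3) ℂ) = matD := by
  ext i j
  change monoMat _ _ _ _ = _
  fin_cases i <;> fin_cases j <;> simp [monoMat, matD, sg_one, w_zero, w_one]

lemma groupK_eq : groupK = Subgroup.closure {mono rot 0, mono 1 ![0, 1, 2], mono 1 ![0, 1, 1], gE} := by
  rw [groupK]
  congr 1
  ext g
  simp only [Set.mem_ofPred_eq, Set.mem_insert_iff, Set.mem_singleton_iff, ← mono_rot_coe,
    ← mono_C_coe, ← mono_D_coe, ← gE_coe, Units.val_inj]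

lemma mono_rot_mem : mono rot 0 ∈ groupK := by
  rw [groupK_eq]; exact Subgroup.subset_closure (by simp)
lemma mono_C_mem : mono 1 ![0, 1, 2] ∈ groupK := by
  rw [groupK_eq]; exact Subgroup.subset_closure (by simp)
lemma mono_D_mem : mono 1 ![0, 1, 1] ∈ groupK := by
  rw [groupK_eq]; exact Subgroup.subset_closure (by simp)
lemma gE_mem : gE ∈ groupK := by
  rw [groupK_eq]; exact Subgroup.subset_closure (by simp)


lemma gE_mul_gE : gE * gE = mono tr 0 := by
  have h := eps_sum
  refine act_ext fun x => ?_
  ext i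
  rw [act_mul, act_E, act_mono]
  fin_cases i <;> simp [act_E, sg_tr, w_zero] <;> grind

/-- Membership in the union of the cosets `N` and `N * gE * gD k` of the group `N` of monomial
matrices. -/
def IsNormal (g : GL (Fin 3) ℂ) : Prop :=
  (∃ σ α, g = mono σ α) ∨ ∃ σ α k, g = mono σ α * gE * gD k

lemma IsNormal.mono_mul {g : GL (Fin 3) ℂ} (hg : IsNormal g) (σ α) : IsNormal (mono σ α * g) := by
  rcases hg with ⟨τ, β, rfl⟩ | ⟨τ, β, k, rfl⟩
  · exact .inl ⟨_, _, Qutrit.mono_mul _ _ _ _⟩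
  · exact .inr ⟨_, _, k, by rw [← mul_assoc, ← mul_assoc, Qutrit.mono_mul]⟩

lemma zmod_three_cases (k : ZMod 3) : k = 0 ∨ k = 1 ∨ k = 2 := by revert k; decide

lemma gE_gD_A (k : ZMod 3) : IsNormal (gE * gD k * mono rot 0) := by
  have h := eps_sum
  suffices ∃ σ α, gE * gD k * mono rot 0 = mono σ α * gE * gD k from
    let ⟨σ, α, e⟩ := this; .inr ⟨σ, α, k, e⟩
  rcases zmod_three_cases k with rfl | rfl | rfl
  · refine ⟨1, ![0, 2, 1], act_ext fun x => ?_⟩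
    ext i
    simp only [act_mul, act_mono, gD, act_E]
    fin_cases i <;> simp [sg_one, sg_rot, w_zero, w_one, w_two] <;> grind
  · refine ⟨rot * rot, ![2, 1, 0], act_ext fun x => ?_⟩
    ext i
    simp only [act_mul, act_mono, gD, act_E]
    fin_cases i <;> simp [sg_one, sg_rot, sg_rot', w_zero, w_one, w_two] <;> grind
  · refine ⟨rot, ![1, 0, 2], act_ext fun x => ?_⟩
    ext i
    simp only [act_mul, act_mono, gD, act_E]
    fin_cases i <;> simp [sg_one, sg_rot, w_zero, w_one, w_two] <;> grind

lemma gE_C : gE * mono 1 ![0, 1, 2] = mono rot 0 * gE := by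
  have h := eps_sum
  refine act_ext fun x => ?_
  ext i
  simp only [act_mul, act_mono, act_E]
  fin_cases i <;> simp [sg_one, sg_rot, w_zero, w_one, w_two] <;> grind

lemma gE_gD_C (k : ZMod 3) : IsNormal (gE * gD k * mono 1 ![0, 1, 2]) := by
  have : gD k * mono 1 ![0, 1, 2] = mono 1 ![0, 1, 2] * gD k := by
    rw [gD, mono_mul, mono_mul]; congr 1; ext i; fin_cases i <;> simp
  exact .inr ⟨rot, 0, k, by rw [mul_assoc, this, ← mul_assoc, gE_C]⟩

lemma gE_gD_D (k : ZMod 3) : IsNormal (gE * gD k * mono 1 ![0, 1, 1]) := by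
  have h1 : gD k * mono 1 ![0, 1, 1] = mono 1 (fun _ => 1) * gD (k - 1) := by
    rw [gD, gD, mono_mul, mono_mul]; congr 1; ext i; fin_cases i <;> simp
  have h2 : gE * mono 1 (fun _ => 1) = mono 1 (fun _ => 1) * gE := by
    refine act_ext fun x => ?_
    ext i
    simp only [act_mul, act_mono, act_E]
    fin_cases i <;> simp [sg_one, w_one] <;> ring
  exact .inr ⟨1, fun _ => 1, k - 1, by rw [mul_assoc, h1, ← mul_assoc, h2]⟩

/-- The braid relation behind these identities: `gE = gD 1 * s * gD 1` for a reflection `s`. -/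
lemma gE_gD_E (k : ZMod 3) : IsNormal (gE * gD k * gE) := by
  have h := eps_sum
  have t0 : tr 0 = 0 := by decide
  rcases zmod_three_cases k with rfl | rfl | rfl
  · refine .inl ⟨tr, 0, ?_⟩
    have : gD 0 = 1 := by
      rw [gD, ← mono_one]; congr 1; ext i; fin_cases i <;> rfl
    rw [this, mul_one, gE_mul_gE]
  · refine .inr ⟨tr, ![2, 0, 0], 2, act_ext fun x => ?_⟩
    ext i
    simp only [act_mul, act_mono, gD, act_E]
    fin_cases i <;> simp [sg_one, sg_tr, w_zero, w_one, w_two, t0] <;> grind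
  · refine .inr ⟨1, ![1, 0, 0], 1, act_ext fun x => ?_⟩
    ext i
    simp only [act_mul, act_mono, gD, act_E]
    fin_cases i <;> simp [sg_one, w_zero, w_one, w_two] <;> grind

lemma gD_zero : gD 0 = 1 := by
  rw [gD, ← mono_one]; congr 1; ext i; fin_cases i <;> rfl

lemma IsNormal.mul_gen {g r : GL (Fin 3) ℂ} (hg : IsNormal g)
    (hr : r ∈ ({mono rot 0, mono 1 ![0, 1, 2], mono 1 ![0, 1, 1], gE} : Set (GL (Fin 3) ℂ))) :
    IsNormal (g * r) := by
  rcases hg with ⟨σ, α, rfl⟩ | ⟨σ, α, k, rfl⟩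
  · rcases hr with rfl | rfl | rfl | rfl
    iterate 3 exact .inl ⟨_, _, Qutrit.mono_mul _ _ _ _⟩
    exact .inr ⟨σ, α, 0, by rw [gD_zero, mul_one]⟩
  · rw [mul_assoc, mul_assoc, ← mul_assoc gE]
    refine IsNormal.mono_mul ?_ σ α
    rcases hr with rfl | rfl | rfl | rfl
    exacts [gE_gD_A k, gE_gD_C k, gE_gD_D k, gE_gD_E k]

lemma gE_pow : gE ^ 4 = 1 := by
  have : gE ^ 4 = (gE * gE) * (gE * gE) := by simp only [pow_succ, pow_zero, one_mul, mul_assoc]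
  rw [this, gE_mul_gE, mono_mul, Equiv.swap_mul_self, ← mono_one]
  congr 1

lemma gen_pow {r : GL (Fin 3) ℂ}
    (hr : r ∈ ({mono rot 0, mono 1 ![0, 1, 2], mono 1 ![0, 1, 1], gE} : Set (GL (Fin 3) ℂ))) :
    r ^ 12 = 1 := by
  have key : ∀ σ α, mono σ α ^ 3 = mono (σ * (σ * σ)) (α + (α + α ∘ σ) ∘ σ) := fun σ α => by
    rw [pow_succ', pow_two, mono_mul, mono_mul, mul_assoc]
  have h3 : r ^ 3 = 1 ∨ r ^ 4 = 1 := by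
    rcases hr with rfl | rfl | rfl | rfl
    iterate 3 left; (rw [key, ← mono_one]; congr 1; decide)
    exact .inr gE_pow
  rcases h3 with h | h
  · rw [show 12 = 3 * 4 from rfl, pow_mul, h, one_pow]
  · rw [show 12 = 4 * 3 from rfl, pow_mul, h, one_pow]

/-- Every element of `K` is a monomial matrix, or one times some `gE * gD k`. -/
lemma isNormal_of_mem {g : GL (Fin 3) ℂ} (hg : g ∈ groupK) : IsNormal g := by
  rw [groupK_eq] at hg
  have hp : ∀ (n : ℕ) (h r : GL (Fin 3) ℂ), r ∈ ({mono rot 0, mono 1 ![0, 1, 2],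
      mono 1 ![0, 1, 1], gE} : Set (GL (Fin 3) ℂ)) → IsNormal h → IsNormal (h * r ^ n) := by
    intro n h r hr hh
    induction n with
    | zero => simpa
    | succ n ih => rw [pow_succ, ← mul_assoc]; exact ih.mul_gen hr
  refine RegularSystem.closure_induction_step (p := IsNormal) (.inl ⟨1, 0, mono_one.symm⟩) ?_ g hg
  intro h _ r hr
  refine ⟨fun H => H.mul_gen hr, fun H => ?_⟩
  have := hp 11 _ r hr H
  rwa [mul_assoc, ← pow_succ', gen_pow hr, mul_one] at this

lemma mono_mem (σ : Equiv.Perm (Fin 3)) (α : Fin 3 → ZMod 3) : mono σ α ∈ groupK := by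
  have hT : mono tr 0 ∈ groupK := gE_mul_gE ▸ mul_mem gE_mem gE_mem
  have hP : ∀ σ : Equiv.Perm (Fin 3), mono σ 0 ∈ groupK := by
    intro σ
    obtain ⟨i, j, rfl⟩ : ∃ i j : Fin 3, σ = tr ^ (j : ℕ) * rot ^ (i : ℕ) := by
      revert σ; decide
    have hpow : ∀ (τ : Equiv.Perm (Fin 3)) (n : ℕ), mono τ 0 ^ n = mono (τ ^ n) 0 := by
      intro τ n
      induction n with
      | zero => simp [mono_one]
      | succ n ih => rw [pow_succ, ih, mono_mul, ← pow_succ']; congr 1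
    have := mul_mem (pow_mem mono_rot_mem (i : ℕ)) (pow_mem hT (j : ℕ))
    rw [hpow, hpow, mono_mul] at this
    convert this using 2; ext; simp
  have hadd : ∀ α β, mono 1 α ∈ groupK → mono 1 β ∈ groupK → mono 1 (α + β) ∈ groupK := by
    intro α β ha hb
    have := mul_mem ha hb
    rwa [mono_mul, one_mul] at this
  have hsmul : ∀ (α : Fin 3 → ZMod 3), mono 1 α ∈ groupK → ∀ n : ℕ, mono 1 (n • α) ∈ groupK := by
    intro α ha n
    induction n with
    | zero => rw [zero_smul, mono_one]; exact one_mem _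
    | succ n ih => rw [add_smul, one_smul]; exact hadd _ _ ih ha
  have h3 : mono 1 ![1, 0, 1] ∈ groupK := by
    have := mul_mem (mul_mem (hP rot⁻¹) mono_D_mem) (hP rot)
    rw [mono_mul, mono_mul] at this
    convert this using 2 <;> decide
  have hD : mono 1 α ∈ groupK := by
    obtain ⟨a, b, c, rfl⟩ : ∃ a b c : Fin 3, α = (a : ℕ) • ![0, 1, 2] + (b : ℕ) • ![0, 1, 1] +
        (c : ℕ) • ![1, 0, 1] := by revert α; decide
    exact hadd _ _ (hadd _ _ (hsmul _ mono_C_mem _) (hsmul _ mono_D_mem _)) (hsmul _ h3 _)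
  have := mul_mem hD (hP σ)
  rw [mono_mul] at this
  convert this using 2 <;> simp

lemma gD_mem (k : ZMod 3) : gD k ∈ groupK := mono_mem _ _

/-! ### Invariants of `K` -/

/-- The invariant of degree `6`. -/
def C6 (x : E3) : ℂ := psi x ^ 2 - 12 * chi x
/-- The invariant of degree `12`. -/
def C12 (x : E3) : ℂ := psi x ^ 4 + lam x * psi x
/-- The invariant of degree `18`. -/
def C18 (x : E3) : ℂ := psi x ^ 6 - 5 / 2 * lam x * psi x ^ 3 - 1 / 8 * lam x ^ 2

/-- A cube root of `lam x`. -/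
def mu (x : E3) : ℂ := 6 * (x 0 * x 1 * x 2)

lemma lam_eq (x : E3) : lam x = mu x ^ 3 := by rw [lam, mu]; ring

lemma mem_solutions {a b c : ℂ} {x : E3} :
    x ∈ solutions a b c ↔ C6 x = a ∧ C12 x = b ∧ C18 x = c := by
  simp only [solutions, Set.mem_ofPred_eq, C6, C12, C18, sub_eq_zero]

/-- The relation between the invariants. -/
lemma C9_sq (x : E3) : 432 * C9 x ^ 2 = C6 x ^ 3 - 3 * C6 x * C12 x + 2 * C18 x := by
  simp only [C9, C6, C12, C18, psi, chi, lam]; ring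

/-- The discriminant of the arrangement of the mirrors of order three. -/
lemma C12_C18 (x : E3) : 64 * (C12 x ^ 3 - C18 x ^ 2) = lam x * (8 * psi x ^ 3 - lam x) ^ 3 := by
  simp only [C12, C18]; ring

lemma psi_mono (σ : Equiv.Perm (Fin 3)) (α : Fin 3 → ZMod 3) (x : E3) :
    psi (act (mono σ α) x) = sg σ * psi x := by
  have h3 : sg σ ^ 3 = sg σ := by rw [pow_succ, sg_sq, one_mul]
  have := Equiv.sum_comp σ (fun i => x i ^ 3)
  rw [Fin.sum_univ_three, Fin.sum_univ_three] at this
  simp only [psi, act_mono, mul_pow, w_cube, h3, mul_one]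
  rw [← mul_add, ← mul_add, this]

lemma cube_mono (σ : Equiv.Perm (Fin 3)) (α : Fin 3 → ZMod 3) (x : E3) (i : Fin 3) :
    act (mono σ α) x i ^ 3 = sg σ * x (σ i) ^ 3 := by
  have h3 : sg σ ^ 3 = sg σ := by rw [pow_succ, sg_sq, one_mul]
  simp only [act_mono, mul_pow, w_cube, h3, mul_one]

lemma lam_mono (σ : Equiv.Perm (Fin 3)) (α : Fin 3 → ZMod 3) (x : E3) :
    lam (act (mono σ α) x) = sg σ * lam x := by
  have h3 : sg σ ^ 3 = sg σ := by rw [pow_succ, sg_sq, one_mul]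
  have := Equiv.prod_comp σ (fun i => x i ^ 3)
  rw [Fin.prod_univ_three, Fin.prod_univ_three] at this
  simp only [lam, cube_mono]
  linear_combination 216 * (x (σ 0) ^ 3 * x (σ 1) ^ 3 * x (σ 2) ^ 3) * h3 + 216 * sg σ * this

lemma chi_eq (x : E3) : 2 * chi x = psi x ^ 2 - ∑ i, (x i ^ 3) ^ 2 := by
  rw [Fin.sum_univ_three, chi, psi]; ring

lemma chi_mono (σ : Equiv.Perm (Fin 3)) (α : Fin 3 → ZMod 3) (x : E3) :
    chi (act (mono σ α) x) = chi x := by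
  have h2 : (2 : ℂ) ≠ 0 := by norm_num
  refine mul_left_cancel₀ h2 ?_
  rw [chi_eq, chi_eq, psi_mono]
  simp only [cube_mono, mul_pow, sg_sq, one_mul]
  rw [Equiv.sum_comp σ (fun i => (x i ^ 3) ^ 2)]

/-- The value of `I₉` is a Vandermonde determinant in the cubes of the coordinates. -/
lemma C9_mono (σ : Equiv.Perm (Fin 3)) (α : Fin 3 → ZMod 3) (x : E3) :
    C9 (act (mono σ α) x) = C9 x := by
  have hdet : ∀ y : Fin 3 → ℂ, (y 0 - y 1) * (y 0 - y 2) * (y 1 - y 2) =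
      -(Matrix.vandermonde y).det := fun y => by
    rw [Matrix.det_fin_three]; simp [Matrix.vandermonde]; ring
  have h := hdet fun i => x (σ i) ^ 3
  have h' := hdet fun i => x i ^ 3
  have e : Matrix.vandermonde (fun i => x (σ i) ^ 3) =
    (Matrix.vandermonde fun i => x i ^ 3).submatrix σ id := rfl
  rw [e, Matrix.det_permute] at h
  simp only [C9, cube_mono]
  have h4 : sg σ ^ 4 = 1 := by rw [show 4 = 2 * 2 from rfl, pow_mul, sg_sq, one_pow]
  simp only [← sg.eq_1] at h
  linear_combination sg σ ^ 3 * h - sg σ ^ 4 * h' +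
    ((x 0 ^ 3 - x 1 ^ 3) * (x 0 ^ 3 - x 2 ^ 3) * (x 1 ^ 3 - x 2 ^ 3)) * h4

lemma act_E0 (x : E3) : act gE x 0 = -(1 + 2 * eps) / 3 * (x 0 + x 1 + x 2) := act_E x 0
lemma act_E1 (x : E3) : act gE x 1 = -(1 + 2 * eps) / 3 * (x 0 + eps * x 1 + eps ^ 2 * x 2) :=
  act_E x 1
lemma act_E2 (x : E3) : act gE x 2 = -(1 + 2 * eps) / 3 * (x 0 + eps ^ 2 * x 1 + eps * x 2) :=
  act_E x 2

lemma psi_E (x : E3) : psi (act gE x) = (1 + 2 * eps) / 3 * (psi x + mu x) := by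
  have h := eps_sum
  simp only [psi, mu, act_E0, act_E1, act_E2]
  grind

lemma mu_E (x : E3) : mu (act gE x) = (1 + 2 * eps) / 3 * (2 * psi x - mu x) := by
  have h := eps_sum
  simp only [psi, mu, act_E0, act_E1, act_E2]
  grind

lemma theta_sq : ((1 + 2 * eps) / 3) ^ 2 = -1 / 3 := by
  have h := eps_sum
  grind

lemma theta_ne_zero : 1 + 2 * eps ≠ 0 := fun h => by
  have := theta_sq
  rw [h] at this
  norm_num at this

lemma C12_E (x : E3) : C12 (act gE x) = C12 x := by
  have h := theta_sq
  simp only [C12, lam_eq, psi_E, mu_E]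
  generalize (1 + 2 * eps) / 3 = t at *
  have h4 : t ^ 4 = 1 / 9 := by linear_combination (t ^ 2 - 1 / 3) * h
  linear_combination ((psi x + mu x) ^ 4 + (2 * psi x - mu x) ^ 3 * (psi x + mu x)) * h4

lemma C18_E (x : E3) : C18 (act gE x) = C18 x := by
  have h := theta_sq
  simp only [C18, lam_eq, psi_E, mu_E]
  generalize (1 + 2 * eps) / 3 = t at *
  have h6 : t ^ 6 = -1 / 27 := by linear_combination (t ^ 4 - t ^ 2 / 3 + 1 / 9) * h
  linear_combination ((psi x + mu x) ^ 6 - 5 / 2 * (2 * psi x - mu x) ^ 3 * (psi x + mu x) ^ 3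
    - 1 / 8 * (2 * psi x - mu x) ^ 6) * h6

/-- The differences of the cubes of the coordinates of `act gE x` are products of linear forms. -/
lemma sub_cubes_E (x : E3) : act gE x 0 ^ 3 - act gE x 1 ^ 3 = (1 + 2 * eps) / 9 * (1 - eps) ^ 3 *
      ((x 0 - eps ^ 2 * x 1) * (x 1 - eps ^ 2 * x 2) * (x 2 - eps ^ 2 * x 0)) ∧
    act gE x 0 ^ 3 - act gE x 2 ^ 3 = (1 + 2 * eps) / 9 * (1 - eps ^ 2) ^ 3 *
      ((x 0 - eps * x 1) * (x 1 - eps * x 2) * (x 2 - eps * x 0)) ∧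
    act gE x 1 ^ 3 - act gE x 2 ^ 3 = -((x 0 - x 1) * (x 0 - x 2) * (x 1 - x 2)) := by
  have h := eps_sum
  rw [act_E0, act_E1, act_E2]
  refine ⟨?_, ?_, ?_⟩ <;> grind

lemma C6_eq (x : E3) : C6 x = -3 * psi x ^ 2 + 2 * ((x 0 ^ 3 - x 1 ^ 3) ^ 2 +
    (x 0 ^ 3 - x 2 ^ 3) ^ 2 + (x 1 ^ 3 - x 2 ^ 3) ^ 2) := by
  simp only [C6, psi, chi]; ring

lemma C6_E (x : E3) : C6 (act gE x) = C6 x := by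
  have h := eps_sum
  obtain ⟨h1, h2, h3⟩ := sub_cubes_E x
  have c1 : ((1 + 2 * eps) / 9 * (1 - eps) ^ 3) ^ 2 = 1 := by grind
  have c2 : ((1 + 2 * eps) / 9 * (1 - eps ^ 2) ^ 3) ^ 2 = 1 := by grind
  rw [C6_eq, h1, h2, h3, psi_E, mul_pow _ (psi x + mu x), theta_sq,
    mul_pow ((1 + 2 * eps) / 9 * (1 - eps) ^ 3), c1, mul_pow ((1 + 2 * eps) / 9 * (1 - eps ^ 2) ^ 3), c2,
    C6, psi, chi, mu]
  grind

lemma C9_E (x : E3) : C9 (act gE x) = C9 x := by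
  have h := eps_sum
  obtain ⟨h1, h2, h3⟩ := sub_cubes_E x
  have f : ∀ y z : ℂ, y ^ 3 - z ^ 3 = (y - z) * (y - eps * z) * (y - eps ^ 2 * z) := by
    intro y z; grind
  have c : (1 + 2 * eps) / 9 * (1 - eps) ^ 3 * ((1 + 2 * eps) / 9 * (1 - eps ^ 2) ^ 3) = -1 := by
    grind
  have e : ∀ k l : ℂ, k * l = 1 → x 2 - k * x 0 = -k * (x 0 - l * x 2) := fun k l hkl => by
    linear_combination -hkl * x 2
  have e12 : eps * eps ^ 2 = 1 := by linear_combination eps_cube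
  rw [C9, h1, h2, h3, C9, f, f, f, e _ _ e12, e _ _ ((mul_comm _ _).trans e12)]
  generalize x 0 - x 1 = p₁, x 0 - eps * x 1 = p₂, x 0 - eps ^ 2 * x 1 = p₃, x 0 - x 2 = q₁,
    x 0 - eps * x 2 = q₂, x 0 - eps ^ 2 * x 2 = q₃, x 1 - x 2 = r₁, x 1 - eps * x 2 = r₂,
    x 1 - eps ^ 2 * x 2 = r₃
  linear_combination (-(eps * eps ^ 2) * (p₁ * p₂ * p₃ * q₁ * q₂ * q₃ * r₁ * r₂ * r₃)) * c +
    (p₁ * p₂ * p₃ * q₁ * q₂ * q₃ * r₁ * r₂ * r₃) * e12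

/-- All four invariants take the same values on a `K`-orbit. -/
lemma invariants_act {g : GL (Fin 3) ℂ} (hg : g ∈ groupK) (x : E3) :
    C6 (act g x) = C6 x ∧ C9 (act g x) = C9 x ∧ C12 (act g x) = C12 x ∧ C18 (act g x) = C18 x := by
  have hmono : ∀ σ α (y : E3), C6 (act (mono σ α) y) = C6 y ∧ C9 (act (mono σ α) y) = C9 y ∧
      C12 (act (mono σ α) y) = C12 y ∧ C18 (act (mono σ α) y) = C18 y := by
    intro σ α y
    refine ⟨?_, C9_mono σ α y, ?_, ?_⟩
    · rw [C6, psi_mono, chi_mono, mul_pow, sg_sq, one_mul, C6]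
    · rw [C12, psi_mono, lam_mono, C12]
      linear_combination (lam y * psi y + psi y ^ 4 * (sg σ ^ 2 + 1)) * sg_sq σ
    · rw [C18, psi_mono, lam_mono, C18]
      linear_combination (-5 / 2 * lam y * psi y ^ 3 * (sg σ ^ 2 + 1) - 1 / 8 * lam y ^ 2 +
        psi y ^ 6 * (sg σ ^ 4 + sg σ ^ 2 + 1)) * sg_sq σ
  have hE : ∀ y : E3, C6 (act gE y) = C6 y ∧ C9 (act gE y) = C9 y ∧ C12 (act gE y) = C12 y ∧
      C18 (act gE y) = C18 y := fun y => ⟨C6_E y, C9_E y, C12_E y, C18_E y⟩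
  rcases isNormal_of_mem hg with ⟨σ, α, rfl⟩ | ⟨σ, α, k, rfl⟩
  · exact hmono σ α x
  · obtain ⟨a1, a2, a3, a4⟩ := hmono σ α (act gE (act (gD k) x))
    obtain ⟨b1, b2, b3, b4⟩ := hE (act (gD k) x)
    obtain ⟨c1, c2, c3, c4⟩ := hmono 1 ![k, 0, 0] x
    rw [act_mul, act_mul]
    exact ⟨a1.trans (b1.trans c1), a2.trans (b2.trans c2), a3.trans (b3.trans c3),
      a4.trans (b4.trans c4)⟩

/-! ### The invariants separate the orbits -/

lemma psi_gE_gD (k : ZMod 3) (x : E3) :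
    psi (act (gE * gD k) x) = (1 + 2 * eps) / 3 * (psi x + w k * mu x) := by
  have : mu (act (gD k) x) = w k * mu x := by
    simp [mu, gD, act_mono, sg_one, w_zero]; ring
  rw [act_mul, psi_E, this, gD, psi_mono, sg_one, one_mul]

lemma psi_sq_gE_gD (k : ZMod 3) (x : E3) :
    psi (act (gE * gD k) x) ^ 2 = -(psi x + w k * mu x) ^ 2 / 3 := by
  rw [psi_gE_gD, mul_pow, theta_sq]; ring

/-- The roots of the quartic are the values of `ψ ^ 2` at four points of the orbit. -/
lemma quartic_eq (x : E3) (X : ℂ) :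
    27 * X ^ 4 - 18 * C12 x * X ^ 2 - 8 * C18 x * X - C12 x ^ 2 =
      27 * (X - psi x ^ 2) * (X + (psi x + w 0 * mu x) ^ 2 / 3) *
        (X + (psi x + w 1 * mu x) ^ 2 / 3) * (X + (psi x + w 2 * mu x) ^ 2 / 3) := by
  have h := eps_sum
  rw [w_zero, w_one, w_two, C12, C18, lam_eq]
  generalize psi x = p, mu x = m
  grind

lemma quartic_psi (x : E3) :
    27 * (psi x ^ 2) ^ 4 - 18 * C12 x * (psi x ^ 2) ^ 2 - 8 * C18 x * psi x ^ 2 - C12 x ^ 2 = 0 := by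
  rw [quartic_eq]; ring

lemma exists_psi_eq {x : E3} {s : ℂ}
    (h : 27 * (s ^ 2) ^ 4 - 18 * C12 x * (s ^ 2) ^ 2 - 8 * C18 x * s ^ 2 - C12 x ^ 2 = 0) :
    ∃ g ∈ groupK, psi (act g x) = s := by
  have h2 : ∃ g ∈ groupK, psi (act g x) ^ 2 = s ^ 2 := by
    rw [quartic_eq] at h
    have key : ∀ k, s ^ 2 + (psi x + w k * mu x) ^ 2 / 3 = 0 →
        ∃ g ∈ groupK, psi (act g x) ^ 2 = s ^ 2 := fun k hk =>
      ⟨_, mul_mem gE_mem (gD_mem k), by rw [psi_sq_gE_gD]; linear_combination -hk⟩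
    rcases mul_eq_zero.1 h with h | h
    · rcases mul_eq_zero.1 h with h | h
      · rcases mul_eq_zero.1 h with h | h
        · refine ⟨1, one_mem _, ?_⟩
          rw [act_one]
          linear_combination -h / 27
        · exact key _ h
      · exact key _ h
    · exact key _ h
  obtain ⟨g, hg, h2⟩ := h2
  rcases sq_eq_sq_iff_eq_or_eq_neg.1 h2 with h | h
  · exact ⟨g, hg, h⟩
  · refine ⟨mono tr 0 * g, mul_mem (mono_mem _ _) hg, ?_⟩
    rw [act_mul, psi_mono, sg_tr, h]; ring

/-- Triples with the same symmetric functions and the same Vandermonde determinant differ by an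
even permutation. -/
lemma exists_rotation {p q : Fin 3 → ℂ} (h1 : q 0 + q 1 + q 2 = p 0 + p 1 + p 2)
    (h2 : q 0 * q 1 + q 0 * q 2 + q 1 * q 2 = p 0 * p 1 + p 0 * p 2 + p 1 * p 2)
    (h3 : q 0 * q 1 * q 2 = p 0 * p 1 * p 2)
    (h4 : (q 0 - q 1) * (q 0 - q 2) * (q 1 - q 2) = (p 0 - p 1) * (p 0 - p 2) * (p 1 - p 2)) :
    ∃ σ, sg σ = 1 ∧ ∀ i, q i = p (σ i) := by
  suffices (q 0 = p 0 ∧ q 1 = p 1 ∧ q 2 = p 2) ∨ (q 0 = p 1 ∧ q 1 = p 2 ∧ q 2 = p 0) ∨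
      (q 0 = p 2 ∧ q 1 = p 0 ∧ q 2 = p 1) by
    rcases this with ⟨a, b, c⟩ | ⟨a, b, c⟩ | ⟨a, b, c⟩
    · exact ⟨1, sg_one, by intro i; fin_cases i <;> assumption⟩
    · exact ⟨rot, sg_rot, by intro i; fin_cases i <;> assumption⟩
    · exact ⟨rot * rot, sg_rot', by intro i; fin_cases i <;> assumption⟩
  generalize q 0 = a, q 1 = b, q 2 = c, p 0 = x, p 1 = y, p 2 = z at *
  -- the case in which `a` is the first member of a cyclic rearrangement of `x, y, z`
  have key : ∀ x y z : ℂ, a + b + c = x + y + z → a * b + a * c + b * c = x * y + x * z + y * z →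
      (a - b) * (a - c) * (b - c) = (x - y) * (x - z) * (y - z) → a = x →
      (a = x ∧ b = y ∧ c = z) ∨ (a = y ∧ b = z ∧ c = x) ∨ (a = z ∧ b = x ∧ c = y) := by
    intro x y z e1 e2 e4 hx
    have hb : (b - y) * (b - z) = 0 := by
      subst hx; linear_combination (a + b) * e1 - e2
    rcases mul_eq_zero.1 hb with hb | hb
    · exact .inl ⟨hx, sub_eq_zero.1 hb, by linear_combination e1 - hx - hb⟩
    · have hb' := sub_eq_zero.1 hb
      have hc : c = y := by linear_combination e1 - hx - hb
      subst hx hb' hc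
      have : (a - b) * (a - c) * (b - c) = 0 := by linear_combination e4 / 2
      rcases mul_eq_zero.1 this with h | h
      · rcases mul_eq_zero.1 h with h | h
        · have := sub_eq_zero.1 h; subst this; simp
        · have := sub_eq_zero.1 h; subst this; simp
      · have := sub_eq_zero.1 h; subst this; simp
  have ha : (a - x) * (a - y) * (a - z) = 0 := by linear_combination a ^ 2 * h1 - a * h2 + h3
  rcases mul_eq_zero.1 ha with ha | ha
  · rcases mul_eq_zero.1 ha with ha | ha
    · exact key x y z h1 h2 h4 (sub_eq_zero.1 ha)
    · have := key y z x (by rw [h1]; ring) (by rw [h2]; ring) (by rw [h4]; ring) (sub_eq_zero.1 ha)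
      tauto
  · have := key z x y (by rw [h1]; ring) (by rw [h2]; ring) (by rw [h4]; ring) (sub_eq_zero.1 ha)
    tauto

lemma exists_mono_of_symm {x y : E3} (h1 : psi y = psi x) (h2 : chi y = chi x)
    (h3 : lam y = lam x) (h4 : C9 y = C9 x) : ∃ g ∈ groupK, y = act g x := by
  obtain ⟨σ, hσ, h⟩ := exists_rotation (p := fun i => x i ^ 3) (q := fun i => y i ^ 3) h1 h2
    (by simp only [lam] at h3; linear_combination h3 / 216) h4
  choose α hα using fun i => exists_w_mul (h i)
  refine ⟨mono σ α, mono_mem _ _, ?_⟩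
  ext i
  rw [act_mono, hσ, one_mul, hα]

/-- Points with the same values of the invariants lie in the same `K`-orbit. -/
lemma exists_act_eq {x y : E3} (h6 : C6 y = C6 x) (h9 : C9 y = C9 x) (h12 : C12 y = C12 x)
    (h18 : C18 y = C18 x) : ∃ g ∈ groupK, y = act g x := by
  -- the case in which `ψ` does not vanish at `y`
  have main : ∀ y : E3, C6 y = C6 x → C9 y = C9 x → C12 y = C12 x → C18 y = C18 x → psi y ≠ 0 →
      ∃ g ∈ groupK, y = act g x := by
    intro y h6 h9 h12 h18 hy
    have hq := quartic_psi y
    rw [h12, h18] at hq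
    obtain ⟨g, hg, e⟩ := exists_psi_eq hq
    obtain ⟨i6, i9, i12, i18⟩ := invariants_act hg x
    rw [← i6] at h6
    rw [← i9] at h9
    rw [← i12] at h12
    obtain ⟨k, hk, e'⟩ := exists_mono_of_symm (x := act g x) (y := y) e.symm
      (by simp only [C6, e] at h6; linear_combination -h6 / 12)
      (by simp only [C12, e] at h12; exact mul_right_cancel₀ hy (by linear_combination h12)) h9
    exact ⟨k * g, mul_mem hk hg, by rw [act_mul, e']⟩
  by_cases hy : psi y = 0
  · by_cases hm : mu y = 0
    · have hl : lam y = 0 := by rw [lam_eq, hm]; ring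
      have c12 : C12 x = 0 := by rw [← h12, C12, hy, hl]; ring
      have c18 : C18 x = 0 := by rw [← h18, C18, hy, hl]; ring
      have hx : psi x = 0 := by
        have := quartic_psi x
        rw [c12, c18] at this
        have h8 : psi x ^ 8 = 0 := by linear_combination this / 27
        exact pow_eq_zero_iff (by norm_num) |>.1 h8
      have hlx : lam x = 0 := by
        rw [C18, hx] at c18
        have : lam x ^ 2 = 0 := by linear_combination -8 * c18
        exact pow_eq_zero_iff (by norm_num) |>.1 this
      refine exists_mono_of_symm (by rw [hy, hx]) ?_ (by rw [hl, hlx]) h9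
      simp only [C6, hy, hx] at h6
      linear_combination -h6 / 12
    · obtain ⟨i6, i9, i12, i18⟩ := invariants_act gE_mem y
      have hne : psi (act gE y) ≠ 0 := by
        rw [psi_E, hy, zero_add]
        refine mul_ne_zero (fun h => ?_) hm
        have := theta_sq
        rw [h] at this
        norm_num at this
      obtain ⟨g, hg, e⟩ := main _ (i6.trans h6) (i9.trans h9) (i12.trans h12) (i18.trans h18) hne
      exact ⟨gE⁻¹ * g, mul_mem (inv_mem gE_mem) hg, by rw [act_mul, ← e, act_inv_act]⟩
  · exact main y h6 h9 h12 h18 hy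

/-- The solutions with prescribed `I₉` form the orbit of any one of them. -/
lemma signedSolutions_eq_orbitK {a b c d : ℂ} {x : E3} (hx : x ∈ signedSolutions a b c d) :
    signedSolutions a b c d = orbitK x := by
  obtain ⟨hx, h9⟩ := hx
  obtain ⟨h6, h12, h18⟩ := mem_solutions.1 hx
  ext y
  constructor
  · rintro ⟨hy, h9'⟩
    obtain ⟨h6', h12', h18'⟩ := mem_solutions.1 hy
    exact exists_act_eq (h6'.trans h6.symm) (h9'.trans h9.symm) (h12'.trans h12.symm)
      (h18'.trans h18.symm)
  · rintro ⟨g, hg, rfl⟩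
    obtain ⟨i6, i9, i12, i18⟩ := invariants_act hg x
    exact ⟨mem_solutions.2 ⟨i6.trans h6, i12.trans h12, i18.trans h18⟩, i9.trans h9⟩

/-! ### The order of `K` and free orbits -/

/-- The elements of `K`, parametrized by monomial matrices and coset representatives. -/
def normalForm : Equiv.Perm (Fin 3) × (Fin 3 → ZMod 3) × Option (ZMod 3) → GL (Fin 3) ℂ
  | (σ, α, none) => mono σ α
  | (σ, α, some k) => mono σ α * gE * gD k

lemma range_normalForm : Set.range normalForm = groupK := by
  ext g
  constructor
  · rintro ⟨⟨σ, α, _ | k⟩, rfl⟩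
    · exact mono_mem σ α
    · exact mul_mem (mul_mem (mono_mem σ α) gE_mem) (gD_mem k)
  · intro hg
    rcases isNormal_of_mem hg with ⟨σ, α, rfl⟩ | ⟨σ, α, k, rfl⟩
    · exact ⟨(σ, α, none), rfl⟩
    · exact ⟨(σ, α, some k), rfl⟩

lemma psi_normalForm_some (σ α k) (x : E3) :
    psi (act (normalForm (σ, α, some k)) x) ^ 2 = -(psi x + w k * mu x) ^ 2 / 3 := by
  rw [normalForm, mul_assoc, act_mul, psi_mono, mul_pow, sg_sq, one_mul, psi_sq_gE_gD]

lemma psi_normalForm_none (σ α) (x : E3) :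
    psi (act (normalForm (σ, α, none)) x) ^ 2 = psi x ^ 2 := by
  rw [normalForm, psi_mono, mul_pow, sg_sq, one_mul]

/-- If one of the other three roots of the quartic is `ψ ^ 2`, then `8 ψ ^ 3 = λ`. -/
lemma eq_lam_of_psi_sq {x : E3} {k : ZMod 3} (h : psi x ^ 2 = -(psi x + w k * mu x) ^ 2 / 3) :
    8 * psi x ^ 3 = lam x := by
  have he := eps_sum
  have h1 : (w k * mu x - 2 * eps * psi x) * (w k * mu x + (2 + 2 * eps) * psi x) = 0 := by
    linear_combination 3 * h - 4 * psi x ^ 2 * he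
  have h2 : ∀ z : ℂ, w k * mu x = z → z ^ 3 = 8 * psi x ^ 3 → 8 * psi x ^ 3 = lam x := by
    intro z hz h
    rw [← h, ← hz, mul_pow, w_cube, lam_eq, one_mul]
  have e3 := eps_cube
  rcases mul_eq_zero.1 h1 with h1 | h1
  · exact h2 (2 * eps * psi x) (by linear_combination h1) (by linear_combination 8 * psi x ^ 3 * e3)
  · refine h2 (-(2 + 2 * eps) * psi x) (by linear_combination h1) ?_
    linear_combination -8 * psi x ^ 3 * (eps + 2) * he

/-- Any two of the other three roots of the quartic are different, unless `8 ψ ^ 3 = λ` or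
`λ = 0`. -/
lemma eq_of_psi_sq {x : E3} {k l : ZMod 3} (h0 : lam x ≠ 0) (h8 : 8 * psi x ^ 3 ≠ lam x)
    (h : -(psi x + w k * mu x) ^ 2 / 3 = -(psi x + w l * mu x) ^ 2 / 3) : k = l := by
  have hm : mu x ≠ 0 := fun hm => h0 (by rw [lam_eq, hm]; ring)
  have h1 : (w k - w l) * mu x * (2 * psi x + (w k + w l) * mu x) = 0 := by
    linear_combination -3 * h
  by_contra hkl
  have hw : w k - w l ≠ 0 := sub_ne_zero.2 fun h => hkl (w_injective h)
  have h2 := (mul_eq_zero.1 h1).resolve_left (mul_ne_zero hw hm)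
  have hs : w k + w l + w (-k - l) = 0 := by
    have he := eps_sum
    have hne : ∀ k l : ZMod 3, k ≠ l → (k = 0 ∧ l = 1) ∨ (k = 1 ∧ l = 0) ∨ (k = 0 ∧ l = 2) ∨
        (k = 2 ∧ l = 0) ∨ (k = 1 ∧ l = 2) ∨ (k = 2 ∧ l = 1) := by decide
    have d1 : (-0 - 1 : ZMod 3) = 2 := by decide
    have d2 : (-1 - 0 : ZMod 3) = 2 := by decide
    have d3 : (-0 - 2 : ZMod 3) = 1 := by decide
    have d4 : (-2 - 0 : ZMod 3) = 1 := by decide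
    have d5 : (-1 - 2 : ZMod 3) = 0 := by decide
    have d6 : (-2 - 1 : ZMod 3) = 0 := by decide
    rcases hne k l hkl with ⟨rfl, rfl⟩ | ⟨rfl, rfl⟩ | ⟨rfl, rfl⟩ | ⟨rfl, rfl⟩ | ⟨rfl, rfl⟩ |
      ⟨rfl, rfl⟩ <;> simp only [d1, d2, d3, d4, d5, d6, w_zero, w_one, w_two] <;>
      linear_combination he
  refine h8 ?_
  have h3 : 2 * psi x = w (-k - l) * mu x := by linear_combination h2 - mu x * hs
  calc 8 * psi x ^ 3 = (2 * psi x) ^ 3 := by ring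
    _ = lam x := by rw [h3, mul_pow, w_cube, lam_eq, one_mul]

lemma mono_injective {σ τ : Equiv.Perm (Fin 3)} {α β : Fin 3 → ZMod 3}
    (h : mono σ α = mono τ β) : σ = τ ∧ α = β := by
  have hM' : monoMat σ α = monoMat τ β := congrArg Units.val h
  have hM : ∀ i j, monoMat σ α i j = monoMat τ β i j := fun i j => by rw [hM']
  have hs : ∀ σ, sg σ ≠ 0 := fun σ h0 => by simpa [h0] using sg_sq σ
  have hσ : σ = τ := by
    ext1 i
    by_contra hne
    have := hM i (σ i)
    simp [monoMat, hne, hs, w_ne_zero] at this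
  subst hσ
  refine ⟨rfl, funext fun i => w_injective ?_⟩
  have := hM i (σ i)
  simpa [monoMat, hs] using this

lemma normalForm_injective : Function.Injective normalForm := by
  -- a point at which the four roots of the quartic are distinct
  let x : E3 := !₂[1, 1, 2]
  have hl : lam x = 1728 := by simp [lam, x]; norm_num
  have hp : psi x = 10 := by simp [psi, x]; norm_num
  have h0 : lam x ≠ 0 := by rw [hl]; norm_num
  have h8 : 8 * psi x ^ 3 ≠ lam x := by rw [hl, hp]; norm_num
  rintro ⟨σ, α, _ | k⟩ ⟨τ, β, _ | l⟩ h
  · obtain ⟨rfl, rfl⟩ := mono_injective h; rfl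
  · have := psi_normalForm_none σ α x
    rw [h, psi_normalForm_some] at this
    exact absurd (eq_lam_of_psi_sq this.symm) h8
  · have := psi_normalForm_none τ β x
    rw [← h, psi_normalForm_some] at this
    exact absurd (eq_lam_of_psi_sq this.symm) h8
  · have := psi_normalForm_some σ α k x
    rw [h, psi_normalForm_some] at this
    obtain rfl := eq_of_psi_sq h0 h8 this.symm
    have h' : mono σ α * gE * gD k = mono τ β * gE * gD k := h
    obtain ⟨rfl, rfl⟩ := mono_injective (mul_right_cancel (mul_right_cancel h'))
    rfl

lemma card_groupK : Nat.card groupK = 648 := by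
  have : Nat.card groupK = Nat.card (Set.range normalForm) := by rw [range_normalForm]; rfl
  rw [this, Nat.card_range_of_injective normalForm_injective]
  simp [Nat.card_eq_fintype_card, Fintype.card_perm, ZMod.card]
  decide

instance : Finite groupK := Nat.finite_of_card_ne_zero (by rw [card_groupK]; norm_num)

/-- The orbit-stabilizer theorem. -/
lemma ncard_orbitK (x : E3) : (orbitK x).ncard * Nat.card (isotropy x) = 648 := by
  let _ : MulAction groupK E3 :=
    { smul := fun g y => act g y, one_smul := act_one, mul_smul := fun g h y => act_mul g h y }
  have h1 : orbitK x = MulAction.orbit groupK x := by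
    ext y
    constructor
    · rintro ⟨g, hg, rfl⟩; exact ⟨⟨g, hg⟩, rfl⟩
    · rintro ⟨⟨g, hg⟩, rfl⟩; exact ⟨g, hg, rfl⟩
  have h2 : Nat.card (isotropy x) = Nat.card (MulAction.stabilizer groupK x) :=
    Nat.card_congr
      { toFun := fun g => ⟨⟨g.1, g.2.1⟩, g.2.2⟩
        invFun := fun g => ⟨g.1.1, g.1.2, g.2⟩
        left_inv := fun _ => rfl
        right_inv := fun _ => rfl }
  rw [h1, h2, ← card_groupK, ← Nat.card_congr (MulAction.orbitProdStabilizerEquivGroup groupK x),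
    Nat.card_prod]
  rfl

/-! ### Existence of solutions -/

lemma exists_of_symm (e₁ e₂ e₃ : ℂ) : ∃ x : E3, psi x = e₁ ∧ chi x = e₂ ∧ lam x = 216 * e₃ := by
  obtain ⟨p, hp⟩ := IsAlgClosed.exists_root (C 1 * X ^ 3 + C (-e₁) * X ^ 2 + C e₂ * X + C (-e₃) : ℂ[X])
    (by rw [degree_cubic one_ne_zero]; norm_num)
  obtain ⟨q, hq⟩ := IsAlgClosed.exists_root
    (C 1 * X ^ 2 + C (p - e₁) * X + C (p ^ 2 - e₁ * p + e₂) : ℂ[X])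
    (by rw [degree_quadratic one_ne_zero]; norm_num)
  simp only [IsRoot.def, eval_add, eval_mul, eval_pow, eval_C, eval_X] at hp hq
  obtain ⟨u, hu⟩ := IsAlgClosed.exists_pow_nat_eq p (n := 3) (by norm_num)
  obtain ⟨v, hv⟩ := IsAlgClosed.exists_pow_nat_eq q (n := 3) (by norm_num)
  obtain ⟨z, hz⟩ := IsAlgClosed.exists_pow_nat_eq (e₁ - p - q) (n := 3) (by norm_num)
  refine ⟨!₂[u, v, z], ?_, ?_, ?_⟩
  · simp [psi, hu, hv, hz]
  · simp [chi, hu, hv, hz]; linear_combination -hq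
  · simp [lam, hu, hv, hz]; linear_combination 216 * hp - 216 * p * hq

lemma exists_root_ne_zero {b c : ℂ} (h : ¬ (b = 0 ∧ c = 0)) :
    ∃ X : ℂ, X ≠ 0 ∧ 27 * X ^ 4 - 18 * b * X ^ 2 - 8 * c * X - b ^ 2 = 0 := by
  by_cases hb : b = 0
  · have hc : c ≠ 0 := fun hc => h ⟨hb, hc⟩
    obtain ⟨z, hz⟩ := IsAlgClosed.exists_pow_nat_eq (8 * c / 27) (n := 3) (by norm_num)
    refine ⟨z, ?_, by rw [hb]; linear_combination 27 * z * hz⟩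
    rintro rfl
    apply hc; linear_combination -27 / 8 * hz
  · obtain ⟨z, hz⟩ := IsAlgClosed.exists_root
      (C 27 * X ^ 4 + (C (-18 * b) * X ^ 2 + C (-8 * c) * X + C (-b ^ 2)) : ℂ[X]) (by
        have h4 : (C 27 * X ^ 4 : ℂ[X]).degree = 4 := degree_C_mul_X_pow 4 (by norm_num)
        rw [degree_add_eq_left_of_degree_lt, h4]
        · norm_num
        · rw [h4]; exact degree_quadratic_lt.trans_le (by norm_num))
    simp only [IsRoot.def, eval_add, eval_mul, eval_pow, eval_C, eval_X] at hz
    refine ⟨z, ?_, by linear_combination hz⟩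
    rintro rfl
    apply pow_ne_zero 2 hb; linear_combination -hz

lemma C6_neg (x : E3) : C6 (-x) = C6 x := by simp only [C6, psi, chi, PiLp.neg_apply]; ring
lemma C9_neg (x : E3) : C9 (-x) = -C9 x := by simp only [C9, PiLp.neg_apply]; ring
lemma C12_neg (x : E3) : C12 (-x) = C12 x := by simp only [C12, psi, lam, PiLp.neg_apply]; ring
lemma C18_neg (x : E3) : C18 (-x) = C18 x := by simp only [C18, psi, lam, PiLp.neg_apply]; ring

lemma neg_mem_solutions {a b c : ℂ} {x : E3} (h : x ∈ solutions a b c) : -x ∈ solutions a b c := by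
  rw [mem_solutions] at *
  rwa [C6_neg, C12_neg, C18_neg]

lemma mem_solutions_of_symm {a b c s : ℂ} {x : E3} (hs : s ≠ 0)
    (hq : 27 * (s ^ 2) ^ 4 - 18 * b * (s ^ 2) ^ 2 - 8 * c * s ^ 2 - b ^ 2 = 0) (h1 : psi x = s)
    (h2 : chi x = (s ^ 2 - a) / 12) (h3 : lam x * s = b - s ^ 4) : x ∈ solutions a b c := by
  rw [mem_solutions, C6, C12, C18, h1, h2]
  refine ⟨by ring, by linear_combination h3, mul_right_cancel₀ (pow_ne_zero 2 hs) ?_⟩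
  linear_combination hq / 8 - (5 / 2 * s ^ 4 + 1 / 8 * (lam x * s + b - s ^ 4)) * h3

lemma exists_mem_solutions (a b c : ℂ) (h : ∃ d : ℂ, 432 * d ^ 2 = a ^ 3 - 3 * a * b + 2 * c) :
    (solutions a b c).Nonempty := by
  by_cases h0 : b = 0 ∧ c = 0
  · obtain ⟨rfl, rfl⟩ := h0
    obtain ⟨x, h1, h2, h3⟩ := exists_of_symm 0 (-a / 12) 0
    refine ⟨x, ?_⟩
    rw [mem_solutions, C6, C12, C18, h1, h2, h3]
    refine ⟨?_, ?_, ?_⟩ <;> ring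
  · obtain ⟨X, hX, hq⟩ := exists_root_ne_zero h0
    obtain ⟨s, rfl⟩ := IsAlgClosed.exists_pow_nat_eq X (n := 2) (by norm_num)
    have hs : s ≠ 0 := fun hs => hX (by rw [hs]; norm_num)
    obtain ⟨x, h1, h2, h3⟩ := exists_of_symm s ((s ^ 2 - a) / 12) ((b - s ^ 4) / (216 * s))
    exact ⟨x, mem_solutions_of_symm hs hq h1 h2 (by rw [h3]; field_simp)⟩

lemma C9_eq_or {a b c d : ℂ} (hd : 432 * d ^ 2 = a ^ 3 - 3 * a * b + 2 * c) {x : E3}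
    (hx : x ∈ solutions a b c) : C9 x = d ∨ C9 x = -d := by
  obtain ⟨h6, h12, h18⟩ := mem_solutions.1 hx
  have := C9_sq x
  rw [h6, h12, h18, ← hd] at this
  exact sq_eq_sq_iff_eq_or_eq_neg.1 (mul_left_cancel₀ (by norm_num) this)

lemma signedSolutions_nonempty {a b c d : ℂ} (hd : 432 * d ^ 2 = a ^ 3 - 3 * a * b + 2 * c) :
    (signedSolutions a b c d).Nonempty := by
  obtain ⟨x, hx⟩ := exists_mem_solutions a b c ⟨d, hd⟩
  rcases C9_eq_or hd hx with h | h
  · exact ⟨x, hx, h⟩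
  · exact ⟨-x, neg_mem_solutions hx, by rw [C9_neg, h, neg_neg]⟩

lemma orbitK_finite (x : E3) : (orbitK x).Finite := by
  have : orbitK x = Set.range fun g : groupK => act g x := by
    ext y
    constructor
    · rintro ⟨g, hg, rfl⟩; exact ⟨⟨g, hg⟩, rfl⟩
    · rintro ⟨⟨g, hg⟩, rfl⟩; exact ⟨g, hg, rfl⟩
  rw [this]; exact Set.finite_range _

lemma signedSolutions_finite (a b c d : ℂ) : (signedSolutions a b c d).Finite := by
  rcases (signedSolutions a b c d).eq_empty_or_nonempty with h | ⟨x, hx⟩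
  · rw [h]; exact Set.finite_empty
  · rw [signedSolutions_eq_orbitK hx]; exact orbitK_finite x

lemma solutions_eq_union {a b c d : ℂ} (hd : 432 * d ^ 2 = a ^ 3 - 3 * a * b + 2 * c) :
    solutions a b c = signedSolutions a b c d ∪ signedSolutions a b c (-d) := by
  ext x
  constructor
  · intro hx
    exact (C9_eq_or hd hx).imp (fun h => ⟨hx, h⟩) fun h => ⟨hx, h⟩
  · rintro (h | h) <;> exact h.1

lemma exists_d (a b c : ℂ) : ∃ d : ℂ, 432 * d ^ 2 = a ^ 3 - 3 * a * b + 2 * c := by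
  obtain ⟨d, hd⟩ := IsAlgClosed.exists_pow_nat_eq ((a ^ 3 - 3 * a * b + 2 * c) / 432) (n := 2)
    (by norm_num)
  exact ⟨d, by rw [hd]; ring⟩

lemma solutions_finite (a b c : ℂ) : (solutions a b c).Finite := by
  obtain ⟨d, hd⟩ := exists_d a b c
  rw [solutions_eq_union hd]
  exact (signedSolutions_finite _ _ _ _).union (signedSolutions_finite _ _ _ _)

/-! ### Chains of equations of degree at most four -/

/-- The solutions are found from a root of the quartic, its square root, and a cubic. -/
lemma mem_solutions_iff_chain {a b c : ℂ} (hb : b ≠ 0) (x : E3) : x ∈ solutions a b c ↔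
    ∃ X s : ℂ, 27 * X ^ 4 - 18 * b * X ^ 2 - 8 * c * X - b ^ 2 = 0 ∧ s ^ 2 = X ∧
      ∀ T : ℂ, (T - x 0 ^ 3) * (T - x 1 ^ 3) * (T - x 2 ^ 3) =
        T ^ 3 - s * T ^ 2 + (s ^ 2 - a) / 12 * T - (b - s ^ 4) / (216 * s) := by
  constructor
  · intro hx
    obtain ⟨h6, h12, h18⟩ := mem_solutions.1 hx
    have hq := quartic_psi x
    rw [h12, h18] at hq
    have hs : psi x ≠ 0 := fun hs => hb (by rw [← h12, C12, hs]; ring)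
    refine ⟨_, psi x, hq, rfl, fun T => ?_⟩
    have e2 : (psi x ^ 2 - a) / 12 = chi x := by rw [← h6, C6]; ring
    have e3 : (b - psi x ^ 4) / (216 * psi x) = lam x / 216 := by
      rw [← h12, C12]; field_simp; ring
    rw [e2, e3, psi, chi, lam]; ring
  · rintro ⟨X, s, hq, rfl, hT⟩
    have hs : s ≠ 0 := fun hs => pow_ne_zero 2 hb (by rw [hs] at hq; linear_combination -hq)
    have t0 := hT 0
    have t1 := hT 1
    have t2 := hT (-1)
    have e3 : (b - s ^ 4) / (216 * s) * (216 * s) = b - s ^ 4 := div_mul_cancel₀ _ (by simpa)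
    refine mem_solutions_of_symm hs hq ?_ ?_ ?_
    · rw [psi]; linear_combination t0 - t1 / 2 - t2 / 2
    · rw [chi]; linear_combination (t1 - t2) / 2
    · rw [lam]; linear_combination -216 * s * t0 + e3


/-- Finitely many roots of equations of degree at most four may be adjoined. -/
lemma ChainField.adjoin {k F : Subfield ℂ} (hF : ChainField k F) {S : Set ℂ} (hS : S.Finite)
    (h : ∀ t ∈ S, ∃ p : ℂ[X], (∀ i, p.coeff i ∈ F) ∧ p ≠ 0 ∧ p.natDegree ≤ 4 ∧ p.IsRoot t) :
    ∃ F', ChainField k F' ∧ F ≤ F' ∧ S ⊆ F' := by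
  induction S, hS using Set.Finite.induction_on with
  | empty => exact ⟨F, hF, le_rfl, Set.empty_subset _⟩
  | @insert t S _ _ ih =>
    obtain ⟨F', h1, h2, h3⟩ := ih fun s hs => h s (Set.mem_insert_of_mem _ hs)
    obtain ⟨p, c, p0, pd, pt⟩ := h t (Set.mem_insert _ _)
    refine ⟨_, .step F' p t h1 (fun i => h2 (c i)) p0 pd pt, h2.trans le_sup_left, ?_⟩
    rintro s (rfl | hs)
    · exact le_sup_right (a := F') (Subfield.subset_closure (Set.mem_singleton _))
    · exact le_sup_left (a := F') (h3 hs)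

lemma coeff_mem_of_poly {F : Subfield ℂ} {c₀ c₁ c₂ c₃ c₄ : ℂ} (h₀ : c₀ ∈ F) (h₁ : c₁ ∈ F)
    (h₂ : c₂ ∈ F) (h₃ : c₃ ∈ F) (h₄ : c₄ ∈ F) (i : ℕ) :
    (C c₄ * X ^ 4 + C c₃ * X ^ 3 + C c₂ * X ^ 2 + C c₁ * X + C c₀ : ℂ[X]).coeff i ∈ F := by
  simp only [coeff_add, coeff_C_mul, coeff_X_pow, coeff_X, coeff_C]
  have h1 := F.one_mem
  have h0 := F.zero_mem
  refine add_mem (add_mem (add_mem (add_mem ?_ ?_) ?_) ?_) ?_ <;> (try refine mul_mem ?_ ?_) <;>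
    first | assumption | (split_ifs <;> assumption)

/-- A form of `ChainField.adjoin` for images of a finite set, with equations given by their
coefficients. -/
lemma ChainField.adjoin_image {k F : Subfield ℂ} (hF : ChainField k F) {S : Set E3} (hS : S.Finite)
    (f : E3 → ℂ) (c₀ c₁ c₂ c₃ c₄ : E3 → ℂ)
    (h : ∀ x ∈ S, c₀ x ∈ F ∧ c₁ x ∈ F ∧ c₂ x ∈ F ∧ c₃ x ∈ F ∧ c₄ x ∈ F ∧
      (c₂ x ≠ 0 ∨ c₃ x ≠ 0 ∨ c₄ x ≠ 0) ∧
      c₄ x * f x ^ 4 + c₃ x * f x ^ 3 + c₂ x * f x ^ 2 + c₁ x * f x + c₀ x = 0) :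
    ∃ F', ChainField k F' ∧ F ≤ F' ∧ ∀ x ∈ S, f x ∈ F' := by
  obtain ⟨F', h1, h2, h3⟩ := hF.adjoin (hS.image f) (by
    rintro _ ⟨x, hx, rfl⟩
    obtain ⟨m0, m1, m2, m3, m4, hne, hr⟩ := h x hx
    refine ⟨C (c₄ x) * X ^ 4 + C (c₃ x) * X ^ 3 + C (c₂ x) * X ^ 2 + C (c₁ x) * X + C (c₀ x),
      coeff_mem_of_poly m0 m1 m2 m3 m4, fun hp => ?_, by compute_degree, by simpa using hr⟩
    have e2 := congrArg (fun p => coeff p 2) hp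
    have e3 := congrArg (fun p => coeff p 3) hp
    have e4 := congrArg (fun p => coeff p 4) hp
    simp at e2 e3 e4
    tauto)
  exact ⟨F', h1, h2, fun x hx => h3 ⟨x, hx, rfl⟩⟩

lemma exists_chainField (a b c : ℂ) : ∃ F : Subfield ℂ,
    ChainField (Subfield.closure {a, b, c}) F ∧ ∀ x ∈ solutions a b c, ∀ i, x i ∈ F := by
  have hS := solutions_finite a b c
  have base : ∀ z ∈ ({a, b, c} : Set ℂ), z ∈ Subfield.closure {a, b, c} :=
    fun z hz => Subfield.subset_closure hz
  have ha := base a (by simp)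
  have hb := base b (by simp)
  have hc := base c (by simp)
  have nat : ∀ (F : Subfield ℂ) (n : ℕ), (n : ℂ) ∈ F := fun F n => natCast_mem F n
  -- adjoin the squares of the values of `ψ`
  obtain ⟨F₁, k₁, l₁, m₁⟩ := ChainField.base.adjoin_image hS (fun x => psi x ^ 2)
    (fun _ => -b ^ 2) (fun _ => -((8 : ℕ) * c)) (fun _ => -((18 : ℕ) * b)) (fun _ => 0)
    (fun _ => (27 : ℕ)) (by
      intro x hx
      obtain ⟨h6, h12, h18⟩ := mem_solutions.1 hx
      refine ⟨neg_mem (pow_mem hb 2), neg_mem (mul_mem (nat _ _) hc),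
        neg_mem (mul_mem (nat _ _) hb), zero_mem _, nat _ _, Or.inr (Or.inr (by norm_num)), ?_⟩
      have := quartic_psi x
      rw [h12, h18] at this
      push_cast
      linear_combination this)
  -- adjoin the values of `ψ`
  obtain ⟨F₂, k₂, l₂, m₂⟩ := k₁.adjoin_image hS psi (fun x => -psi x ^ 2) (fun _ => 0)
    (fun _ => 1) (fun _ => 0) (fun _ => 0) (by
      intro x hx
      refine ⟨neg_mem (m₁ x hx), zero_mem _, one_mem _, zero_mem _, zero_mem _,
        Or.inl one_ne_zero, by ring⟩)
  have ha₂ := l₂ (l₁ ha)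
  have hc₂ := l₂ (l₁ hc)
  -- adjoin the values of `λ`, roots of a quadratic equation
  obtain ⟨F₃, k₃, l₃, m₃⟩ := k₂.adjoin_image hS lam
    (fun x => (8 : ℕ) * c - (8 : ℕ) * psi x ^ 6) (fun x => (20 : ℕ) * psi x ^ 3)
    (fun _ => 1) (fun _ => 0) (fun _ => 0) (by
      intro x hx
      obtain ⟨h6, h12, h18⟩ := mem_solutions.1 hx
      refine ⟨sub_mem (mul_mem (nat _ _) hc₂) (mul_mem (nat _ _) (pow_mem (m₂ x hx) _)),
        mul_mem (nat _ _) (pow_mem (m₂ x hx) _), one_mem _, zero_mem _, zero_mem _,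
        Or.inl one_ne_zero, ?_⟩
      rw [C18] at h18
      push_cast
      linear_combination -8 * h18)
  -- adjoin the cubes of the coordinates, roots of a cubic equation, then the coordinates
  have step : ∀ (F : Subfield ℂ) (i : Fin 3), ChainField (Subfield.closure {a, b, c}) F → F₃ ≤ F →
      ∃ F', ChainField (Subfield.closure {a, b, c}) F' ∧ F ≤ F' ∧
        ∀ x ∈ solutions a b c, x i ∈ F' := by
    intro F i hF hle
    obtain ⟨F₄, k₄, l₄, m₄⟩ := hF.adjoin_image hS (fun x => x i ^ 3)
      (fun x => -(lam x / (216 : ℕ))) (fun x => (psi x ^ 2 - a) / (12 : ℕ)) (fun x => -psi x)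
      (fun _ => 1) (fun _ => 0) (by
        intro x hx
        obtain ⟨h6, h12, h18⟩ := mem_solutions.1 hx
        refine ⟨hle (neg_mem (div_mem (m₃ x hx) (nat _ _))),
          hle (l₃ (div_mem (sub_mem (pow_mem (m₂ x hx) 2) ha₂) (nat _ _))),
          hle (l₃ (neg_mem (m₂ x hx))), one_mem _, zero_mem _, Or.inr (Or.inl one_ne_zero), ?_⟩
        rw [← h6, C6, chi, psi, lam]
        push_cast
        fin_cases i <;> simp only [Fin.zero_eta, Fin.mk_one, Fin.reduceFinMk] <;> ring)
    obtain ⟨F₅, k₅, l₅, m₅⟩ := k₄.adjoin_image hS (fun x => x i) (fun x => -x i ^ 3) (fun _ => 0)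
      (fun _ => 0) (fun _ => 1) (fun _ => 0) (by
        intro x hx
        exact ⟨neg_mem (m₄ x hx), zero_mem _, zero_mem _, one_mem _, zero_mem _,
          Or.inr (Or.inl one_ne_zero), by ring⟩)
    exact ⟨F₅, k₅, l₄.trans l₅, m₅⟩
  obtain ⟨G₀, g₀, n₀, p₀⟩ := step F₃ 0 k₃ le_rfl
  obtain ⟨G₁, g₁, n₁, p₁⟩ := step G₀ 1 g₀ n₀
  obtain ⟨G₂, g₂, n₂, p₂⟩ := step G₁ 2 g₁ (n₀.trans n₁)
  refine ⟨G₂, g₂, fun x hx i => ?_⟩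
  fin_cases i
  · exact n₂ (n₁ (p₀ x hx))
  · exact n₂ (p₁ x hx)
  · exact p₂ x hx

/-! ### Isotropy groups -/

/-- The isotropy groups of the points of an orbit are conjugate. -/
def isotropyEquiv {g : GL (Fin 3) ℂ} (hg : g ∈ groupK) (x : E3) :
    isotropy x ≃* isotropy (act g x) where
  toFun h := ⟨g * h * g⁻¹, mul_mem (mul_mem hg h.2.1) (inv_mem hg), by
    rw [act_mul, act_mul, act_inv_act, h.2.2]⟩
  invFun h := ⟨g⁻¹ * h * g, mul_mem (mul_mem (inv_mem hg) h.2.1) hg, by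
    rw [act_mul, act_mul, h.2.2, act_inv_act]⟩
  left_inv h := Subtype.ext (by simp only; group)
  right_inv h := Subtype.ext (by simp only; group)
  map_mul' h k := Subtype.ext (by simp only [Subgroup.coe_mul]; group)

lemma perm_cases (σ : Equiv.Perm (Fin 3)) :
    (σ = 1 ∨ σ = rot ∨ σ = rot * rot) ∨ (sg σ = -1 ∧ ∃ i, σ i = i) := by
  have h : ∀ σ : Equiv.Perm (Fin 3), (σ = 1 ∨ σ = rot ∨ σ = rot * rot) ∨
      (Equiv.Perm.sign σ = -1 ∧ ∃ i, σ i = i) := by decide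
  exact (h σ).imp_right fun ⟨h1, h2⟩ => ⟨by simp [sg, h1], h2⟩

/-- A monomial element of the isotropy group of a point with `ψ ≠ 0` whose cubes are not all equal is
diagonal. -/
lemma eq_one_of_fixed {σ : Equiv.Perm (Fin 3)} {α : Fin 3 → ZMod 3} {x : E3}
    (h : act (mono σ α) x = x) (hx : ∀ i, σ i = i → psi x ≠ 0 ∨ x i ≠ 0)
    (hne : ¬ (x 0 ^ 3 = x 1 ^ 3 ∧ x 1 ^ 3 = x 2 ^ 3)) : σ = 1 := by
  have hc : ∀ i, x i ^ 3 = sg σ * x (σ i) ^ 3 := fun i => by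
    conv_lhs => rw [← h]
    exact cube_mono σ α x i
  rcases perm_cases σ with (h1 | rfl | rfl) | ⟨hs, i, hi⟩
  · exact h1
  · refine absurd ⟨?_, ?_⟩ hne
    · have := hc 0; rwa [sg_rot, one_mul] at this
    · have := hc 1; rwa [sg_rot, one_mul] at this
  · refine absurd ⟨?_, ?_⟩ hne
    · have := hc 1; rw [sg_rot', one_mul] at this; exact this.symm
    · have := hc 2; rw [sg_rot', one_mul] at this; exact this.symm
  · exfalso
    rcases hx i hi with hp | hp
    · have h1 : psi x = sg σ * psi x := by conv_lhs => rw [← h]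
                                           exact psi_mono σ α x
      rw [hs] at h1
      exact hp (by linear_combination h1 / 2)
    · have h1 := hc i
      rw [hs, hi] at h1
      have : x i ^ 3 = 0 := by linear_combination h1 / 2
      exact hp (pow_eq_zero_iff (by norm_num) |>.1 this)

lemma w_eq_zero {k : ZMod 3} {z : ℂ} (hz : z ≠ 0) (h : w k * z = z) : k = 0 :=
  w_injective (by rw [w_zero]; exact mul_right_cancel₀ hz (by rw [h, one_mul]))

/-- Points off the mirrors of the reflections of order three have trivial isotropy groups. -/
lemma isotropy_eq_bot {x : E3} (h0 : lam x ≠ 0) (h8 : 8 * psi x ^ 3 ≠ lam x) : isotropy x = ⊥ := by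
  rw [eq_bot_iff]
  rintro g ⟨hg, hx⟩
  have hi : ∀ i, x i ≠ 0 := by
    intro i hi
    apply h0
    fin_cases i <;> simp only [Fin.zero_eta, Fin.mk_one, Fin.reduceFinMk] at hi <;>
      rw [lam, hi] <;> ring
  rcases isNormal_of_mem hg with ⟨σ, α, rfl⟩ | ⟨σ, α, k, rfl⟩
  · have h1 : σ = 1 := by
      refine eq_one_of_fixed hx (fun i _ => Or.inr (hi i)) ?_
      rintro ⟨e1, e2⟩
      apply h8
      rw [psi, lam]; rw [e1, e2]; ring
    subst h1
    have : α = 0 := funext fun i => by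
      have := congrArg (fun y : E3 => y i) hx
      simp only [act_mono, sg_one, one_mul, Equiv.Perm.one_apply] at this
      exact w_eq_zero (hi i) this
    rw [this, mono_one]; exact one_mem _
  · have := psi_normalForm_some σ α k x
    rw [normalForm, hx] at this
    exact absurd (eq_lam_of_psi_sq this) h8

/-- Every point on a mirror of a reflection of order three can be moved into a coordinate plane. -/
lemma exists_coord_zero {x : E3} (h : lam x = 0 ∨ 8 * psi x ^ 3 = lam x) :
    ∃ g ∈ groupK, act g x 0 = 0 := by
  have key : ∀ x : E3, lam x = 0 → ∃ g ∈ groupK, act g x 0 = 0 := by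
    intro x h
    have : x 0 = 0 ∨ x 1 = 0 ∨ x 2 = 0 := by
      rw [lam_eq, mu] at h
      have := pow_eq_zero_iff (by norm_num) |>.1 h
      simpa [or_assoc] using this
    rcases this with h | h | h
    · exact ⟨1, one_mem _, by rw [act_one, h]⟩
    · refine ⟨mono rot 0, mono_mem _ _, ?_⟩
      have : rot 0 = 1 := by decide
      rw [act_mono, this, h, mul_zero]
    · refine ⟨mono (rot * rot) 0, mono_mem _ _, ?_⟩
      have : (rot * rot) 0 = 2 := by decide
      rw [act_mono, this, h, mul_zero]
  rcases h with h | h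
  · exact key x h
  · obtain ⟨k, hk⟩ := exists_w_mul (y := 2 * psi x) (z := mu x) (by rw [← lam_eq, ← h]; ring)
    have hm : mu (act (gD k) x) = w k * mu x := by
      simp [mu, gD, act_mono, sg_one, w_zero]; ring
    have hp : psi (act (gD k) x) = psi x := by rw [gD, psi_mono, sg_one, one_mul]
    obtain ⟨g, hg, e⟩ := key (act (gE * gD k) x) (by
      rw [lam_eq, act_mul, mu_E, hm, hp, hk]; ring)
    exact ⟨g * (gE * gD k), mul_mem hg (mul_mem gE_mem (gD_mem k)), by rw [act_mul, e]⟩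

/-- The isotropy group of a point in a coordinate plane with `ψ ≠ 0` is diagonal. -/
lemma mem_isotropy_iff {x : E3} (h0 : x 0 = 0) (hp : psi x ≠ 0) {g : GL (Fin 3) ℂ} :
    g ∈ isotropy x ↔ ∃ α, g = mono 1 α ∧ ∀ i, x i ≠ 0 → α i = 0 := by
  constructor
  · rintro ⟨hg, hx⟩
    rcases isNormal_of_mem hg with ⟨σ, α, rfl⟩ | ⟨σ, α, k, rfl⟩
    · have h1 : σ = 1 := by
        refine eq_one_of_fixed hx (fun i _ => Or.inl hp) ?_
        rintro ⟨e1, e2⟩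
        apply hp
        rw [psi, ← e2, ← e1, h0]; ring
      subst h1
      refine ⟨α, rfl, fun i hi => ?_⟩
      have := congrArg (fun y : E3 => y i) hx
      simp only [act_mono, sg_one, one_mul, Equiv.Perm.one_apply] at this
      exact w_eq_zero hi this
    · have := psi_normalForm_some σ α k x
      have hm : mu x = 0 := by rw [mu, h0]; ring
      rw [normalForm, hx, hm] at this
      have h2 : psi x ^ 2 = 0 := by linear_combination 3 / 4 * this
      exact absurd (pow_eq_zero_iff (by norm_num) |>.1 h2) hp
  · rintro ⟨α, rfl, h⟩
    refine ⟨mono_mem _ _, ?_⟩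
    ext i
    rw [act_mono, sg_one, one_mul, Equiv.Perm.one_apply]
    by_cases hi : x i = 0
    · rw [hi, mul_zero]
    · rw [h i hi, w_zero, one_mul]

/-- The diagonal matrices in `K` with entries `ε ^ α i`. -/
def diagHom : Multiplicative (Fin 3 → ZMod 3) →* GL (Fin 3) ℂ where
  toFun α := mono 1 α.toAdd
  map_one' := mono_one
  map_mul' α β := by rw [mono_mul]; rfl

lemma diagHom_injective : Function.Injective diagHom := fun _ _ h => (mono_injective h).2

lemma isotropy_equiv_C3 {x : E3} (h0 : x 0 = 0) (h1 : x 1 ≠ 0) (h2 : x 2 ≠ 0) (hp : psi x ≠ 0) :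
    Nonempty (isotropy x ≃* Multiplicative (ZMod 3)) := by
  let e : ZMod 3 →+ (Fin 3 → ZMod 3) :=
    { toFun := fun k => ![k, 0, 0]
      map_zero' := by ext i; fin_cases i <;> rfl
      map_add' := fun k l => by ext i; fin_cases i <;> simp }
  have hmem : ∀ k, diagHom.comp (AddMonoidHom.toMultiplicative e) k ∈ isotropy x := fun k =>
    (mem_isotropy_iff h0 hp).2 ⟨_, rfl, fun i hi => by
      fin_cases i
      · exact absurd h0 hi
      · rfl
      · rfl⟩
  refine ⟨(MulEquiv.ofBijective ((diagHom.comp (AddMonoidHom.toMultiplicative e)).codRestrict _ hmem)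
    ⟨fun k l h => ?_, ?_⟩).symm⟩
  · have h' := diagHom_injective (congrArg Subtype.val h)
    exact congrFun h' 0
  · rintro ⟨g, hg⟩
    obtain ⟨α, rfl, hα⟩ := (mem_isotropy_iff h0 hp).1 hg
    refine ⟨Multiplicative.ofAdd (α 0), Subtype.ext (congrArg (mono 1) ?_)⟩
    ext i
    fin_cases i
    · rfl
    · exact (hα 1 h1).symm
    · exact (hα 2 h2).symm

lemma isotropy_equiv_C3_prod {x : E3} (h0 : x 0 = 0) (h1 : x 1 ≠ 0) (h2 : x 2 = 0) :
    Nonempty (isotropy x ≃* Multiplicative (ZMod 3) × Multiplicative (ZMod 3)) := by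
  have hp : psi x ≠ 0 := by
    rw [psi, h0, h2]
    simpa using h1
  let e : ZMod 3 × ZMod 3 →+ (Fin 3 → ZMod 3) :=
    { toFun := fun k => ![k.1, 0, k.2]
      map_zero' := by ext i; fin_cases i <;> rfl
      map_add' := fun k l => by ext i; fin_cases i <;> simp }
  have hmem : ∀ k, diagHom.comp (AddMonoidHom.toMultiplicative e) k ∈ isotropy x := fun k =>
    (mem_isotropy_iff h0 hp).2 ⟨_, rfl, fun i hi => by
      fin_cases i
      · exact absurd h0 hi
      · rfl
      · exact absurd h2 hi⟩
  refine ⟨(MulEquiv.ofBijective ((diagHom.comp (AddMonoidHom.toMultiplicative e)).codRestrict _ hmem)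
    ⟨fun k l h => ?_, ?_⟩).symm.trans (MulEquiv.prodMultiplicative _ _)⟩
  · have h' := diagHom_injective (congrArg Subtype.val h)
    exact Prod.ext (congrFun h' 0) (congrFun h' 2)
  · rintro ⟨g, hg⟩
    obtain ⟨α, rfl, hα⟩ := (mem_isotropy_iff h0 hp).1 hg
    refine ⟨Multiplicative.ofAdd (α 0, α 2), Subtype.ext (congrArg (mono 1) ?_)⟩
    ext i
    fin_cases i
    · rfl
    · exact (hα 1 h1).symm
    · rfl

/-! ### Isotropy groups isomorphic to `G₄` -/

lemma HasIsotropyG4.of_act {g : GL (Fin 3) ℂ} (hg : g ∈ groupK) {x : E3}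
    (h : HasIsotropyG4 (act g x)) : HasIsotropyG4 x := by
  obtain ⟨φ, j, hj, hx, H⟩ := h
  let L : E3 →ₗ[ℂ] E3 :=
    { toFun := act g⁻¹
      map_add' := fun y z => by ext i; simp only [act_apply, PiLp.add_apply]; ring
      map_smul' := fun c y => act_smul _ _ _ }
  have hL : ∀ y, L y = act g⁻¹ y := fun _ => rfl
  have hgL : ∀ y, act g (L y) = y := fun y => by rw [hL, ← act_mul, mul_inv_cancel, act_one]
  refine ⟨(isotropyEquiv hg x).trans φ, L.comp j, ?_, ?_, ?_⟩
  · intro y z hyz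
    have := congrArg (act g) hyz
    simp only [LinearMap.comp_apply, hgL] at this
    exact hj this
  · rintro ⟨y, hy⟩
    refine hx ⟨y, ?_⟩
    rw [← hy, LinearMap.comp_apply, hgL]
  · intro k y
    have := H (isotropyEquiv hg x k) y
    simp only [LinearMap.comp_apply, MulEquiv.trans_apply, this, hL]
    rw [← act_mul, ← act_mul]
    congr 1
    simp only [isotropyEquiv, MulEquiv.coe_mk, Equiv.coe_fn_mk]
    group

/-- The embedding of `GL₂` in `GL₃` as the group of block matrices `M ⊕ 1`. -/
def blockHom : Matrix (Fin 2) (Fin 2) ℂ →* Matrix (Fin 3) (Fin 3) ℂ where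
  toFun M := !![M 0 0, M 0 1, 0; M 1 0, M 1 1, 0; 0, 0, 1]
  map_one' := by ext i j; fin_cases i <;> fin_cases j <;> simp
  map_mul' M N := by
    ext i j
    fin_cases i <;> fin_cases j <;> simp [Matrix.mul_apply, Fin.sum_univ_succ]

/-- The basis of `ℂ³` consisting of multiples of the roots `(1, 0, 0)`, `(1, 1, 1)` and of the vector
`(0, 1, -1)`. -/
def basisG4 : Matrix (Fin 3) (Fin 3) ℂ := !![eps - 1, 1, 0; 0, 1, 1; 0, 1, -1]

lemma eps_sub_one_ne : eps - 1 ≠ 0 := sub_ne_zero.2 (eps_prim.ne_one (by norm_num))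

lemma det_basisG4 : basisG4.det ≠ 0 := by
  have : basisG4.det = -2 * (eps - 1) := by
    rw [basisG4, Matrix.det_fin_three]; simp; ring
  rw [this]; exact mul_ne_zero (by norm_num) eps_sub_one_ne

def gP : GL (Fin 3) ℂ := Matrix.GeneralLinearGroup.mkOfDetNeZero basisG4 det_basisG4

/-- `GL₂` acting on the plane spanned by the roots `(1, 0, 0)` and `(1, 1, 1)`. -/
def planeHom : GL (Fin 2) ℂ →* GL (Fin 3) ℂ :=
  (MulAut.conj gP).toMonoidHom.comp (Units.map blockHom)

lemma planeHom_apply (M : GL (Fin 2) ℂ) : planeHom M = gP * Units.map blockHom M * gP⁻¹ := rfl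

lemma planeHom_injective : Function.Injective planeHom := by
  refine (MulAut.conj gP).injective.comp ?_
  intro M N h
  have h' : blockHom M = blockHom N := congrArg Units.val h
  ext i j
  have := congrFun (congrFun h' i.castSucc) j.castSucc
  fin_cases i <;> fin_cases j <;> simpa [blockHom] using this

/-- The reflection with root `(1, 1, 1)`. -/
def gS : GL (Fin 3) ℂ := gD 2 * gE * gD 2

lemma gD_mul (k l : ZMod 3) : gD k * gD l = gD (k + l) := by
  rw [gD, gD, mono_mul, gD]; congr 1; ext i; fin_cases i <;> simp

lemma act_gS (x : E3) (i : Fin 3) : act gS x i = x i + (eps - 1) / 3 * (x 0 + x 1 + x 2) := by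
  have h := eps_sum
  rw [gS, act_mul, act_mul, gD, act_mono, sg_one, Equiv.Perm.one_apply, act_E]
  fin_cases i <;> simp [act_mono, sg_one, w_zero, w_two] <;> grind

lemma act_gD (k : ZMod 3) (x : E3) (i : Fin 3) : act (gD k) x i = w (![k, 0, 0] i) * x i := by
  rw [gD, act_mono, sg_one, one_mul, Equiv.Perm.one_apply]

lemma act_coe (g : GL (Fin 3) ℂ) (M : Matrix (Fin 3) (Fin 3) ℂ) (h : (g : Matrix _ _ ℂ) = M) (x : E3)
    (i : Fin 3) : act g x i = M i 0 * x 0 + M i 1 * x 1 + M i 2 * x 2 := by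
  rw [act_apply, h]

lemma act_gP (x : E3) (i : Fin 3) :
    act gP x i = basisG4 i 0 * x 0 + basisG4 i 1 * x 1 + basisG4 i 2 * x 2 :=
  act_coe gP basisG4 rfl x i

lemma planeHom_r {r : GL (Fin 2) ℂ} (hr : (r : Matrix (Fin 2) (Fin 2) ℂ) = !![eps, 1; 0, 1]) :
    planeHom r = gD 1 := by
  rw [planeHom_apply, mul_inv_eq_iff_eq_mul]
  refine act_ext fun x => ?_
  ext i
  have hb := act_coe (Units.map blockHom r) (blockHom !![eps, 1; 0, 1]) (by rw [← hr]; rfl) x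
  rw [act_mul, act_mul, act_gP, act_gD, act_gP, hb, hb, hb]
  fin_cases i <;> simp [blockHom, basisG4, w_one, w_zero]
  ring

lemma planeHom_s {s : GL (Fin 2) ℂ} (hs : (s : Matrix (Fin 2) (Fin 2) ℂ) = !![1, 0; -eps, eps]) :
    planeHom s = gS := by
  have h := eps_sum
  rw [planeHom_apply, mul_inv_eq_iff_eq_mul]
  refine act_ext fun x => ?_
  ext i
  have hb := act_coe (Units.map blockHom s) (blockHom !![1, 0; -eps, eps]) (by rw [← hs]; rfl) x
  rw [act_mul, act_mul, act_gS]
  simp only [act_gP, hb]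
  fin_cases i <;> simp [blockHom, basisG4] <;> grind

lemma groupG4_map : groupG4.map planeHom = Subgroup.closure {gD 1, gS} := by
  rw [groupG4, MonoidHom.map_closure]
  congr 1
  have hr : (!![eps, 1; 0, 1] : Matrix (Fin 2) (Fin 2) ℂ).det ≠ 0 := by
    simpa [Matrix.det_fin_two] using eps_prim.ne_zero (by norm_num)
  have hs : (!![1, 0; -eps, eps] : Matrix (Fin 2) (Fin 2) ℂ).det ≠ 0 := by
    simpa [Matrix.det_fin_two] using eps_prim.ne_zero (by norm_num)
  ext g
  constructor
  · rintro ⟨M, hM | hM, rfl⟩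
    · exact Or.inl (planeHom_r hM)
    · exact Or.inr (planeHom_s hM)
  · rintro (rfl | rfl)
    · exact ⟨Matrix.GeneralLinearGroup.mkOfDetNeZero _ hr, Or.inl rfl, planeHom_r rfl⟩
    · exact ⟨Matrix.GeneralLinearGroup.mkOfDetNeZero _ hs, Or.inr rfl, planeHom_s rfl⟩

lemma act_gE_gD_fixed {x : E3} (h0 : x 0 = 0) (h1 : x 2 = -x 1) (k : ZMod 3) :
    act (gE * gD k) x = x := by
  have h := eps_sum
  ext i
  rw [act_mul, act_E]
  fin_cases i <;> simp [act_gD, w_zero, h0, h1] <;> grind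

/-- The isotropy group of `(0, t, -t)`, in normal form. -/
lemma mem_isotropy_iff' {x : E3} (h0 : x 0 = 0) (h1 : x 2 = -x 1) (ht : x 1 ≠ 0)
    {g : GL (Fin 3) ℂ} : g ∈ isotropy x ↔
      ∃ (s : Bool) (k : ZMod 3) (o : Option (ZMod 3)),
        g = normalForm (if s then tr else 1, ![k, 0, 0], o) := by
  have t0 : tr 0 = 0 := by decide
  have hne : -x 1 ≠ x 1 := fun h => ht (by linear_combination -h / 2)
  have hmono : ∀ σ α, act (mono σ α) x = x ↔ ∃ (s : Bool) (k : ZMod 3),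
      σ = (if s then tr else 1) ∧ α = ![k, 0, 0] := by
    intro σ α
    constructor
    · intro h
      have hi : ∀ i, sg σ * w (α i) * x (σ i) = x i := fun i => by
        rw [← act_mono, h]
      have hs : σ = 1 ∨ σ = tr := by
        have h3 := hi 0
        rw [h0, mul_eq_zero, mul_eq_zero] at h3
        have h4 : x (σ 0) = 0 := by
          rcases h3 with (h3 | h3) | h3
          · have := sg_sq σ; rw [h3] at this; norm_num at this
          · exact absurd h3 (w_ne_zero _)
          · exact h3
        have hσ : ∀ σ : Equiv.Perm (Fin 3), σ = 1 ∨ σ = tr ∨ σ 0 = 1 ∨ σ 0 = 2 := by decide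
        rcases hσ σ with h | h | h | h
        · exact .inl h
        · exact .inr h
        · rw [h] at h4; exact absurd h4 ht
        · rw [h, h1, neg_eq_zero] at h4; exact absurd h4 ht
      rcases hs with rfl | rfl
      · refine ⟨false, α 0, rfl, ?_⟩
        have h3 := hi 1
        have h4 := hi 2
        rw [sg_one, one_mul, Equiv.Perm.one_apply] at h3 h4
        have e1 := w_eq_zero ht h3
        have e2 := w_eq_zero (by rw [h1]; simpa) h4
        ext i; fin_cases i
        exacts [rfl, e1, e2]
      · refine ⟨true, α 0, rfl, ?_⟩
        have h3 := hi 1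
        have h4 := hi 2
        rw [sg_tr, Equiv.swap_apply_left, h1] at h3
        rw [sg_tr, Equiv.swap_apply_right, h1] at h4
        have e1 := w_eq_zero (k := α 1) ht (by linear_combination h3)
        have e2 := w_eq_zero (k := α 2) ht (by linear_combination -h4)
        ext i; fin_cases i
        exacts [rfl, e1, e2]
    · rintro ⟨s, k, rfl, rfl⟩
      cases s
      · ext i
        rw [act_mono]
        fin_cases i <;> simp [sg_one, w_zero, h0]
      · ext i
        rw [act_mono]
        fin_cases i <;> simp [sg_tr, w_zero, h0, h1, t0]
  constructor
  · rintro ⟨hg, hx⟩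
    rcases isNormal_of_mem hg with ⟨σ, α, rfl⟩ | ⟨σ, α, k, rfl⟩
    · obtain ⟨s, k, rfl, rfl⟩ := (hmono σ α).1 hx
      exact ⟨s, k, none, rfl⟩
    · rw [mul_assoc, act_mul, act_gE_gD_fixed h0 h1] at hx
      obtain ⟨s, l, rfl, rfl⟩ := (hmono σ α).1 hx
      exact ⟨s, l, some k, rfl⟩
  · rintro ⟨s, k, o, rfl⟩
    have hm := (hmono _ _).2 ⟨s, k, rfl, rfl⟩
    refine ⟨?_, ?_⟩
    · rw [← SetLike.mem_coe, ← range_normalForm]; exact ⟨_, rfl⟩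
    · cases o with
      | none => exact hm
      | some l => rw [normalForm, mul_assoc, act_mul, act_gE_gD_fixed h0 h1, hm]

lemma card_isotropy_G4 {x : E3} (h0 : x 0 = 0) (h1 : x 2 = -x 1) (ht : x 1 ≠ 0) :
    Nat.card (isotropy x) = 24 := by
  let f : Bool × ZMod 3 × Option (ZMod 3) → GL (Fin 3) ℂ :=
    fun p => normalForm (if p.1 then tr else 1, ![p.2.1, 0, 0], p.2.2)
  have hf : Function.Injective f := by
    rintro ⟨s, k, o⟩ ⟨s', k', o'⟩ h
    have h' := normalForm_injective h
    simp only [Prod.mk.injEq] at h'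
    obtain ⟨e1, e2, rfl⟩ := h'
    have e3 : k = k' := congrFun e2 0
    have ht : tr ≠ 1 := by decide
    subst e3
    cases s <;> cases s' <;> simp_all [eq_comm]
  have hr : Set.range f = isotropy x := by
    ext g
    rw [SetLike.mem_coe, mem_isotropy_iff' h0 h1 ht]
    constructor
    · rintro ⟨⟨s, k, o⟩, rfl⟩; exact ⟨s, k, o, rfl⟩
    · rintro ⟨s, k, o, rfl⟩; exact ⟨⟨s, k, o⟩, rfl⟩
  have : Nat.card (isotropy x) = Nat.card (Set.range f) := by rw [hr]; rfl
  rw [this, Nat.card_range_of_injective hf]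
  simp

lemma gE_eq : gE = gD 1 * gS * gD 1 := by
  have h : (1 + 2 : ZMod 3) = 0 := by decide
  have h' : (2 + 1 : ZMod 3) = 0 := by decide
  rw [gS, ← mul_assoc, ← mul_assoc, gD_mul, h, gD_zero, one_mul, mul_assoc, gD_mul, h', gD_zero,
    mul_one]

lemma isotropy_eq_closure {x : E3} (h0 : x 0 = 0) (h1 : x 2 = -x 1) (ht : x 1 ≠ 0) :
    isotropy x = Subgroup.closure {gD 1, gS} := by
  refine le_antisymm ?_ ?_
  · have hD : ∀ k, gD k ∈ Subgroup.closure {gD 1, gS} := by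
      have h1 : gD 1 ∈ Subgroup.closure {gD 1, gS} := Subgroup.subset_closure (by simp)
      have h2 : gD 2 = gD 1 * gD 1 := by rw [gD_mul]; rfl
      intro k
      rcases zmod_three_cases k with rfl | rfl | rfl
      · rw [gD_zero]; exact one_mem _
      · exact h1
      · rw [h2]; exact mul_mem h1 h1
    have hE : gE ∈ Subgroup.closure {gD 1, gS} := by
      rw [gE_eq]
      exact mul_mem (mul_mem (hD 1) (Subgroup.subset_closure (by simp))) (hD 1)
    intro g hg
    obtain ⟨s, k, o, rfl⟩ := (mem_isotropy_iff' h0 h1 ht).1 hg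
    have hm : mono (if s then tr else 1) ![k, 0, 0] ∈ Subgroup.closure {gD 1, gS} := by
      cases s
      · exact hD k
      · have : mono tr ![k, 0, 0] = gD k * (gE * gE) := by
          rw [gE_mul_gE, gD, mono_mul, mul_one]; congr 1; ext i; simp
        simp only [if_true]
        rw [this]; exact mul_mem (hD k) (mul_mem hE hE)
    cases o with
    | none => exact hm
    | some l => exact mul_mem (mul_mem hm hE) (hD l)
  · rw [Subgroup.closure_le]
    rintro g (rfl | rfl)
    · refine ⟨gD_mem 1, ?_⟩
      ext i
      rw [act_gD]
      fin_cases i <;> simp [w_zero, h0]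
    · refine ⟨mul_mem (mul_mem (gD_mem 2) gE_mem) (gD_mem 2), ?_⟩
      ext i
      rw [act_gS, h0, h1]; ring

lemma hasIsotropyG4 {x : E3} (h0 : x 0 = 0) (h1 : x 2 = -x 1) (ht : x 1 ≠ 0) :
    HasIsotropyG4 x := by
  let e : groupG4 ≃* isotropy x := (groupG4.equivMapOfInjective planeHom planeHom_injective).trans
    (MulEquiv.subgroupCongr (groupG4_map.trans (isotropy_eq_closure h0 h1 ht).symm))
  have he : ∀ M, (e M : GL (Fin 3) ℂ) = planeHom M := fun M => rfl
  let i : (Fin 2 → ℂ) → E3 := fun y => !₂[y 0, y 1, 0]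
  let j : (Fin 2 → ℂ) →ₗ[ℂ] E3 :=
    { toFun := fun y => act gP (i y)
      map_add' := fun y z => by ext k; simp [act_gP, i]; ring
      map_smul' := fun c y => by ext k; simp [act_gP, i]; ring }
  have hj : ∀ y, j y = act gP (i y) := fun _ => rfl
  refine ⟨e.symm, j, ?_, ?_, ?_⟩
  · intro y z h
    have h' : i y = i z := by
      have := congrArg (act gP⁻¹) h
      rwa [hj, hj, act_inv_act, act_inv_act] at this
    ext k
    have := congrArg (fun v : E3 => v k.castSucc) h'
    fin_cases k <;> simpa [i] using this
  · rintro ⟨y, hy⟩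
    have e1 := congrArg (fun v : E3 => v 1) hy
    have e2 := congrArg (fun v : E3 => v 2) hy
    simp only [hj, act_gP, i, basisG4] at e1 e2
    simp at e1 e2
    apply ht
    linear_combination -(e1 - e2 - h1) / 2
  · intro g y
    have hg : (g : GL (Fin 3) ℂ) = planeHom (e.symm g) := by rw [← he, e.apply_symm_apply]
    rw [hg, hj, hj, planeHom_apply, act_mul, act_mul, act_inv_act]
    congr 1
    generalize (e.symm g : GL (Fin 2) ℂ) = M
    ext k
    rw [act_coe _ (blockHom M) rfl]
    fin_cases k <;> simp [i, blockHom, Matrix.mulVec, dotProduct, Fin.sum_univ_two]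

/-! ### The sizes and isotropy groups of the sets of solutions -/

lemma act_zero (g : GL (Fin 3) ℂ) : act g 0 = 0 := by
  ext i; rw [act_apply]; simp

lemma isotropy_zero : isotropy 0 = groupK := by
  ext g
  exact ⟨fun h => h.1, fun h => ⟨h, act_zero g⟩⟩

lemma act_mem_solutions {g : GL (Fin 3) ℂ} (hg : g ∈ groupK) {a b c : ℂ} {x : E3}
    (hx : x ∈ solutions a b c) : act g x ∈ solutions a b c := by
  obtain ⟨h6, -, h12, h18⟩ := invariants_act hg x
  rw [mem_solutions] at *
  rwa [h6, h12, h18]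

lemma ncard_signedSolutions {a b c d : ℂ} {x : E3} (hx : x ∈ signedSolutions a b c d) :
    (signedSolutions a b c d).ncard * Nat.card (isotropy x) = 648 := by
  rw [signedSolutions_eq_orbitK hx, ncard_orbitK]

/-- When `b³ = c²`, every orbit of solutions meets the mirror `u = 0`. -/
lemma exists_mem_mirror {a b c : ℂ} (h : b ^ 3 = c ^ 2) {x : E3} (hx : x ∈ solutions a b c) :
    ∃ g ∈ groupK, act g x 0 = 0 ∧ psi (act g x) ^ 4 = b ∧ psi (act g x) ^ 6 = c ∧
      psi (act g x) ^ 2 - 12 * (act g x 1 * act g x 2) ^ 3 = a := by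
  have hx' := mem_solutions.1 hx
  have hl : lam x = 0 ∨ 8 * psi x ^ 3 = lam x := by
    have h1 := C12_C18 x
    rw [hx'.2.1, hx'.2.2, h, sub_self, mul_zero] at h1
    rcases mul_eq_zero.1 h1.symm with h2 | h2
    · exact .inl h2
    · exact .inr (sub_eq_zero.1 (pow_eq_zero_iff (by norm_num) |>.1 h2))
  obtain ⟨g, hg, h0⟩ := exists_coord_zero hl
  obtain ⟨e1, e2, e3⟩ := mem_solutions.1 (act_mem_solutions hg hx)
  have hlam : lam (act g x) = 0 := by rw [lam, h0]; ring
  rw [C12, hlam] at e2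
  rw [C18, hlam] at e3
  rw [C6, chi, h0] at e1
  exact ⟨g, hg, h0, by linear_combination e2, by linear_combination e3, by linear_combination e1⟩

lemma isotropy_eq_bot_of_ne {a b c : ℂ} (h : b ^ 3 ≠ c ^ 2) {x : E3} (hx : x ∈ solutions a b c) :
    isotropy x = ⊥ := by
  obtain ⟨-, h12, h18⟩ := mem_solutions.1 hx
  have h1 := C12_C18 x
  rw [h12, h18] at h1
  have h2 : lam x * (8 * psi x ^ 3 - lam x) ^ 3 ≠ 0 := by
    rw [← h1]; exact mul_ne_zero (by norm_num) (sub_ne_zero.2 h)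
  refine isotropy_eq_bot (left_ne_zero_of_mul h2) fun h3 => right_ne_zero_of_mul h2 ?_
  rw [h3, sub_self]; norm_num

lemma isotropy_equiv_of_eq {a b c : ℂ} (h : b ^ 3 = c ^ 2) (hb : b ≠ 0)
    (hn : ¬ (b = a ^ 2 ∧ c = a ^ 3)) {x : E3} (hx : x ∈ solutions a b c) :
    Nonempty (isotropy x ≃* Multiplicative (ZMod 3)) := by
  obtain ⟨g, hg, h0, e4, e6, e2⟩ := exists_mem_mirror h hx
  have h12 : act g x 1 * act g x 2 ≠ 0 := by
    intro h'
    rw [h'] at e2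
    have : psi (act g x) ^ 2 = a := by linear_combination e2
    exact hn ⟨by rw [← e4, ← this]; ring, by rw [← e6, ← this]; ring⟩
  obtain ⟨e⟩ := isotropy_equiv_C3 h0 (left_ne_zero_of_mul h12) (right_ne_zero_of_mul h12)
    (fun h' => hb (by rw [← e4, h']; norm_num))
  exact ⟨(isotropyEquiv hg x).trans e⟩

/-- When `b = a² ≠ 0` and `c = a³`, every orbit of solutions meets a coordinate axis. -/
lemma exists_mem_axis {a b c : ℂ} (hb : b = a ^ 2) (hc : c = a ^ 3) (ha : a ≠ 0) {x : E3}
    (hx : x ∈ solutions a b c) :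
    ∃ g ∈ groupK, act g x 0 = 0 ∧ act g x 1 ≠ 0 ∧ act g x 2 = 0 := by
  obtain ⟨g, hg, h0, e4, e6, e2⟩ := exists_mem_mirror (by rw [hb, hc]; ring) hx
  have hp : psi (act g x) ≠ 0 := fun h' => ha (by
    rw [h', hb] at e4
    exact pow_eq_zero_iff (n := 2) (by norm_num) |>.1 (by rw [← e4]; norm_num))
  have hp2 : psi (act g x) ^ 2 = a := by
    have : psi (act g x) ^ 4 * (psi (act g x) ^ 2 - a) = 0 := by
      linear_combination e6 - a * e4 + hc - a * hb
    exact sub_eq_zero.1 ((mul_eq_zero.1 this).resolve_left (pow_ne_zero _ hp))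
  have h12 : act g x 1 * act g x 2 = 0 := by
    refine pow_eq_zero_iff (n := 3) (by norm_num) |>.1 ?_
    linear_combination (hp2 - e2) / 12
  rw [psi, h0] at hp
  rcases mul_eq_zero.1 h12 with h1 | h2
  · refine ⟨mono rot 0 * g, mul_mem (mono_mem _ _) hg, ?_, ?_, ?_⟩ <;>
      rw [act_mul, act_mono, sg_rot, one_mul, Pi.zero_apply, w_zero, one_mul]
    · exact h1
    · intro h2
      refine hp ?_
      have h2' : act g x 2 = 0 := h2
      rw [h1, h2']; norm_num
    · exact h0
  · refine ⟨g, hg, h0, fun h1 => hp ?_, h2⟩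
    rw [h1, h2]; norm_num

lemma isotropy_equiv_of_axis {a b c : ℂ} (hb : b = a ^ 2) (hc : c = a ^ 3) (ha : a ≠ 0) {x : E3}
    (hx : x ∈ solutions a b c) :
    Nonempty (isotropy x ≃* Multiplicative (ZMod 3) × Multiplicative (ZMod 3)) := by
  obtain ⟨g, hg, h0, h1, h2⟩ := exists_mem_axis hb hc ha hx
  obtain ⟨e⟩ := isotropy_equiv_C3_prod h0 h1 h2
  exact ⟨(isotropyEquiv hg x).trans e⟩

/-- When `b = c = 0`, every orbit of solutions contains a multiple of `(0, 1, -1)`. -/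
lemma exists_mem_line {a b c : ℂ} (hb : b = 0) (hc : c = 0) {x : E3} (hx : x ∈ solutions a b c) :
    ∃ g ∈ groupK, act g x 0 = 0 ∧ act g x 2 = -act g x 1 ∧ 12 * act g x 1 ^ 6 = a := by
  obtain ⟨g, hg, h0, e4, e6, e2⟩ := exists_mem_mirror (by rw [hb, hc]; norm_num) hx
  have hp : psi (act g x) = 0 := pow_eq_zero_iff (n := 4) (by norm_num) |>.1 (e4.trans hb)
  rw [hp] at e2
  rw [psi, h0] at hp
  obtain ⟨k, hk⟩ := exists_w_mul (y := -act g x 1) (z := act g x 2) (by linear_combination -hp)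
  refine ⟨mono 1 ![0, 0, k] * g, mul_mem (mono_mem _ _) hg, ?_⟩
  simp only [act_mul, act_mono, sg_one, Equiv.Perm.one_apply, one_mul]
  refine ⟨?_, ?_, ?_⟩
  · simp [h0]
  · simp [w_zero, hk]
  · simp only [Matrix.cons_val_one, Matrix.cons_val_zero, w_zero, one_mul]
    linear_combination e2 + 12 * act g x 1 ^ 3 * hp

lemma isotropyG4_of_line {a b c : ℂ} (hb : b = 0) (hc : c = 0) (ha : a ≠ 0) {x : E3}
    (hx : x ∈ solutions a b c) : HasIsotropyG4 x ∧ Nat.card (isotropy x) = 24 := by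
  obtain ⟨g, hg, h0, h1, h2⟩ := exists_mem_line hb hc hx
  have ht : act g x 1 ≠ 0 := fun h => ha (by rw [← h2, h]; norm_num)
  exact ⟨HasIsotropyG4.of_act hg (hasIsotropyG4 h0 h1 ht),
    (Nat.card_congr (isotropyEquiv hg x).toEquiv).trans (card_isotropy_G4 h0 h1 ht)⟩

lemma eq_zero_of_mem_solutions {x : E3} (hx : x ∈ solutions 0 0 0) : x = 0 := by
  obtain ⟨g, hg, h0, h1, h2⟩ := exists_mem_line rfl rfl hx
  have h3 : act g x 1 = 0 := pow_eq_zero_iff (n := 6) (by norm_num) |>.1 (by linear_combination h2 / 12)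
  have h4 : act g x = 0 := by
    ext i; fin_cases i
    exacts [h0, h3, by simpa [h3] using h1]
  rw [← act_inv_act g x, h4, act_zero]

/-- The number of solutions in the generic case. -/
lemma ncard_solutions {a b c : ℂ} (h : (b ^ 3 - c ^ 2) * (a ^ 3 - 3 * a * b + 2 * c) ≠ 0) :
    (solutions a b c).ncard = 1296 := by
  obtain ⟨d, hd⟩ := exists_d a b c
  have hbc : b ^ 3 ≠ c ^ 2 := sub_ne_zero.1 (left_ne_zero_of_mul h)
  have hd0 : d ≠ 0 := fun h0 => right_ne_zero_of_mul h (by rw [← hd, h0]; norm_num)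
  have hd' : 432 * (-d) ^ 2 = a ^ 3 - 3 * a * b + 2 * c := by rw [neg_sq, hd]
  have key : ∀ d, 432 * d ^ 2 = a ^ 3 - 3 * a * b + 2 * c →
      (signedSolutions a b c d).ncard = 648 := by
    intro d hd
    obtain ⟨x, hx⟩ := signedSolutions_nonempty hd
    have := ncard_signedSolutions hx
    rwa [isotropy_eq_bot_of_ne hbc hx.1, Subgroup.card_bot, mul_one] at this
  rw [solutions_eq_union hd, Set.ncard_union_eq _ (signedSolutions_finite ..)
    (signedSolutions_finite ..), key _ hd, key _ hd']
  refine Set.disjoint_left.2 fun x h1 h2 => hd0 ?_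
  have h3 : d = -d := h1.2.symm.trans h2.2
  linear_combination h3 / 2

/-- The sizes of the sets of solutions with prescribed value of `I₉`, and their isotropy groups. -/
lemma orbit_types {a b c d : ℂ} (hd : 432 * d ^ 2 = a ^ 3 - 3 * a * b + 2 * c) :
    (b ^ 3 ≠ c ^ 2 → (signedSolutions a b c d).ncard = 648 ∧
      ∀ x ∈ signedSolutions a b c d, isotropy x = ⊥) ∧
    (b ^ 3 = c ^ 2 → b ≠ 0 → ¬ (b = a ^ 2 ∧ c = a ^ 3) →
      (signedSolutions a b c d).ncard = 216 ∧
      ∀ x ∈ signedSolutions a b c d, Nonempty (isotropy x ≃* Multiplicative (ZMod 3))) ∧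
    (b = a ^ 2 → c = a ^ 3 → a ≠ 0 →
      (signedSolutions a b c d).ncard = 72 ∧
      ∀ x ∈ signedSolutions a b c d,
        Nonempty (isotropy x ≃* Multiplicative (ZMod 3) × Multiplicative (ZMod 3))) ∧
    (b = 0 → c = 0 → a ≠ 0 →
      (signedSolutions a b c d).ncard = 27 ∧ ∀ x ∈ signedSolutions a b c d, HasIsotropyG4 x) ∧
    (a = 0 → b = 0 → c = 0 →
      signedSolutions a b c d = {0} ∧ isotropy 0 = groupK) := by
  obtain ⟨x, hx⟩ := signedSolutions_nonempty hd
  have hN := ncard_signedSolutions hx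
  refine ⟨fun h => ⟨?_, fun y hy => isotropy_eq_bot_of_ne h hy.1⟩,
    fun h hb hn => ⟨?_, fun y hy => isotropy_equiv_of_eq h hb hn hy.1⟩,
    fun hb hc ha => ⟨?_, fun y hy => isotropy_equiv_of_axis hb hc ha hy.1⟩,
    fun hb hc ha => ⟨?_, fun y hy => (isotropyG4_of_line hb hc ha hy.1).1⟩,
    fun ha hb hc => ⟨?_, isotropy_zero⟩⟩
  · rwa [isotropy_eq_bot_of_ne h hx.1, Subgroup.card_bot, mul_one] at hN
  · obtain ⟨e⟩ := isotropy_equiv_of_eq h hb hn hx.1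
    rw [Nat.card_congr e.toEquiv, Nat.card_congr Multiplicative.toAdd, Nat.card_zmod] at hN
    omega
  · obtain ⟨e⟩ := isotropy_equiv_of_axis hb hc ha hx.1
    rw [Nat.card_congr e.toEquiv, Nat.card_prod, Nat.card_congr Multiplicative.toAdd,
      Nat.card_zmod] at hN
    omega
  · rw [(isotropyG4_of_line hb hc ha hx.1).2] at hN
    omega
  · subst ha hb hc
    have h0 := eq_zero_of_mem_solutions hx.1
    ext y
    exact ⟨fun hy => eq_zero_of_mem_solutions hy.1, fun hy => by
      rw [Set.mem_singleton_iff.1 hy, ← h0]; exact hx⟩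

/-! ### Unitary reflections -/

/-- The linear map that multiplies `r` by `ω` and fixes the orthogonal complement of `r`. -/
def reflMap (r : E3) (ω : ℂ) : E3 →ₗ[ℂ] E3 :=
  LinearMap.transvection (((ω - 1) / inner ℂ r r) • (innerSL ℂ r).toLinearMap) r

lemma reflMap_apply (r : E3) (ω : ℂ) (x : E3) :
    reflMap r ω x = x + ((ω - 1) / inner ℂ r r * inner ℂ r x) • r := by
  simp [reflMap, LinearMap.transvection.apply]

lemma inner_reflMap {r : E3} (hr : r ≠ 0) {ω : ℂ} (hω : (starRingEnd ℂ) ω * ω = 1) (x y : E3) :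
    inner ℂ (reflMap r ω x) (reflMap r ω y) = inner ℂ x y := by
  have h0 : inner ℂ r r ≠ (0 : ℂ) := inner_self_ne_zero.2 hr
  have h1 : (starRingEnd ℂ) (inner ℂ r r) = inner ℂ r r := inner_conj_symm r r
  have h2 : (starRingEnd ℂ) (inner ℂ r x) = inner ℂ x r := inner_conj_symm x r
  simp only [reflMap_apply, inner_add_left, inner_add_right, inner_smul_left, inner_smul_right,
    map_mul, map_div₀, map_sub, map_one, h1, h2]
  field_simp
  linear_combination (inner ℂ x r * inner ℂ r y) * hω

/-- The unitary reflection with root `r` and multiplier `ω`. -/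
def refl (r : E3) (hr : r ≠ 0) (ω : ℂ) (hω : (starRingEnd ℂ) ω * ω = 1) : E3 ≃ₗᵢ[ℂ] E3 :=
  ((reflMap r ω).isometryOfInner (inner_reflMap hr hω)).toLinearIsometryEquiv rfl

lemma refl_apply (r : E3) (hr : r ≠ 0) (ω : ℂ) (hω : (starRingEnd ℂ) ω * ω = 1) (x : E3) :
    refl r hr ω hω x = x + ((ω - 1) / inner ℂ r r * inner ℂ r x) • r := reflMap_apply r ω x

lemma det_refl (r : E3) (hr : r ≠ 0) (ω : ℂ) (hω : (starRingEnd ℂ) ω * ω = 1) :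
    LinearMap.det ((refl r hr ω hω).toLinearEquiv : E3 →ₗ[ℂ] E3) = ω := by
  have : ((refl r hr ω hω).toLinearEquiv : E3 →ₗ[ℂ] E3) = reflMap r ω := by ext x; rfl
  rw [this, reflMap, LinearMap.transvection.det]
  have h0 : inner ℂ r r ≠ (0 : ℂ) := inner_self_ne_zero.2 hr
  simp only [LinearMap.smul_apply, ContinuousLinearMap.coe_coe, innerSL_apply_apply, smul_eq_mul]
  field_simp
  ring

lemma inner_E3 (x y : E3) : inner ℂ x y = (starRingEnd ℂ) (x 0) * y 0 + (starRingEnd ℂ) (x 1) * y 1 +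
    (starRingEnd ℂ) (x 2) * y 2 := by
  simp [PiLp.inner_apply, Fin.sum_univ_three, mul_comm]

lemma star_eps_mul : (starRingEnd ℂ) eps * eps = 1 := by
  rw [star_eps]; linear_combination -eps_sum

/-! ### Eisenstein integers -/

/-- The Eisenstein integer `a + b ε` is represented by the pair `(a, b)`. -/
abbrev Eis := ℤ × ℤ

namespace Eis

/-- The complex number represented by a pair of integers. -/
def val (p : Eis) : ℂ := p.1 + p.2 * eps

/-- Multiplication of Eisenstein integers. -/
def mul (p q : Eis) : Eis := (p.1 * q.1 - p.2 * q.2, p.1 * q.2 + p.2 * q.1 - p.2 * q.2)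

/-- Complex conjugation of Eisenstein integers. -/
def conj (p : Eis) : Eis := (p.1 - p.2, -p.2)

lemma val_add (p q : Eis) : val (p + q) = val p + val q := by
  simp only [val, Prod.fst_add, Prod.snd_add]; push_cast; ring
lemma val_sub (p q : Eis) : val (p - q) = val p - val q := by
  simp only [val, Prod.fst_sub, Prod.snd_sub]; push_cast; ring
lemma val_mul (p q : Eis) : val (mul p q) = val p * val q := by
  simp only [val, mul]; push_cast; linear_combination -(p.2 * q.2 : ℂ) * eps_sum
lemma val_conj (p : Eis) : val (conj p) = (starRingEnd ℂ) (val p) := by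
  simp only [val, conj, map_add, map_mul, map_intCast, star_eps]; push_cast; ring
lemma val_zero : val 0 = 0 := by simp [val]

lemma val_re (p : Eis) : (val p).re = p.1 - p.2 / 2 := by
  have h : eps.re = -1 / 2 := by
    have := congrArg Complex.re star_eps
    simp at this
    linarith
  simp [val, h]; ring

lemma val_eq_zero {p : Eis} (h : val p = 0) : p = 0 := by
  have hc := congrArg (starRingEnd ℂ) h
  rw [← val_conj, map_zero] at hc
  simp only [val, conj] at h hc
  push_cast at hc
  have h2 : (p.2 : ℂ) * (1 + 2 * eps) = 0 := by linear_combination h - hc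
  have h4 : p.2 = 0 := by exact_mod_cast (mul_eq_zero.1 h2).resolve_right theta_ne_zero
  rw [h4] at h
  exact Prod.ext (by simpa using h) h4

lemma val_injective : Function.Injective val := fun p q h =>
  sub_eq_zero.1 (val_eq_zero (by rw [val_sub, h, sub_self]))

end Eis

/-- The triple `(p, q, m)` represents the vector `(p, q, r)` with Eisenstein integer coordinates
and `p + q + r = (1 + 2ε) m`. -/
abbrev Vec := Eis × Eis × Eis

namespace Vec

open Eis (mul conj)

/-- The third coordinate. -/
def third (v : Vec) : Eis := mul (1, 2) v.2.2 - v.1 - v.2.1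

/-- The vector of `ℂ³` represented by a triple. -/
def val (v : Vec) : E3 := !₂[Eis.val v.1, Eis.val v.2.1, Eis.val (third v)]

/-- The triple representing the vector with the given coordinates; the division is exact only when
their sum is divisible by `θ`. -/
def ofCoords (p q r : Eis) : Vec :=
  let s := mul (p + q + r) (-1, -2)
  (p, q, (s.1 / 3, s.2 / 3))

/-- The Hermitian inner product. -/
def ip (v w : Vec) : Eis :=
  mul (conj v.1) w.1 + mul (conj v.2.1) w.2.1 + mul (conj (third v)) (third w)

/-- The vectors `v` and `w` are proportional. -/
def Parallel (v w : Vec) : Prop :=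
  mul v.1 w.2.1 = mul v.2.1 w.1 ∧ mul v.1 (third w) = mul (third v) w.1 ∧
    mul v.2.1 (third w) = mul (third v) w.2.1

instance (v w : Vec) : Decidable (Parallel v w) := by unfold Parallel; infer_instance

lemma val_zero' (v : Vec) : val v 0 = Eis.val v.1 := rfl
lemma val_one' (v : Vec) : val v 1 = Eis.val v.2.1 := rfl
lemma val_two' (v : Vec) : val v 2 = (1 + 2 * eps) * Eis.val v.2.2 - Eis.val v.1 - Eis.val v.2.1 := by
  have : Eis.val (1, 2) = 1 + 2 * eps := by simp [Eis.val]
  rw [← this, ← Eis.val_mul, ← Eis.val_sub, ← Eis.val_sub]; rfl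

lemma val_third (v : Vec) : Eis.val (third v) = val v 2 := rfl

lemma val_sub (v w : Vec) : val (v - w) = val v - val w := by
  ext i
  fin_cases i
  · exact Eis.val_sub _ _
  · exact Eis.val_sub _ _
  · change val (v - w) 2 = val v 2 - val w 2
    simp only [val_two', Prod.fst_sub, Prod.snd_sub, Eis.val_sub]; ring

lemma val_neg (v : Vec) : (-v).val = -v.val := by
  have := val_sub (v - v) v
  rwa [sub_self, zero_sub, ← sub_self v, val_sub, sub_self, zero_sub] at this

lemma val_injective : Function.Injective val := by
  intro v w h
  have h0 : v.1 = w.1 := Eis.val_injective (congrArg (fun x : E3 => x 0) h)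
  have h1 : v.2.1 = w.2.1 := Eis.val_injective (congrArg (fun x : E3 => x 1) h)
  have h2 : val v 2 = val w 2 := congrArg (fun x : E3 => x 2) h
  rw [val_two', val_two', h0, h1] at h2
  have h4 : Eis.val v.2.2 = Eis.val w.2.2 :=
    mul_left_cancel₀ theta_ne_zero (by linear_combination h2)
  exact Prod.ext h0 (Prod.ext h1 (Eis.val_injective h4))

lemma inner_val (v w : Vec) : inner ℂ (val v) (val w) = Eis.val (ip v w) := by
  rw [inner_E3, ip]
  simp only [Eis.val_add, Eis.val_mul, Eis.val_conj]
  rfl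

lemma parallel_of_smul {v w : Vec} {k : ℂ} (h : val v = k • val w) : Parallel v w := by
  have h0 : Eis.val v.1 = k * Eis.val w.1 := congrArg (fun x : E3 => x 0) h
  have h1 : Eis.val v.2.1 = k * Eis.val w.2.1 := congrArg (fun x : E3 => x 1) h
  have h2 : Eis.val (third v) = k * Eis.val (third w) := congrArg (fun x : E3 => x 2) h
  refine ⟨?_, ?_, ?_⟩ <;> apply Eis.val_injective <;> simp only [Eis.val_mul, h0, h1, h2] <;> ring

end Vec

/-! ### The generating reflections -/

/-- The reflections that generate the symmetry groups of the polyhedra. -/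
inductive Gen
  | d0 | d1 | s | t

namespace Gen

open Eis (mul conj)

/-- The root of a generating reflection. -/
def root : Gen → E3
  | d0 => !₂[1, 0, 0]
  | d1 => !₂[0, 1, 0]
  | s => !₂[1, 1, 1]
  | t => !₂[1, 0, -1]

/-- The nontrivial eigenvalue of a generating reflection. -/
def mult : Gen → ℂ
  | t => -1
  | _ => eps

lemma root_ne (g : Gen) : root g ≠ 0 := by
  intro h
  cases g
  · simpa [root] using congrArg (fun x : E3 => x 0) h
  · simpa [root] using congrArg (fun x : E3 => x 1) h
  · simpa [root] using congrArg (fun x : E3 => x 0) h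
  · simpa [root] using congrArg (fun x : E3 => x 0) h

lemma mult_unit (g : Gen) : (starRingEnd ℂ) (mult g) * mult g = 1 := by
  cases g <;> simp [mult, star_eps_mul]

/-- The generating reflections as unitary maps. -/
def real (g : Gen) : E3 ≃ₗᵢ[ℂ] E3 := refl (root g) (root_ne g) (mult g) (mult_unit g)

lemma d0_apply (x : E3) : real d0 x = !₂[eps * x 0, x 1, x 2] := by
  rw [real, refl_apply, inner_E3, inner_E3]
  ext i; fin_cases i <;> simp [root, mult]; ring

lemma d1_apply (x : E3) : real d1 x = !₂[x 0, eps * x 1, x 2] := by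
  rw [real, refl_apply, inner_E3, inner_E3]
  ext i; fin_cases i <;> simp [root, mult]; ring

lemma s_apply (x : E3) (i : Fin 3) : real s x i = x i + (eps - 1) / 3 * (x 0 + x 1 + x 2) := by
  rw [real, refl_apply, inner_E3, inner_E3]
  fin_cases i <;> simp [root, mult, -mul_eq_mul_right_iff] <;> ring

lemma t_apply (x : E3) : real t x = !₂[x 2, x 1, x 0] := by
  rw [real, refl_apply, inner_E3, inner_E3]
  ext i; fin_cases i <;> simp [root, mult] <;> ring

/-- The generating reflections as maps of triples of Eisenstein integers. -/
def model : Gen → Vec → Vec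
  | d0, v => (mul (0, 1) v.1, v.2.1, v.2.2 - mul (-1, -1) v.1)
  | d1, v => (v.1, mul (0, 1) v.2.1, v.2.2 - mul (-1, -1) v.2.1)
  | s, v => (v.1 + mul (-1, -1) v.2.2, v.2.1 + mul (-1, -1) v.2.2, mul (0, 1) v.2.2)
  | t, v => (v.third, v.2.1, v.2.2)

lemma val_eps : Eis.val (0, 1) = eps := by simp [Eis.val]
lemma val_eps_sq : Eis.val (-1, -1) = -1 - eps := by simp [Eis.val]; ring

lemma real_val (g : Gen) (v : Vec) : real g (v.val) = (model g v).val := by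
  have h := eps_sum
  cases g
  · rw [d0_apply]
    ext i; fin_cases i
    · simp [Vec.val_zero', model, Eis.val_mul, val_eps]
    · rfl
    · simp [Vec.val_two', model, Eis.val_mul, Eis.val_sub, val_eps, val_eps_sq]; grind
  · rw [d1_apply]
    ext i; fin_cases i
    · rfl
    · simp [Vec.val_one', model, Eis.val_mul, val_eps]
    · simp [Vec.val_two', model, Eis.val_mul, Eis.val_sub, val_eps, val_eps_sq]; grind
  · ext i
    rw [s_apply]
    simp only [Vec.val_zero', Vec.val_one', Vec.val_two']
    fin_cases i
    · simp [Vec.val_zero', model, Eis.val_mul, Eis.val_add, val_eps_sq]; grind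
    · simp [Vec.val_one', model, Eis.val_mul, Eis.val_add, val_eps_sq]; grind
    · simp [Vec.val_two', model, Eis.val_mul, Eis.val_add, val_eps, val_eps_sq]; grind
  · rw [t_apply]
    ext i; fin_cases i
    · rfl
    · rfl
    · have h1 : Eis.val v.third = (1 + 2 * eps) * Eis.val v.2.2 - Eis.val v.1 - Eis.val v.2.1 :=
        Vec.val_two' v
      refine Eq.trans ?_ (Vec.val_two' (model t v)).symm
      simp only [model, h1]
      simp [Vec.val_zero']
      ring

lemma det_real (g : Gen) :
    LinearMap.det ((real g).toLinearEquiv : E3 →ₗ[ℂ] E3) = mult g := det_refl _ _ _ _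

/-- The image of a triple under a word in the generators. -/
def eval (l : List Gen) (v : Vec) : Vec := l.foldr model v

lemma prod_val (l : List Gen) (v : Vec) : (l.map real).prod v.val = (eval l v).val := by
  induction l with
  | nil => rfl
  | cons g l ih =>
    rw [List.map_cons, List.prod_cons, LinearIsometryEquiv.coe_mul, Function.comp_apply, ih, real_val]
    rfl

/-- Triples representing the multiples by `1 + 2ε` of the standard basis. -/
def basis : List Vec := [((1, 2), 0, (1, 0)), (0, (1, 2), (1, 0)), (0, 0, (1, 0))]

lemma ext_basis {f g : E3 →ₗ[ℂ] E3} (h : ∀ v ∈ basis, f v.val = g v.val) : f = g := by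
  have h3 := theta_ne_zero
  have hv : Eis.val (1, 2) = 1 + 2 * eps := by simp [Eis.val]
  have hv1 : Eis.val (1, 0) = 1 := by simp [Eis.val]
  ext x : 1
  have hx : x = (x 0 / (1 + 2 * eps)) • Vec.val ((1, 2), 0, (1, 0)) +
      (x 1 / (1 + 2 * eps)) • Vec.val (0, (1, 2), (1, 0)) +
      (x 2 / (1 + 2 * eps)) • Vec.val (0, 0, (1, 0)) := by
    ext i
    fin_cases i
    · simp [Vec.val_zero', hv, Eis.val_zero, h3]
    · simp [Vec.val_one', hv, Eis.val_zero, h3]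
    · simp [Vec.val_two', hv, hv1, Eis.val_zero, h3]
  rw [hx]
  simp only [map_add, map_smul]
  rw [h _ (by simp [basis]), h _ (by simp [basis]), h _ (by simp [basis])]

/-- Equality of words in the generating reflections is decidable. -/
lemma prod_eq_prod_iff (l m : List Gen) : (l.map real).prod = (m.map real).prod ↔
    ∀ v ∈ basis, eval l v = eval m v := by
  constructor
  · intro h v _
    apply Vec.val_injective
    rw [← prod_val, ← prod_val, h]
  · intro h
    have := ext_basis (f := ((l.map real).prod.toLinearEquiv : E3 →ₗ[ℂ] E3))
      (g := ((m.map real).prod.toLinearEquiv : E3 →ₗ[ℂ] E3)) fun v hv => by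
        change (l.map real).prod v.val = (m.map real).prod v.val
        rw [prod_val, prod_val, h v hv]
    exact LinearIsometryEquiv.ext fun x => LinearMap.congr_fun this x

/-- The images of a triple under the words of length at most `k` in the given generators. -/
def reach (gs : List Gen) (v : Vec) : ℕ → List Vec
  | 0 => [v]
  | k + 1 => reach gs v k ++ gs.flatMap fun g => (reach gs v k).map (model g)

lemma exists_of_mem_reach {gs : List Gen} {v u : Vec} {k : ℕ} (h : u ∈ reach gs v k) :
    ∃ g ∈ Subgroup.closure {x | ∃ g ∈ gs, x = real g}, u.val = g v.val := by
  induction k generalizing u with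
  | zero =>
    rw [reach, List.mem_singleton] at h
    exact ⟨1, one_mem _, by rw [h]; rfl⟩
  | succ k ih =>
    rw [reach, List.mem_append, List.mem_flatMap] at h
    rcases h with h | ⟨g, hg, h⟩
    · exact ih h
    · obtain ⟨u', hu', rfl⟩ := List.mem_map.1 h
      obtain ⟨x, hx, e⟩ := ih hu'
      exact ⟨real g * x, mul_mem (Subgroup.subset_closure ⟨g, hg, rfl⟩) hx, by
        rw [LinearIsometryEquiv.coe_mul, Function.comp_apply, ← e, real_val]⟩

end Gen

/-! ### Regular systems from Eisenstein integers -/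

namespace Vec

/-- Scalar multiplication by an Eisenstein integer. -/
def smul (k : Eis) (v : Vec) : Vec := (Eis.mul k v.1, Eis.mul k v.2.1, Eis.mul k v.2.2)

lemma val_smul (k : Eis) (v : Vec) : (smul k v).val = k.val • v.val := by
  ext i
  fin_cases i
  · exact Eis.val_mul _ _
  · exact Eis.val_mul _ _
  · change (smul k v).val 2 = k.val * v.val 2
    simp only [val_two', smul, Eis.val_mul]; ring

/-- The determinant of three vectors. -/
def det (u v w : Vec) : Eis :=
  Eis.mul u.1 (Eis.mul v.2.1 (third w) - Eis.mul (third v) w.2.1) -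
    Eis.mul u.2.1 (Eis.mul v.1 (third w) - Eis.mul (third v) w.1) +
    Eis.mul (third u) (Eis.mul v.1 w.2.1 - Eis.mul v.2.1 w.1)

end Vec

lemma span_eq_top_of_det {u v w : E3} (h : u 0 * (v 1 * w 2 - v 2 * w 1) -
    u 1 * (v 0 * w 2 - v 2 * w 0) + u 2 * (v 0 * w 1 - v 1 * w 0) ≠ 0) :
    Submodule.span ℂ {u, v, w} = ⊤ := by
  rw [eq_top_iff]
  rintro x -
  rw [Submodule.mem_span_triple]
  set δ := u 0 * (v 1 * w 2 - v 2 * w 1) -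
    u 1 * (v 0 * w 2 - v 2 * w 0) + u 2 * (v 0 * w 1 - v 1 * w 0) with hδ
  -- the coefficients are given by Cramer's rule
  refine ⟨(x 0 * (v 1 * w 2 - v 2 * w 1) - x 1 * (v 0 * w 2 - v 2 * w 0) +
      x 2 * (v 0 * w 1 - v 1 * w 0)) / δ,
    (u 0 * (x 1 * w 2 - x 2 * w 1) - u 1 * (x 0 * w 2 - x 2 * w 0) +
      u 2 * (x 0 * w 1 - x 1 * w 0)) / δ,
    (u 0 * (v 1 * x 2 - v 2 * x 1) - u 1 * (v 0 * x 2 - v 2 * x 0) +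
      u 2 * (v 0 * x 1 - v 1 * x 0)) / δ, ?_⟩
  ext i
  simp only [PiLp.add_apply, PiLp.smul_apply, smul_eq_mul]
  field_simp
  rw [hδ]
  fin_cases i <;> simp <;> ring

lemma eq_add_smul_of_mem_line {u v w : E3} (h : u ∈ line[ℂ, v, w]) : ∃ k : ℂ, u - v = k • (w - v) := by
  obtain ⟨k, rfl⟩ := mem_affineSpan_pair_iff_exists_lineMap_eq.1 h
  exact ⟨k, by simp [AffineMap.lineMap_apply]⟩

lemma mem_line_of_eq {u v w : E3} {k : ℂ} (h : u - v = k • (w - v)) : u ∈ line[ℂ, v, w] :=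
  mem_affineSpan_pair_iff_exists_lineMap_eq.2 ⟨k, by
    rw [AffineMap.lineMap_apply, vsub_eq_sub, ← h]; simp⟩

/-- If the generators of a group map a finite set into itself, then so does the group. -/
lemma mapsTo_of_closure {T : Set (E3 ≃ₗᵢ[ℂ] E3)} {S : Set E3} (hS : S.Finite)
    (h : ∀ g ∈ T, ∀ x ∈ S, g x ∈ S) {g : E3 ≃ₗᵢ[ℂ] E3} (hg : g ∈ Subgroup.closure T) :
    ∀ x ∈ S, g x ∈ S := by
  induction hg using Subgroup.closure_induction with
  | mem g hg => exact h g hg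
  | one => exact fun x hx => hx
  | mul g k _ _ hg hk => exact fun x hx => hg _ (hk x hx)
  | inv g _ hg =>
    intro x hx
    have h1 : g '' S = S := Set.eq_of_subset_of_ncard_le (Set.image_subset_iff.2 hg)
      (Set.ncard_image_of_injective S g.injective).ge hS
    obtain ⟨y, hy, rfl⟩ := h1.ge hx
    rwa [← Function.comp_apply (f := ⇑g⁻¹), ← LinearIsometryEquiv.coe_mul, inv_mul_cancel]

/-- The data of a regular system with Eisenstein integer coordinates, up to a scaling. The lists `V`
and `N` contain the orbits of the base vertex `v` and of the normal vector `n` of the base face. -/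
structure ModelSystem where
  (r₁ r₂ r₃ : Gen)
  (v n : Vec)
  (V N : List Vec)
  (c k : Eis)
  comm : ∀ u ∈ Gen.basis, Gen.eval [r₁, r₃] u = Gen.eval [r₃, r₁] u
  fixed : ∀ x, r₁.real x = x → r₂.real x = x → r₃.real x = x → x = 0
  r₁_n : r₁.model n = n
  r₂_v : r₂.model v = v
  r₂_n : r₂.model n = n
  r₃_v : r₃.model v = v
  r₃_w : r₃.model (r₁.model v) = r₁.model v
  ip_n_v : n.ip v = c
  c_ne : c ≠ 0
  r₁_v_ne : r₁.model v ≠ v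
  r₃_n_ne : r₃.model n ≠ n
  r₁_w : r₁.model (r₁.model v) - v = Vec.smul k (r₁.model v - v)
  r₂_w : ¬ Vec.Parallel (r₂.model (r₁.model v) - v) (r₁.model v - v)
  det_ne : Vec.det v (r₁.model v) n ≠ 0
  mem_V : v ∈ V
  mem_N : n ∈ N
  closed_V : ∀ r ∈ [r₁, r₂, r₃], ∀ u ∈ V, r.model u ∈ V
  closed_N : ∀ r ∈ [r₁, r₂, r₃], ∀ u ∈ N, r.model u ∈ N
  vert_edge : ∀ u ∈ V, Vec.Parallel (u - v) (r₁.model v - v) →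
    u ∈ [v, r₁.model v, r₁.model (r₁.model v)]
  vert_edge_ip : ∀ u ∈ V, Vec.Parallel (u - v) (r₁.model v - v) → v.ip u = v.ip (r₁.model v) →
    u = r₁.model v
  edge_face : ∀ m ∈ N, m.ip v = c → m.ip (r₁.model v) = c →
    m ∈ [n, r₃.model n, r₃.model (r₃.model n)]
  vert_face : ∀ m ∈ N, m.ip v = c → m ∈ Gen.reach [r₂, r₃] n 4
  face_vert : ∀ u ∈ V, n.ip u = c → u ∈ Gen.reach [r₁, r₂] v 4
  face_vert_ip : ∀ u ∈ V, n.ip u = c → v.ip u = v.ip (r₁.model v) →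
    u ∈ [r₁.model v, r₂.model (r₁.model v), r₂.model (r₂.model (r₁.model v))]

namespace ModelSystem

variable (M : ModelSystem) (t : ℂ)

/-- The base vertex, scaled by `t`. -/
def baseV : E3 := t • M.v.val

/-- The normal vector of the base face through the base vertex, normalized so that its inner product
with the base vertex is `1`. -/
def baseN : E3 := ((starRingEnd ℂ) (t * M.c.val))⁻¹ • M.n.val

/-- The generators of the symmetry group. -/
def gens : Set (E3 ≃ₗᵢ[ℂ] E3) := {M.r₁.real, M.r₂.real, M.r₃.real}

lemma real_smul (r : Gen) (s : ℂ) (u : Vec) : r.real (s • u.val) = s • (r.model u).val := by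
  rw [map_smul, Gen.real_val]

lemma exists_vec (L : List Vec) (hL : ∀ r ∈ [M.r₁, M.r₂, M.r₃], ∀ u ∈ L, r.model u ∈ L) {u : Vec}
    (hu : u ∈ L) (s : ℂ) {g : E3 ≃ₗᵢ[ℂ] E3} (hg : g ∈ Subgroup.closure M.gens) :
    ∃ u' ∈ L, g (s • u.val) = s • u'.val := by
  have hfin : ((fun u : Vec => s • u.val) '' {u | u ∈ L}).Finite := L.finite_toSet.image _
  obtain ⟨u', hu', e⟩ := mapsTo_of_closure (T := M.gens) hfin (by
    rintro g hg _ ⟨u, hu, rfl⟩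
    have : ∃ r ∈ [M.r₁, M.r₂, M.r₃], g = r.real := by
      rcases hg with rfl | rfl | rfl
      exacts [⟨_, by simp, rfl⟩, ⟨_, by simp, rfl⟩, ⟨_, by simp, rfl⟩]
    obtain ⟨r, hr, rfl⟩ := this
    exact ⟨r.model u, hL r hr u hu, (real_smul r s u).symm⟩) hg _ ⟨u, hu, rfl⟩
  exact ⟨u', hu', e.symm⟩

lemma exists_vec_v {g : E3 ≃ₗᵢ[ℂ] E3} (hg : g ∈ Subgroup.closure M.gens) :
    ∃ u ∈ M.V, g (M.baseV t) = t • u.val := M.exists_vec M.V M.closed_V M.mem_V t hg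

lemma exists_vec_n {g : E3 ≃ₗᵢ[ℂ] E3} (hg : g ∈ Subgroup.closure M.gens) :
    ∃ u ∈ M.N, g (M.baseN t) = ((starRingEnd ℂ) (t * M.c.val))⁻¹ • u.val :=
  M.exists_vec M.N M.closed_N M.mem_N _ hg

lemma orbit_finite (x : E3) (s : ℂ) (L : List Vec)
    (h : ∀ g ∈ Subgroup.closure M.gens, ∃ u ∈ L, g x = s • u.val) :
    {y | ∃ g ∈ Subgroup.closure M.gens, y = g x}.Finite := by
  refine (L.finite_toSet.image fun u : Vec => s • u.val).subset ?_
  rintro _ ⟨g, hg, rfl⟩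
  obtain ⟨u, hu, e⟩ := h g hg
  exact ⟨u, hu, e.symm⟩

variable {t}

lemma ip_eq_iff (ht : t ≠ 0) (u u' u'' : Vec) :
    inner ℂ (t • u.val) (t • u'.val) = inner ℂ (t • u.val) (t • u''.val) ↔ u.ip u' = u.ip u'' := by
  have h : (starRingEnd ℂ) t ≠ 0 := by simpa using ht
  simp only [inner_smul_left, inner_smul_right, Vec.inner_val, mul_right_inj' ht, mul_right_inj' h]
  exact Eis.val_injective.eq_iff

lemma c_val_ne : M.c.val ≠ 0 := fun h => M.c_ne (Eis.val_eq_zero h)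

lemma inner_eq_one_iff (ht : t ≠ 0) (m u : Vec) :
    inner ℂ (((starRingEnd ℂ) (t * M.c.val))⁻¹ • m.val) (t • u.val) = 1 ↔ m.ip u = M.c := by
  have hc := M.c_val_ne
  rw [inner_smul_left, inner_smul_right, Vec.inner_val, map_inv₀, Complex.conj_conj]
  rw [← Eis.val_injective.eq_iff]
  constructor
  · intro h
    field_simp at h
    exact h
  · intro h
    rw [h]
    field_simp

lemma parallel_of_mem_line (ht : t ≠ 0) {u v w : Vec}
    (h : t • u.val ∈ line[ℂ, t • v.val, t • w.val]) : Vec.Parallel (u - v) (w - v) := by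
  obtain ⟨k, hk⟩ := eq_add_smul_of_mem_line h
  refine Vec.parallel_of_smul (k := k) ?_
  rw [Vec.val_sub, Vec.val_sub]
  rw [← smul_sub, ← smul_sub, smul_comm] at hk
  exact smul_right_injective _ ht hk

lemma pow_of_mem {r : Gen} {s : ℂ} {u u' : Vec}
    (h : u ∈ [u', r.model u', r.model (r.model u')]) :
    ∃ k : ℕ, s • u.val = (r.real ^ k) (s • u'.val) := by
  simp only [List.mem_cons, List.not_mem_nil, or_false] at h
  rcases h with rfl | rfl | rfl
  · exact ⟨0, rfl⟩
  · exact ⟨1, by rw [pow_one, real_smul]⟩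
  · exact ⟨2, by rw [pow_two, LinearIsometryEquiv.coe_mul, Function.comp_apply, real_smul, real_smul]⟩

lemma exists_of_reach {r r' : Gen} {s : ℂ} {u u' : Vec} {k : ℕ} (h : u ∈ Gen.reach [r, r'] u' k) :
    ∃ g ∈ Subgroup.closure {r.real, r'.real}, s • u.val = g (s • u'.val) := by
  obtain ⟨g, hg, e⟩ := Gen.exists_of_mem_reach h
  refine ⟨g, ?_, by rw [map_smul, e]⟩
  convert hg using 2
  ext x
  simp

variable (t)

/-- The regular system given by the model and a scaling factor. -/
def system (ht : t ≠ 0) : RegularSystem where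
  R₁ := M.r₁.real
  R₂ := M.r₂.real
  R₃ := M.r₃.real
  v₀ := M.baseV t
  n₀ := M.baseN t
  R₁_n := by rw [baseN, real_smul, M.r₁_n]
  R₂_v := by rw [baseV, real_smul, M.r₂_v]
  R₂_n := by rw [baseN, real_smul, M.r₂_n]
  R₃_v := by rw [baseV, real_smul, M.r₃_v]
  R₃_w := by rw [baseV, real_smul, real_smul, M.r₃_w]
  comm := by simpa using (Gen.prod_eq_prod_iff [M.r₁, M.r₃] [M.r₃, M.r₁]).2 M.comm
  inner_n_v := (M.inner_eq_one_iff ht _ _).2 M.ip_n_v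
  R₁_v_ne := fun h => M.r₁_v_ne <| by
    rw [baseV, real_smul] at h
    exact Vec.val_injective (smul_right_injective _ ht h)
  R₃_n_ne := fun h => M.r₃_n_ne <| by
    rw [baseN, real_smul] at h
    refine Vec.val_injective (smul_right_injective _ (inv_ne_zero ?_) h)
    exact (_root_.map_ne_zero _).2 (mul_ne_zero ht M.c_val_ne)
  R₁_w := by
    refine mem_line_of_eq (k := M.k.val) ?_
    rw [baseV, real_smul, real_smul, ← smul_sub, ← smul_sub, ← Vec.val_sub, ← Vec.val_sub, M.r₁_w,
      Vec.val_smul, smul_comm]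
  R₂_w := fun h => M.r₂_w <| by
    rw [baseV, real_smul, real_smul] at h
    exact parallel_of_mem_line ht h
  span := by
    rw [baseV, real_smul, baseN]
    apply span_eq_top_of_det
    have h1 : (starRingEnd ℂ) (t * M.c.val) ≠ 0 :=
      (_root_.map_ne_zero _).2 (mul_ne_zero ht M.c_val_ne)
    have h2 : (Vec.det M.v (M.r₁.model M.v) M.n).val ≠ 0 := fun h => M.det_ne (Eis.val_eq_zero h)
    have h3 := mul_ne_zero (mul_ne_zero (mul_ne_zero ht ht) (inv_ne_zero h1)) h2
    convert h3 using 1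
    simp only [Vec.det, Eis.val_add, Eis.val_sub, Eis.val_mul, Vec.val_third, PiLp.smul_apply,
      smul_eq_mul, Vec.val_zero', Vec.val_one']
    ring
  fixed := M.fixed
  finite_v := M.orbit_finite _ t M.V fun g hg => M.exists_vec_v t hg
  finite_n := M.orbit_finite _ _ M.N fun g hg => M.exists_vec_n t hg
  vert_edge g hg h := by
    obtain ⟨u, hu, e⟩ := M.exists_vec_v t hg
    rw [e, baseV, real_smul] at h
    rw [e]
    exact pow_of_mem (M.vert_edge u hu (parallel_of_mem_line ht h))
  vert_edge_inner g hg h h' := by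
    obtain ⟨u, hu, e⟩ := M.exists_vec_v t hg
    rw [e, baseV, real_smul] at h h'
    rw [e, baseV, real_smul]
    rw [M.vert_edge_ip u hu (parallel_of_mem_line ht h) ((ip_eq_iff ht _ _ _).1 h')]
  edge_face g hg h h' := by
    obtain ⟨u, hu, e⟩ := M.exists_vec_n t hg
    rw [e, baseV] at h h'
    rw [real_smul] at h'
    rw [e]
    exact pow_of_mem (M.edge_face u hu ((M.inner_eq_one_iff ht _ _).1 h)
      ((M.inner_eq_one_iff ht _ _).1 h'))
  vert_face g hg h := by
    obtain ⟨u, hu, e⟩ := M.exists_vec_n t hg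
    rw [e, baseV] at h
    rw [e]
    exact exists_of_reach (M.vert_face u hu ((M.inner_eq_one_iff ht _ _).1 h))
  face_vert g hg h := by
    obtain ⟨u, hu, e⟩ := M.exists_vec_v t hg
    rw [e, baseN] at h
    rw [e]
    exact exists_of_reach (M.face_vert u hu ((M.inner_eq_one_iff ht _ _).1 h))
  face_vert_inner g hg h h' := by
    obtain ⟨u, hu, e⟩ := M.exists_vec_v t hg
    rw [e, baseN] at h
    rw [e, baseV, real_smul] at h'
    rw [e, baseV, real_smul]
    exact pow_of_mem (M.face_vert_ip u hu ((M.inner_eq_one_iff ht _ _).1 h) ((ip_eq_iff ht _ _ _).1 h'))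

end ModelSystem

/-! ### The three polyhedra -/

namespace Gen



lemma orderOf_real {a : Gen} {p : ℕ} [Fact p.Prime]
    (h : ∀ v ∈ basis, eval (List.replicate p a) v = v) (h' : ¬ ∀ v ∈ basis, eval [a] v = v) :
    orderOf a.real = p := by
  apply orderOf_eq_prime
  · simpa using (prod_eq_prod_iff (List.replicate p a) []).2 h
  · intro h1
    exact h' ((prod_eq_prod_iff [a] []).1 (by simpa using h1))

/-- Alternating words. -/
def alt : Gen → Gen → ℕ → List Gen
  | _, _, 0 => []
  | a, b, n + 1 => a :: alt b a n

lemma altProd_real (a b : Gen) (n : ℕ) : altProd a.real b.real n = ((alt a b n).map real).prod := by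
  induction n generalizing a b with
  | zero => rfl
  | succ n ih => rw [altProd, ih]; rfl

lemma isBraidLength_real {a b : Gen} {q : ℕ} (hq : 0 < q)
    (h : ∀ v ∈ basis, eval (alt a b q) v = eval (alt b a q) v)
    (h' : ∀ n < q, 0 < n → ¬ ∀ v ∈ basis, eval (alt a b n) v = eval (alt b a n) v) :
    IsBraidLength a.real b.real q := by
  refine ⟨⟨hq, ?_⟩, fun n hn => ?_⟩
  · rw [altProd_real, altProd_real]; exact (prod_eq_prod_iff _ _).2 h
  · by_contra hlt
    refine h' n (not_le.1 hlt) hn.1 ((prod_eq_prod_iff _ _).1 ?_)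
    rw [← altProd_real, ← altProd_real]; exact hn.2

lemma orderOf_d0 : orderOf d0.real = 3 := orderOf_real (by decide +kernel) (by decide +kernel)
lemma orderOf_d1 : orderOf d1.real = 3 := orderOf_real (by decide +kernel) (by decide +kernel)
lemma orderOf_s : orderOf s.real = 3 := orderOf_real (by decide +kernel) (by decide +kernel)
lemma orderOf_t : orderOf t.real = 2 := orderOf_real (by decide +kernel) (by decide +kernel)

lemma mult_eps : eps = Complex.exp (2 * Real.pi * Complex.I / (3 : ℕ)) := by rw [eps]; norm_num

lemma mult_t : (-1 : ℂ) = Complex.exp (2 * Real.pi * Complex.I / (2 : ℕ)) := by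
  rw [show 2 * (Real.pi : ℂ) * Complex.I / (2 : ℕ) = Real.pi * Complex.I by push_cast; ring,
    Complex.exp_pi_mul_I]

lemma eps_sub_one_ne : eps - 1 ≠ 0 := fun h => by
  have h1 : eps = 1 := sub_eq_zero.1 h
  have := eps_sum; rw [h1] at this; norm_num at this

lemma d0_fixed {x : E3} (h : d0.real x = x) : x 0 = 0 := by
  rw [d0_apply] at h
  have h1 : eps * x 0 = x 0 := congrArg (fun y : E3 => y 0) h
  exact (mul_eq_zero.1 (show (eps - 1) * x 0 = 0 by linear_combination h1)).resolve_left
    eps_sub_one_ne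

lemma d1_fixed {x : E3} (h : d1.real x = x) : x 1 = 0 := by
  rw [d1_apply] at h
  have h1 : eps * x 1 = x 1 := congrArg (fun y : E3 => y 1) h
  exact (mul_eq_zero.1 (show (eps - 1) * x 1 = 0 by linear_combination h1)).resolve_left
    eps_sub_one_ne

lemma s_fixed {x : E3} (h : s.real x = x) : x 0 + x 1 + x 2 = 0 := by
  have h1 := s_apply x 0
  rw [h] at h1
  exact (mul_eq_zero.1 (show (eps - 1) * (x 0 + x 1 + x 2) = 0 by
    linear_combination -3 * h1)).resolve_left eps_sub_one_ne

lemma t_fixed {x : E3} (h : t.real x = x) : x 2 = x 0 := by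
  rw [t_apply] at h
  exact congrArg (fun y : E3 => y 0) h

end Gen

/-- The vertices of the Hessian polyhedron: the vectors `(0, u, -u')` with `u³ = u'³ = 1`, and their
cyclic permutations. -/
def hessianVerts : List Vec :=
  let U : List Eis := [(1, 0), (0, 1), (-1, -1)]
  U.flatMap fun u => U.flatMap fun u' =>
    [Vec.ofCoords 0 u (-u'), Vec.ofCoords u (-u') 0, Vec.ofCoords (-u') 0 u]

/-- The vertices of two reciprocal Hessian polyhedra. -/
def doubleHessianVerts : List Vec := hessianVerts ++ hessianVerts.map fun v => -v

/-- The vectors `±(1 + 2ε) u` on the coordinate axes, and the vectors `±(u, u', u'')`, where `u`,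
`u'`, `u''` are cube roots of unity. -/
def axisVerts : List Vec :=
  let U : List Eis := [(1, 0), (0, 1), (-1, -1)]
  let A := (U.flatMap fun u => let p := Eis.mul (1, 2) u
    [Vec.ofCoords p 0 0, Vec.ofCoords 0 p 0, Vec.ofCoords 0 0 p]) ++
    U.flatMap fun u => U.flatMap fun u' => U.map fun u'' => Vec.ofCoords u u' u''
  A ++ A.map fun v => -v

/-- The Hessian polyhedron `3{3}3{3}3`. -/
def hessianModel : ModelSystem where
  r₁ := .d1
  r₂ := .s
  r₃ := .d0
  v := .ofCoords 0 (1, 0) (-1, 0)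
  n := .ofCoords (-1, 0) 0 (1, 0)
  V := hessianVerts
  N := hessianVerts
  c := (-1, 0)
  k := (1, 1)
  comm := by decide +kernel
  fixed x h1 h2 h3 := by
    have e0 := Gen.d0_fixed h3
    have e1 := Gen.d1_fixed h1
    have e2 := Gen.s_fixed h2
    rw [e0, e1, zero_add, zero_add] at e2
    ext i; fin_cases i
    exacts [e0, e1, e2]
  r₁_n := by decide +kernel
  r₂_v := by decide +kernel
  r₂_n := by decide +kernel
  r₃_v := by decide +kernel
  r₃_w := by decide +kernel
  ip_n_v := by decide +kernel
  c_ne := by decide +kernel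
  r₁_v_ne := by decide +kernel
  r₃_n_ne := by decide +kernel
  r₁_w := by decide +kernel
  r₂_w := by decide +kernel
  det_ne := by decide +kernel
  mem_V := by decide +kernel
  mem_N := by decide +kernel
  closed_V := by decide +kernel
  closed_N := by decide +kernel
  vert_edge := by decide +kernel
  vert_edge_ip := by decide +kernel
  edge_face := by decide +kernel
  vert_face := by decide +kernel
  face_vert := by decide +kernel
  face_vert_ip := by decide +kernel

/-- The polyhedron `2{4}3{3}3`. -/
def doubleHessianModel : ModelSystem where
  r₁ := .t
  r₂ := .d0
  r₃ := .s
  v := .ofCoords 0 (1, 0) (-1, 0)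
  n := .ofCoords 0 (1, 2) 0
  V := doubleHessianVerts
  N := axisVerts
  c := (-1, -2)
  k := 0
  comm := by decide +kernel
  fixed x h1 h2 h3 := by
    have e0 := Gen.d0_fixed h2
    have e2 := (Gen.t_fixed h1).trans e0
    have e1 := Gen.s_fixed h3
    rw [e0, e2, zero_add, add_zero] at e1
    ext i; fin_cases i
    exacts [e0, e1, e2]
  r₁_n := by decide +kernel
  r₂_v := by decide +kernel
  r₂_n := by decide +kernel
  r₃_v := by decide +kernel
  r₃_w := by decide +kernel
  ip_n_v := by decide +kernel
  c_ne := by decide +kernel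
  r₁_v_ne := by decide +kernel
  r₃_n_ne := by decide +kernel
  r₁_w := by decide +kernel
  r₂_w := by decide +kernel
  det_ne := by decide +kernel
  mem_V := by decide +kernel
  mem_N := by decide +kernel
  closed_V := by decide +kernel
  closed_N := by decide +kernel
  vert_edge := by decide +kernel
  vert_edge_ip := by decide +kernel
  edge_face := by decide +kernel
  vert_face := by decide +kernel
  face_vert := by decide +kernel
  face_vert_ip := by decide +kernel

/-- The polyhedron `3{3}3{4}2`. -/
def axisModel : ModelSystem where
  r₁ := .s
  r₂ := .d0
  r₃ := .t
  v := .ofCoords 0 (1, 2) 0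
  n := .ofCoords 0 (1, 0) (-1, 0)
  V := axisVerts
  N := doubleHessianVerts
  c := (1, 2)
  k := (1, 1)
  comm := by decide +kernel
  fixed x h1 h2 h3 := by
    have e0 := Gen.d0_fixed h2
    have e2 := (Gen.t_fixed h3).trans e0
    have e1 := Gen.s_fixed h1
    rw [e0, e2, zero_add, add_zero] at e1
    ext i; fin_cases i
    exacts [e0, e1, e2]
  r₁_n := by decide +kernel
  r₂_v := by decide +kernel
  r₂_n := by decide +kernel
  r₃_v := by decide +kernel
  r₃_w := by decide +kernel
  ip_n_v := by decide +kernel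
  c_ne := by decide +kernel
  r₁_v_ne := by decide +kernel
  r₃_n_ne := by decide +kernel
  r₁_w := by decide +kernel
  r₂_w := by decide +kernel
  det_ne := by decide +kernel
  mem_V := by decide +kernel
  mem_N := by decide +kernel
  closed_V := by decide +kernel
  closed_N := by decide +kernel
  vert_edge := by decide +kernel
  vert_edge_ip := by decide +kernel
  edge_face := by decide +kernel
  vert_face := by decide +kernel
  face_vert := by decide +kernel
  face_vert_ip := by decide +kernel

lemma isRegularOfType_hessian {t : ℂ} (ht : t ≠ 0) :
    (hessianModel.system t ht).poly.IsHessian :=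
  (hessianModel.system t ht).isRegularOfType Gen.orderOf_d1 Gen.orderOf_s Gen.orderOf_d0
    ((Gen.det_real _).trans Gen.mult_eps) ((Gen.det_real _).trans Gen.mult_eps)
    ((Gen.det_real _).trans Gen.mult_eps)
    (Gen.isBraidLength_real (by norm_num) (by decide +kernel) (by decide +kernel))
    (Gen.isBraidLength_real (by norm_num) (by decide +kernel) (by decide +kernel))

lemma isRegularOfType_doubleHessian {t : ℂ} (ht : t ≠ 0) :
    (doubleHessianModel.system t ht).poly.IsRegularOfType 2 4 3 3 3 :=
  (doubleHessianModel.system t ht).isRegularOfType Gen.orderOf_t Gen.orderOf_d0 Gen.orderOf_s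
    ((Gen.det_real _).trans Gen.mult_t) ((Gen.det_real _).trans Gen.mult_eps)
    ((Gen.det_real _).trans Gen.mult_eps)
    (Gen.isBraidLength_real (by norm_num) (by decide +kernel) (by decide +kernel))
    (Gen.isBraidLength_real (by norm_num) (by decide +kernel) (by decide +kernel))

lemma isRegularOfType_axis {t : ℂ} (ht : t ≠ 0) :
    (axisModel.system t ht).poly.IsRegularOfType 3 3 3 4 2 :=
  (axisModel.system t ht).isRegularOfType Gen.orderOf_s Gen.orderOf_d0 Gen.orderOf_t
    ((Gen.det_real _).trans Gen.mult_eps) ((Gen.det_real _).trans Gen.mult_eps)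
    ((Gen.det_real _).trans Gen.mult_t)
    (Gen.isBraidLength_real (by norm_num) (by decide +kernel) (by decide +kernel))
    (Gen.isBraidLength_real (by norm_num) (by decide +kernel) (by decide +kernel))

/-! ### The group `K` and the symmetry groups of the polyhedra -/

/-- The matrices whose action is that of an element of `Γ`. -/
def realized (Γ : Subgroup (E3 ≃ₗᵢ[ℂ] E3)) : Subgroup (GL (Fin 3) ℂ) where
  carrier := {k | ∃ g ∈ Γ, ∀ x, act k x = g x}
  one_mem' := ⟨1, one_mem _, act_one⟩
  mul_mem' := by
    rintro k l ⟨g, hg, e⟩ ⟨h, hh, e'⟩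
    exact ⟨g * h, mul_mem hg hh, fun x => by rw [act_mul, e', e]; rfl⟩
  inv_mem' := by
    rintro k ⟨g, hg, e⟩
    refine ⟨g⁻¹, inv_mem hg, fun x => g.injective ?_⟩
    rw [← e, ← act_mul, mul_inv_cancel, act_one, ← Function.comp_apply (f := g),
      ← LinearIsometryEquiv.coe_mul, mul_inv_cancel]
    rfl


lemma realized_mono {Γ Δ : Subgroup (E3 ≃ₗᵢ[ℂ] E3)} (h : Γ ≤ Δ) : realized Γ ≤ realized Δ := by
  rintro k ⟨g, hg, e⟩
  exact ⟨g, h hg, e⟩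

namespace Gen

lemma act_d0 (x : E3) : act (gD 1) x = d0.real x := by
  rw [d0_apply]
  ext i
  rw [act_gD]
  fin_cases i <;> simp [w_one, w_zero]

lemma act_d1 (x : E3) : act (mono 1 ![0, 1, 0]) x = d1.real x := by
  rw [d1_apply]
  ext i
  rw [act_mono, sg_one, one_mul, Equiv.Perm.one_apply]
  fin_cases i <;> simp [w_one, w_zero]

lemma act_s (x : E3) : act gS x = s.real x := by
  ext i
  rw [act_gS, s_apply]

lemma act_t (x : E3) : act (mono (Equiv.swap 0 2) 0) x = -t.real x := by
  have h : sg (Equiv.swap 0 2) = -1 := by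
    have : Equiv.Perm.sign (Equiv.swap (0 : Fin 3) 2) = -1 := by decide
    simp [sg, this]
  have h1 : Equiv.swap (0 : Fin 3) 2 1 = 1 := by decide
  rw [t_apply]
  ext i
  rw [act_mono, h]
  fin_cases i <;> simp [w_zero, h1]

lemma prod_eq_neg_prod {l m : List Gen} (h : ∀ v ∈ basis, eval l v = -eval m v) (x : E3) :
    (l.map real).prod x = -(m.map real).prod x := by
  have := ext_basis (f := ((l.map real).prod.toLinearEquiv : E3 →ₗ[ℂ] E3))
    (g := -((m.map real).prod.toLinearEquiv : E3 →ₗ[ℂ] E3)) fun v hv => by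
      change (l.map real).prod v.val = -(m.map real).prod v.val
      rw [prod_val, prod_val, h v hv, Vec.val_neg]
  exact LinearMap.congr_fun this x

end Gen

open Gen

lemma gens_hessian : hessianModel.gens = {d1.real, s.real, d0.real} := rfl

lemma gens_doubleHessian : doubleHessianModel.gens = {t.real, d0.real, s.real} := rfl

/-- Every element of `K` acts as a product of the three reflections of order three. -/
lemma groupK_le_realized : groupK ≤ realized (Subgroup.closure hessianModel.gens) := by
  rw [gens_hessian]
  set Q := realized (Subgroup.closure {d1.real, s.real, d0.real})
  have h0 : gD 1 ∈ Q := ⟨d0.real, Subgroup.subset_closure (by simp), act_d0⟩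
  have h1 : mono 1 ![0, 1, 0] ∈ Q := ⟨d1.real, Subgroup.subset_closure (by simp), act_d1⟩
  have hS : gS ∈ Q := ⟨s.real, Subgroup.subset_closure (by simp), act_s⟩
  have hE : gE ∈ Q := by rw [gE_eq]; exact mul_mem (mul_mem h0 hS) h0
  have hT : mono tr 0 ∈ Q := gE_mul_gE ▸ mul_mem hE hE
  have hU : mono (Equiv.swap 0 2) 0 ∈ Q := by
    have : mono (Equiv.swap 0 2) 0 = mono 1 ![0, 1, 0] * gS * mono 1 ![0, 1, 0] *
        (mono 1 ![0, 1, 0] * gS * mono 1 ![0, 1, 0]) := by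
      refine act_ext fun x => ?_
      simp only [act_mul, act_d1, act_s]
      rw [act_t]
      exact (prod_eq_neg_prod (l := [d1, s, d1, d1, s, d1]) (m := [t]) (by decide +kernel) x).symm
    rw [this]
    exact mul_mem (mul_mem (mul_mem h1 hS) h1) (mul_mem (mul_mem h1 hS) h1)
  have hR : mono rot 0 ∈ Q := by
    have h := mul_mem hU hT
    have h' := mul_mem hT hU
    rw [mono_mul] at h h'
    have : (tr * Equiv.swap 0 2 = rot) ∨ (Equiv.swap 0 2 * tr = rot) := by decide
    rcases this with e | e
    · rw [e] at h; simpa using h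
    · rw [e] at h'; simpa using h'
  have hperm : ∀ σ α, mono σ 0 ∈ Q → mono 1 α ∈ Q → mono 1 (α ∘ σ) ∈ Q := by
    intro σ α hσ hα
    have h := mul_mem (mul_mem hσ hα) (inv_mem hσ)
    have e : mono σ 0 * mono 1 α * (mono σ 0)⁻¹ = mono 1 (α ∘ σ) := by
      rw [mul_inv_eq_iff_eq_mul, mono_mul, mono_mul]; simp
    rwa [e] at h
  have h2 : mono 1 ![0, 0, 1] ∈ Q := by
    have := hperm tr ![0, 1, 0] hT h1
    convert this using 2
    decide
  have hD : mono 1 ![0, 1, 1] ∈ Q := by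
    have := mul_mem h1 h2
    rw [mono_mul] at this
    convert this using 2 <;> decide
  have hC : mono 1 ![0, 1, 2] ∈ Q := by
    have := mul_mem hD h2
    rw [mono_mul] at this
    convert this using 2 <;> decide
  rw [groupK_eq, Subgroup.closure_le]
  rintro g (rfl | rfl | rfl | rfl)
  exacts [hR, hC, hD, hE]

/-- The group generated by maps that act as multiples, by elements of `U`, of elements of `K`. -/
lemma exists_act_of_closure {T : Set (E3 ≃ₗᵢ[ℂ] E3)} (U : Subgroup ℂˣ)
    (h : ∀ g ∈ T, ∃ k ∈ groupK, ∃ u ∈ U, ∀ x, g x = (u : ℂ) • act k x) {g : E3 ≃ₗᵢ[ℂ] E3}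
    (hg : g ∈ Subgroup.closure T) : ∃ k ∈ groupK, ∃ u ∈ U, ∀ x, g x = (u : ℂ) • act k x := by
  induction hg using Subgroup.closure_induction with
  | mem g hg => exact h g hg
  | one => exact ⟨1, one_mem _, 1, one_mem _, fun x => by rw [act_one, Units.val_one, one_smul]; rfl⟩
  | mul g g' _ _ hg hg' =>
    obtain ⟨k, hk, u, hu, e⟩ := hg
    obtain ⟨k', hk', u', hu', e'⟩ := hg'
    refine ⟨k * k', mul_mem hk hk', u * u', mul_mem hu hu', fun x => ?_⟩
    rw [LinearIsometryEquiv.coe_mul, Function.comp_apply, e', e, act_smul, act_mul, smul_smul,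
      Units.val_mul]
  | inv g _ hg =>
    obtain ⟨k, hk, u, hu, e⟩ := hg
    refine ⟨k⁻¹, inv_mem hk, u⁻¹, inv_mem hu, fun x => g.injective ?_⟩
    refine Eq.trans ?_ (e _).symm
    rw [act_smul, smul_smul, Units.mul_inv, one_smul, ← act_mul, mul_inv_cancel, act_one,
      ← Function.comp_apply (f := g), ← LinearIsometryEquiv.coe_mul, mul_inv_cancel]
    rfl

lemma gS_mem : gS ∈ groupK := mul_mem (mul_mem (gD_mem _) gE_mem) (gD_mem _)

lemma neg_one_mem : (-1 : ℂˣ) ∈ rootsOfUnity 2 ℂ := by simp [mem_rootsOfUnity]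

lemma exists_act_hessian {g : E3 ≃ₗᵢ[ℂ] E3} (hg : g ∈ Subgroup.closure hessianModel.gens) :
    ∃ k ∈ groupK, ∀ x, g x = act k x := by
  rw [gens_hessian] at hg
  obtain ⟨k, hk, u, hu, e⟩ := exists_act_of_closure (T := {d1.real, s.real, d0.real}) ⊥ (by
    rintro g (rfl | rfl | rfl)
    · exact ⟨mono 1 ![0, 1, 0], mono_mem _ _, 1, one_mem _, fun x => by
        rw [act_d1, Units.val_one, one_smul]⟩
    · exact ⟨gS, gS_mem, 1, one_mem _, fun x => by rw [act_s, Units.val_one, one_smul]⟩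
    · exact ⟨gD 1, gD_mem 1, 1, one_mem _, fun x => by rw [act_d0, Units.val_one, one_smul]⟩) hg
  rw [Subgroup.mem_bot.1 hu] at e
  exact ⟨k, hk, fun x => by rw [e, Units.val_one, one_smul]⟩

/-- The reciprocal polyhedra `2{4}3{3}3` and `3{3}3{4}2` have the same symmetry group. -/
lemma gens_axis : axisModel.gens = doubleHessianModel.gens := by
  have : axisModel.gens = {s.real, d0.real, t.real} := rfl
  rw [this, gens_doubleHessian]
  ext g
  exact ⟨fun h => h.elim (fun h => .inr (.inr h)) (Or.elim · (fun h => .inr (.inl h)) .inl),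
    fun h => h.elim (fun h => .inr (.inr h)) (Or.elim · (fun h => .inr (.inl h)) .inl)⟩

lemma exists_act_doubleHessian {g : E3 ≃ₗᵢ[ℂ] E3}
    (hg : g ∈ Subgroup.closure doubleHessianModel.gens) :
    ∃ k ∈ groupK, (∀ x, g x = act k x) ∨ ∀ x, g x = -act k x := by
  rw [gens_doubleHessian] at hg
  obtain ⟨k, hk, u, hu, e⟩ := exists_act_of_closure (rootsOfUnity 2 ℂ) (by
    rintro g (rfl | rfl | rfl)
    · exact ⟨mono (Equiv.swap 0 2) 0, mono_mem _ _, -1, neg_one_mem, fun x => by simp [act_t]⟩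
    · exact ⟨gD 1, gD_mem 1, 1, one_mem _, fun x => by rw [act_d0, Units.val_one, one_smul]⟩
    · exact ⟨gS, gS_mem, 1, one_mem _, fun x => by rw [act_s, Units.val_one, one_smul]⟩) hg
  refine ⟨k, hk, ?_⟩
  rw [mem_rootsOfUnity, Units.ext_iff, Units.val_pow_eq_pow_val, Units.val_one, sq_eq_one_iff] at hu
  rcases hu with hu | hu <;> rw [hu] at e
  · exact Or.inl fun x => by rw [e, one_smul]
  · exact Or.inr fun x => by rw [e, neg_one_smul]

lemma closure_hessian_le :
    Subgroup.closure hessianModel.gens ≤ Subgroup.closure doubleHessianModel.gens := by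
  rw [gens_hessian, gens_doubleHessian, Subgroup.closure_le]
  have h0 : d0.real ∈ Subgroup.closure {t.real, d0.real, s.real} :=
    Subgroup.subset_closure (by simp)
  have hs : s.real ∈ Subgroup.closure {t.real, d0.real, s.real} :=
    Subgroup.subset_closure (by simp)
  have ht : t.real ∈ Subgroup.closure {t.real, d0.real, s.real} :=
    Subgroup.subset_closure (by simp)
  have hE : d0.real * s.real * d0.real ∈ Subgroup.closure {t.real, d0.real, s.real} :=
    mul_mem (mul_mem h0 hs) h0
  rintro g (rfl | rfl | rfl)
  · have : d1.real = (d0.real * s.real * d0.real) ^ 2 * (t.real * d0.real * t.real) *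
        (d0.real * s.real * d0.real) ^ 2 := by
      simpa [pow_two, mul_assoc] using
        (prod_eq_prod_iff [d1] [d0, s, d0, d0, s, d0, t, d0, t, d0, s, d0, d0, s, d0]).2
          (by decide +kernel)
    rw [this]
    exact mul_mem (mul_mem (pow_mem hE 2) (mul_mem (mul_mem ht h0) ht)) (pow_mem hE 2)
  · exact hs
  · exact h0

lemma groupK_le_realized_doubleHessian :
    groupK ≤ realized (Subgroup.closure doubleHessianModel.gens) :=
  groupK_le_realized.trans (realized_mono closure_hessian_le)

/-- A set of solutions is the orbit of each of its points under the symmetry group of the Hessian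
polyhedron. -/
lemma signedSolutions_eq_hessian {a b c d : ℂ} {x : E3} (hx : x ∈ signedSolutions a b c d) :
    signedSolutions a b c d = {y | ∃ g ∈ Subgroup.closure hessianModel.gens, y = g x} := by
  rw [signedSolutions_eq_orbitK hx]
  ext y
  constructor
  · rintro ⟨k, hk, rfl⟩
    obtain ⟨g, hg, e⟩ := groupK_le_realized hk
    exact ⟨g, hg, e x⟩
  · rintro ⟨g, hg, rfl⟩
    obtain ⟨k, hk, e⟩ := exists_act_hessian hg
    exact ⟨k, hk, e x⟩

/-- When `I₉` vanishes, the set of solutions is also the orbit of each of its points under the larger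
symmetry group. -/
lemma signedSolutions_eq_doubleHessian {a b c : ℂ} {x : E3} (hx : x ∈ signedSolutions a b c 0) :
    signedSolutions a b c 0 = {y | ∃ g ∈ Subgroup.closure doubleHessianModel.gens, y = g x} := by
  have hneg : ∀ y ∈ signedSolutions a b c 0, -y ∈ signedSolutions a b c 0 := fun y hy =>
    ⟨neg_mem_solutions hy.1, by rw [C9_neg, hy.2, neg_zero]⟩
  ext y
  constructor
  · intro hy
    rw [signedSolutions_eq_orbitK hx] at hy
    obtain ⟨k, hk, rfl⟩ := hy
    obtain ⟨g, hg, e⟩ := groupK_le_realized_doubleHessian hk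
    exact ⟨g, hg, e x⟩
  · rintro ⟨g, hg, rfl⟩
    obtain ⟨k, hk, e⟩ := exists_act_doubleHessian hg
    have hk' : act k x ∈ signedSolutions a b c 0 := by
      rw [signedSolutions_eq_orbitK hx]; exact ⟨k, hk, rfl⟩
    rcases e with e | e
    · rw [e]; exact hk'
    · rw [e]; exact hneg _ hk'

/-! ### Sets of solutions as vertices and centres of edges -/

lemma verts_system (M : ModelSystem) {t : ℂ} (ht : t ≠ 0) : (M.system t ht).poly.verts =
    {v | ∃ g ∈ Subgroup.closure M.gens, v = g (M.baseV t)} := (M.system t ht).verts_poly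

lemma edgeCenters_system (M : ModelSystem) {t : ℂ} (ht : t ≠ 0) {S : Finset E3} {z : E3}
    (hS : (S : Set E3) = Set.range fun k : ℕ => (M.r₁.real ^ k) (M.baseV t))
    (hz : (S.card : ℂ)⁻¹ • ∑ v ∈ S, v = z) : (M.system t ht).poly.edgeCenters =
    {x | ∃ g ∈ Subgroup.closure M.gens, x = g z} := by
  have h : (M.system t ht).poly.edgeCenter ((M.system t ht).edge 1) = z := by
    have h1 : (M.system t ht).poly.vertsOn ((M.system t ht).edge 1) = S := by
      rw [(M.system t ht).vertsOn_edge (one_mem _), hS]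
      exact Set.image_id _
    rw [ComplexPolyhedron.edgeCenter, h1, Set.ncard_coe_finset, finsum_mem_coe_finset, hz]
  rw [(M.system t ht).edgeCenters_poly, h]
  rfl

lemma range_pow_three {g : E3 ≃ₗᵢ[ℂ] E3} (hg : g ^ 3 = 1) (x : E3) :
    (Set.range fun k : ℕ => (g ^ k) x) = {x, g x, g (g x)} := by
  ext y
  constructor
  · rintro ⟨k, rfl⟩
    have h : g ^ k = g ^ (k % 3) := by
      conv_lhs => rw [← Nat.div_add_mod k 3, pow_add, pow_mul, hg, one_pow, one_mul]
    have h3 : k % 3 < 3 := Nat.mod_lt _ (by norm_num)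
    simp only [h]
    interval_cases k % 3
    exacts [.inl rfl, .inr (.inl rfl), .inr (.inr rfl)]
  · rintro (rfl | rfl | rfl)
    exacts [⟨0, rfl⟩, ⟨1, rfl⟩, ⟨2, rfl⟩]

lemma range_pow_two {g : E3 ≃ₗᵢ[ℂ] E3} (hg : g ^ 2 = 1) (x : E3) :
    (Set.range fun k : ℕ => (g ^ k) x) = {x, g x} := by
  ext y
  constructor
  · rintro ⟨k, rfl⟩
    have h : g ^ k = g ^ (k % 2) := by
      conv_lhs => rw [← Nat.div_add_mod k 2, pow_add, pow_mul, hg, one_pow, one_mul]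
    have h3 : k % 2 < 2 := Nat.mod_lt _ (by norm_num)
    simp only [h]
    interval_cases k % 2
    exacts [.inl rfl, .inr rfl]
  · rintro (rfl | rfl)
    exacts [⟨0, rfl⟩, ⟨1, rfl⟩]

lemma baseV_hessian (t : ℂ) : hessianModel.baseV t = !₂[0, t, -t] := by
  have h : hessianModel.v = (0, (1, 0), (0, 0)) := by decide +kernel
  rw [ModelSystem.baseV, h]
  ext i; fin_cases i
  · simp [Vec.val_zero', Eis.val]
  · simp [Vec.val_one', Eis.val]
  · simp [Vec.val_two', Eis.val]

lemma baseV_doubleHessian (t : ℂ) : doubleHessianModel.baseV t = !₂[0, t, -t] := baseV_hessian t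

lemma baseV_axis (t : ℂ) : axisModel.baseV t = !₂[0, t * (1 + 2 * eps), 0] := by
  have h : axisModel.v = (0, (1, 2), (1, 0)) := by decide +kernel
  rw [ModelSystem.baseV, h]
  ext i; fin_cases i
  · simp [Vec.val_zero', Eis.val]
  · simp [Vec.val_one', Eis.val]
  · simp [Vec.val_two', Eis.val]

lemma act_mem_signedSolutions {a b c d : ℂ} {x : E3} (hx : x ∈ signedSolutions a b c d)
    {k : GL (Fin 3) ℂ} (hk : k ∈ groupK) : act k x ∈ signedSolutions a b c d := by
  rw [signedSolutions_eq_orbitK hx]; exact ⟨k, hk, rfl⟩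

/-- For `b = c = 0`, the solutions are the vertices of a Hessian polyhedron. -/
lemma exists_hessian_verts {a b c d : ℂ} (hd : 432 * d ^ 2 = a ^ 3 - 3 * a * b + 2 * c)
    (hb : b = 0) (hc : c = 0) (ha : a ≠ 0) :
    ∃ H : ComplexPolyhedron, H.IsHessian ∧ signedSolutions a b c d = H.verts := by
  obtain ⟨x, hx⟩ := signedSolutions_nonempty hd
  obtain ⟨k, hk, h0, h2, h1⟩ := exists_mem_line hb hc hx.1
  have ht : act k x 1 ≠ 0 := fun h => ha (by rw [← h1, h]; norm_num)
  refine ⟨_, isRegularOfType_hessian ht, ?_⟩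
  have hy := act_mem_signedSolutions hx hk
  have e : (!₂[0, act k x 1, -act k x 1] : E3) = act k x := by
    ext i; fin_cases i
    exacts [h0.symm, rfl, h2.symm]
  rw [verts_system, signedSolutions_eq_hessian hy, baseV_hessian, e]

lemma eps_ne_one : eps ≠ 1 := fun h => Gen.eps_sub_one_ne (by rw [h, sub_self])

/-- For `b = a²` and `c = a³`, the solutions are the centres of the edges of a Hessian polyhedron. -/
lemma exists_hessian_edgeCenters {a b c d : ℂ} (hd : 432 * d ^ 2 = a ^ 3 - 3 * a * b + 2 * c)
    (hb : b = a ^ 2) (hc : c = a ^ 3) (ha : a ≠ 0) :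
    ∃ H : ComplexPolyhedron, H.IsHessian ∧ signedSolutions a b c d = H.edgeCenters := by
  obtain ⟨x, hx⟩ := signedSolutions_nonempty hd
  obtain ⟨k, hk, h0, h1, h2⟩ := exists_mem_axis hb hc ha hx.1
  set t := -act k x 1 with ht
  have ht0 : t ≠ 0 := neg_ne_zero.2 h1
  refine ⟨_, isRegularOfType_hessian ht0, ?_⟩
  have hy := act_mem_signedSolutions (act_mem_signedSolutions hx hk) (mono_mem rot⁻¹ 0)
  rw [signedSolutions_eq_hessian hy]
  classical
  have hr0 : rot⁻¹ 0 = 2 := by decide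
  have hr1 : rot⁻¹ 1 = 0 := by decide
  have hr2 : rot⁻¹ 2 = 1 := by decide
  have hsg : sg rot⁻¹ = 1 := by
    have : Equiv.Perm.sign rot⁻¹ = 1 := by decide
    simp [sg, this]
  have e : act (mono rot⁻¹ 0) (act k x) = !₂[0, 0, -t] := by
    ext i
    rw [act_mono, hsg, Pi.zero_apply, w_zero, one_mul, one_mul]
    fin_cases i
    exacts [(congrArg _ hr0).trans h2, (congrArg _ hr1).trans h0,
      (congrArg _ hr2).trans (neg_neg _).symm]
  have hp : ∀ u : ℂ, Gen.d1.real !₂[0, u, -t] = !₂[0, eps * u, -t] := fun u => by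
    rw [Gen.d1_apply]; rfl
  have hne : ∀ u v : ℂ, u ≠ v → (!₂[0, u, -t] : E3) ≠ !₂[0, v, -t] := fun u v h h' =>
    h (congrArg (fun y : E3 => y 1) h')
  have e1 : t ≠ eps * t := fun h => eps_ne_one (mul_right_cancel₀ ht0 (by rw [one_mul, ← h]))
  have e2 : t ≠ eps * (eps * t) := fun h => eps_ne_one (by
    have : eps ^ 2 = 1 := mul_right_cancel₀ ht0 (by rw [one_mul, pow_two, mul_assoc, ← h])
    have h3 := eps_cube
    rw [pow_succ, this, one_mul] at h3
    exact h3)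
  have e3 : eps * t ≠ eps * (eps * t) := fun h => e1 (mul_left_cancel₀ (eps_prim.ne_zero
    (by norm_num)) h)
  refine (edgeCenters_system hessianModel ht0
    (S := {!₂[0, t, -t], !₂[0, eps * t, -t], !₂[0, eps * (eps * t), -t]}) ?_ ?_).symm
  · have h3 : Gen.d1.real ^ 3 = 1 := orderOf_dvd_iff_pow_eq_one.1 Gen.orderOf_d1.dvd
    rw [baseV_hessian]
    refine Eq.trans ?_ (range_pow_three h3 _).symm
    rw [hp, hp]
    simp
  · have n1 := hne _ _ e1
    have n2 := hne _ _ e2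
    have n3 := hne _ _ e3
    rw [Finset.card_insert_of_notMem (by simp [n1, n2]), Finset.card_pair n3,
      Finset.sum_insert (by simp [n1, n2]), Finset.sum_pair n3]
    have h := eps_sum
    rw [e]
    ext i
    fin_cases i
    · simp
    · simp
      linear_combination t * h / 3
    · simp
      ring

/-- For `b = a²` and `c = a³`, the solutions are the vertices of a polyhedron of type `3{3}3{4}2`. -/
lemma exists_axis_verts {a b c d : ℂ} (hd : 432 * d ^ 2 = a ^ 3 - 3 * a * b + 2 * c)
    (hb : b = a ^ 2) (hc : c = a ^ 3) (ha : a ≠ 0) :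
    ∃ P : ComplexPolyhedron, P.IsRegularOfType 3 3 3 4 2 ∧ signedSolutions a b c d = P.verts := by
  have hd0 : d = 0 := by
    refine pow_eq_zero_iff (n := 2) (by norm_num) |>.1 ?_
    rw [hb, hc] at hd
    linear_combination hd / 432
  subst hd0
  obtain ⟨x, hx⟩ := signedSolutions_nonempty hd
  obtain ⟨k, hk, h0, h1, h2⟩ := exists_mem_axis hb hc ha hx.1
  have hθ := theta_ne_zero
  have ht : act k x 1 / (1 + 2 * eps) ≠ 0 := div_ne_zero h1 hθ
  refine ⟨_, isRegularOfType_axis ht, ?_⟩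
  have hy := act_mem_signedSolutions hx hk
  have e : (!₂[0, act k x 1, 0] : E3) = act k x := by
    ext i; fin_cases i
    exacts [h0.symm, rfl, h2.symm]
  rw [verts_system, signedSolutions_eq_doubleHessian hy, baseV_axis, gens_axis,
    div_mul_cancel₀ _ hθ, e]

/-- For `b = a² / 4` and `c = -a³ / 8`, the solutions are the centres of the edges of a polyhedron of
type `2{4}3{3}3`. -/
lemma exists_doubleHessian_edgeCenters {a b c d : ℂ}
    (hd : 432 * d ^ 2 = a ^ 3 - 3 * a * b + 2 * c) (hb : b = a ^ 2 / 4) (hc : c = -a ^ 3 / 8)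
    (ha : a ≠ 0) : ∃ (t : ℂ) (ht : t ≠ 0),
      signedSolutions a b c d = (doubleHessianModel.system t ht).poly.edgeCenters := by
  have hd0 : d = 0 := by
    refine pow_eq_zero_iff (n := 2) (by norm_num) |>.1 ?_
    rw [hb, hc] at hd
    linear_combination hd / 432
  subst hd0
  -- the centre of the base edge is `(-t/2, t, -t/2)`, with `ψ² - 12 χ = 27 t⁶ / 8`
  obtain ⟨t, ht⟩ := IsAlgClosed.exists_pow_nat_eq (8 * a / 27) (n := 6) (by norm_num)
  have ht0 : t ≠ 0 := fun h => ha (by rw [h] at ht; linear_combination -27 / 8 * ht)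
  refine ⟨t, ht0, ?_⟩
  have hx : (!₂[-t / 2, t, -t / 2] : E3) ∈ signedSolutions a b c 0 := by
    have hat : a = 27 / 8 * t ^ 6 := by rw [ht]; ring
    refine ⟨mem_solutions.2 ⟨?_, ?_, ?_⟩, ?_⟩
    · simp [C6, psi, chi, hat]; ring
    · simp [C12, psi, lam, hb, hat]; ring
    · simp [C18, psi, lam, hc, hat]; ring
    · simp [C9]
  rw [signedSolutions_eq_doubleHessian hx]
  classical
  have hp : Gen.t.real !₂[0, t, -t] = !₂[-t, t, 0] := by rw [Gen.t_apply]; rfl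
  have hne : (!₂[0, t, -t] : E3) ≠ !₂[-t, t, 0] := fun h => by
    have : (0 : ℂ) = -t := congrArg (fun y : E3 => y 0) h
    exact ht0 (by linear_combination this)
  refine (edgeCenters_system doubleHessianModel ht0 (S := {!₂[0, t, -t], !₂[-t, t, 0]}) ?_ ?_).symm
  · have h2 : Gen.t.real ^ 2 = 1 := orderOf_dvd_iff_pow_eq_one.1 Gen.orderOf_t.dvd
    rw [baseV_doubleHessian]
    refine Eq.trans ?_ (range_pow_two h2 _).symm
    rw [hp]
    simp
  · rw [Finset.card_pair hne, Finset.sum_pair hne]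
    ext i
    fin_cases i <;> simp <;> ring

open ComplexPolyhedron (mapFlat)

/-! ### Two reciprocal Hessian polyhedra -/

/-- The polar of a flat with respect to the sphere with centre `0` and squared radius `r`. -/
def polar (r : ℝ) (F : Flat) : Set E3 := {y | ∀ x ∈ F, inner ℂ x y = (r : ℂ)}

lemma polar_mapFlat (r : ℝ) (g : E3 ≃ₗᵢ[ℂ] E3) {F F' : Flat} (h : (F' : Set E3) = polar r F) :
    (mapFlat (aff g) F' : Set E3) = polar r (mapFlat (aff g) F) := by
  ext y
  obtain ⟨y, rfl⟩ := g.surjective y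
  have h1 : g y ∈ mapFlat (aff g) F' ↔ y ∈ F' := apply_mem_mapFlat (g := aff g)
  have h2 : y ∈ F' ↔ y ∈ polar r F := by rw [← h]; rfl
  rw [SetLike.mem_coe, h1, h2]
  constructor
  · rintro H _ ⟨x, hx, rfl⟩
    exact (g.inner_map_map x y).trans (H x hx)
  · intro H x hx
    rw [← g.inner_map_map]
    exact H _ ⟨x, hx, rfl⟩

/-- Two regular systems with the same symmetry group are reciprocal when the polars of the elements of
the base flag of one of them are elements of the other. -/
lemma isReciprocal_of_base {D D' : RegularSystem} (hG : D.G = D'.G) {r : ℝ} (hr : 0 < r)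
    {g₁ g₂ g₃ : E3 ≃ₗᵢ[ℂ] E3} (h₁ : g₁ ∈ D.G) (h₂ : g₂ ∈ D.G) (h₃ : g₃ ∈ D.G)
    (e₁ : (D'.face g₁ : Set E3) = polar r (D.vert 1))
    (e₂ : (D'.edge g₂ : Set E3) = polar r (D.edge 1))
    (e₃ : (D'.vert g₃ : Set E3) = polar r (D.face 1)) : D.poly.IsReciprocal D'.poly := by
  have e₁' : ∀ g, (D'.face (g * g₁) : Set E3) = polar r (D.vert g) := fun g => by
    have := polar_mapFlat r g e₁
    rwa [D.map_vert, D'.map_face, mul_one] at this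
  have e₂' : ∀ g, (D'.edge (g * g₂) : Set E3) = polar r (D.edge g) := fun g => by
    have := polar_mapFlat r g e₂
    rwa [D.map_edge, D'.map_edge, mul_one] at this
  have e₃' : ∀ g, (D'.vert (g * g₃) : Set E3) = polar r (D.face g) := fun g => by
    have := polar_mapFlat r g e₃
    rwa [D.map_face, D'.map_vert, mul_one] at this
  have hbot : ((⊤ : Flat) : Set E3) = polar r ⊥ := by
    ext y
    exact ⟨fun _ x hx => absurd hx (AffineSubspace.notMem_bot _ _ x), fun _ => trivial⟩
  have htop : ((⊥ : Flat) : Set E3) = polar r ⊤ := by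
    ext y
    refine ⟨fun hy => absurd hy (AffineSubspace.notMem_bot _ _ y), fun hy => ?_⟩
    have := hy 0 trivial
    rw [inner_zero_left] at this
    exact absurd (Complex.ofReal_eq_zero.1 this.symm) hr.ne'
  refine ⟨0, r, hr, fun F => ?_⟩
  simp only [sub_zero]
  change F ∈ D'.flats ↔ ∃ F' ∈ D.flats, (F : Set E3) = polar r F'
  constructor
  · rintro (rfl | rfl | ⟨g, hg, rfl⟩ | ⟨g, hg, rfl⟩ | ⟨g, hg, rfl⟩)
    · exact ⟨⊤, .inr (.inl rfl), htop⟩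
    · exact ⟨⊥, .inl rfl, hbot⟩
    · rw [← hG] at hg
      refine ⟨_, D.face_mem (mul_mem hg (inv_mem h₃)), ?_⟩
      rw [← e₃', inv_mul_cancel_right]
    · rw [← hG] at hg
      refine ⟨_, D.edge_mem (mul_mem hg (inv_mem h₂)), ?_⟩
      rw [← e₂', inv_mul_cancel_right]
    · rw [← hG] at hg
      refine ⟨_, D.vert_mem (mul_mem hg (inv_mem h₁)), ?_⟩
      rw [← e₁', inv_mul_cancel_right]
  · rintro ⟨F', hF', e⟩
    rcases hF' with rfl | rfl | ⟨g, hg, rfl⟩ | ⟨g, hg, rfl⟩ | ⟨g, hg, rfl⟩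
    · exact .inr (.inl (SetLike.coe_injective (e.trans hbot.symm)))
    · exact .inl (SetLike.coe_injective (e.trans htop.symm))
    · rw [SetLike.coe_injective (e.trans (e₁' g).symm)]
      exact D'.face_mem (hG ▸ mul_mem hg h₁)
    · rw [SetLike.coe_injective (e.trans (e₂' g).symm)]
      exact D'.edge_mem (hG ▸ mul_mem hg h₂)
    · rw [SetLike.coe_injective (e.trans (e₃' g).symm)]
      exact D'.vert_mem (hG ▸ mul_mem hg h₃)

lemma ext_E3 {x y : E3} (h0 : x 0 = y 0) (h1 : x 1 = y 1) (h2 : x 2 = y 2) : x = y := by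
  ext i; fin_cases i
  exacts [h0, h1, h2]

lemma baseN_hessian (t : ℂ) : hessianModel.baseN t = ((starRingEnd ℂ) t)⁻¹ • !₂[1, 0, -1] := by
  have h : hessianModel.n = ((-1, 0), 0, (0, 0)) := by decide +kernel
  have hc : hessianModel.c.val = -1 := by
    have : hessianModel.c = (-1, 0) := rfl
    rw [this]; simp [Eis.val]
  rw [ModelSystem.baseN, h, hc]
  apply ext_E3
  · simp [Vec.val_zero', Eis.val]
  · simp [Vec.val_one', Eis.val]
  · simp [Vec.val_two', Eis.val]

/-- The Hessian polyhedra obtained from opposite scaling factors are reciprocal. -/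
lemma isReciprocal_hessian {t : ℂ} (ht : t ≠ 0) (ht' : -t ≠ 0) :
    (hessianModel.system t ht).poly.IsReciprocal (hessianModel.system (-t) ht').poly := by
  have hct : (starRingEnd ℂ) t ≠ 0 := (_root_.map_ne_zero _).2 ht
  obtain ⟨h, hh, eh⟩ := groupK_le_realized (mono_mem rot 0)
  obtain ⟨k, hk, ek⟩ := groupK_le_realized (mono_mem (Equiv.swap 0 1) 0)
  have hr : ((‖t‖ ^ 2 : ℝ) : ℂ) = (starRingEnd ℂ) t * t := by
    rw [Complex.conj_mul']; push_cast; rfl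
  have hh' : ∀ x, h x = !₂[x 1, x 2, x 0] := fun x => by
    rw [← eh]
    apply ext_E3 <;> rw [act_mono, sg_rot, Pi.zero_apply, w_zero, one_mul, one_mul] <;> rfl
  have hs : sg (Equiv.swap 0 1) = -1 := by
    have : Equiv.Perm.sign (Equiv.swap (0 : Fin 3) 1) = -1 := by decide
    simp [sg, this]
  have hk' : ∀ x, k x = !₂[-x 1, -x 0, -x 2] := fun x => by
    rw [← ek]
    apply ext_E3 <;> rw [act_mono, hs, Pi.zero_apply, w_zero, mul_one, neg_one_mul] <;> rfl
  have hv : (hessianModel.system t ht).v₀ = !₂[0, t, -t] := baseV_hessian t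
  have hv' : (hessianModel.system (-t) ht').v₀ = !₂[0, -t, - -t] := baseV_hessian (-t)
  have hn : (hessianModel.system t ht).n₀ = ((starRingEnd ℂ) t)⁻¹ • !₂[1, 0, -1] := baseN_hessian t
  have hn' : (hessianModel.system (-t) ht').n₀ = ((starRingEnd ℂ) (-t))⁻¹ • !₂[1, 0, -1] :=
    baseN_hessian (-t)
  have hw : (hessianModel.system t ht).R₁ !₂[0, t, -t] = !₂[0, eps * t, -t] :=
    Gen.d1_apply _
  have hw' : (hessianModel.system (-t) ht').R₁ !₂[0, -t, - -t] =
      !₂[0, eps * -t, - -t] := Gen.d1_apply _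
  have hE := Gen.eps_sub_one_ne
  refine isReciprocal_of_base rfl (r := ‖t‖ ^ 2) (pow_pos (norm_pos_iff.2 ht) 2) hh hk hk ?_ ?_ ?_
  · ext y
    simp only [RegularSystem.face, RegularSystem.vert, polar, SetLike.mem_coe, mem_polarPlane,
      hn', hv, hh', Set.mem_ofPred_eq, mem_ptFlat, forall_eq, inner_E3,
      LinearIsometryEquiv.coe_one, id_eq, hr]
    simp
    field_simp
  · ext y
    simp only [RegularSystem.edge, hw', hv', hv, hw, hk', LinearIsometryEquiv.coe_one, id_eq]
    constructor
    · intro hy x hx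
      obtain ⟨c, hc⟩ := eq_add_smul_of_mem_line hy
      obtain ⟨d, hd⟩ := eq_add_smul_of_mem_line hx
      have y1 : y 1 - 0 = c * (0 - 0) := by simpa using congrArg (fun z : E3 => z 1) hc
      have y2 : y 2 + t = c * (-t + t) := by simpa using congrArg (fun z : E3 => z 2) hc
      have x0 : x 0 - 0 = d * (0 - 0) := by simpa using congrArg (fun z : E3 => z 0) hd
      have x2 : x 2 + t = d * (-t + t) := by simpa using congrArg (fun z : E3 => z 2) hd
      rw [inner_E3, hr, show x 0 = 0 by linear_combination x0, show y 1 = 0 by linear_combination y1,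
        show y 2 = -t by linear_combination y2, show x 2 = -t by linear_combination x2]
      simp
    · intro hy
      have h1 := hy _ (left_mem_affineSpan_pair ℂ _ _)
      have h2 := hy _ (right_mem_affineSpan_pair ℂ _ _)
      rw [inner_E3, hr] at h1 h2
      simp at h1 h2
      have h3 : y 1 - y 2 = t := mul_left_cancel₀ hct (by linear_combination h1)
      have h4 : ((starRingEnd ℂ) eps - 1) * y 1 = 0 :=
        mul_left_cancel₀ hct (by linear_combination h2 - h1)
      have h5 : (starRingEnd ℂ) eps - 1 ≠ 0 := fun h => hE (by
        have := congrArg (starRingEnd ℂ) h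
        simpa using this)
      have h6 : y 1 = 0 := (mul_eq_zero.1 h4).resolve_left h5
      refine mem_line_of_eq (k := (y 0 - t) / ((eps - 1) * t)) (ext_E3 ?_ ?_ ?_)
      · simp; field_simp
      · simp [h6]
      · simp; linear_combination h6 - h3
  · ext y
    simp only [RegularSystem.face, RegularSystem.vert, SetLike.mem_coe,
      hv', mem_ptFlat, hk', LinearIsometryEquiv.coe_one, id_eq, hn]
    have hmem : ∀ x : E3, x ∈ polarPlane (((starRingEnd ℂ) t)⁻¹ • (!₂[1, 0, -1] : E3)) ↔
        x 0 - x 2 = t := fun x => by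
      rw [mem_polarPlane, inner_smul_left, inner_E3]
      simp
      field_simp
      rw [← sub_eq_add_neg]
    constructor
    · rintro rfl x hx
      rw [hmem] at hx
      rw [inner_E3, hr, ← hx]
      simp
      ring
    · intro hy
      have h1 := hy !₂[t, 0, 0] ((hmem _).2 (by simp))
      have h2 := hy !₂[t, 1, 0] ((hmem _).2 (by simp))
      have h3 := hy !₂[0, 0, -t] ((hmem _).2 (by simp))
      rw [inner_E3, hr] at h1 h2 h3
      simp at h1 h2 h3
      have h1' := h1.resolve_right ht
      refine ext_E3 ?_ ?_ ?_
      · simp [h1']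
      · simp
        linear_combination h2 - (starRingEnd ℂ) t * h1'
      · simp
        exact mul_left_cancel₀ hct (by linear_combination -h3)

open ComplexPolyhedron (mapFlat)

/-! ### The polyhedron spanned by two reciprocal Hessian polyhedra -/

lemma act_mem_orbitK {k : GL (Fin 3) ℂ} (hk : k ∈ groupK) {x y : E3} (hy : y ∈ orbitK x) :
    act k y ∈ orbitK x := by
  obtain ⟨l, hl, rfl⟩ := hy
  exact ⟨k * l, mul_mem hk hl, (act_mul k l x).symm⟩

lemma neg_mem_orbitK {x y : E3} (hy : y ∈ orbitK x) : -y ∈ orbitK (-x) := by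
  obtain ⟨k, hk, rfl⟩ := hy
  exact ⟨k, hk, (act_neg k x).symm⟩

lemma self_mem_orbitK (x : E3) : x ∈ orbitK x := ⟨1, one_mem _, (act_one x).symm⟩

lemma orbitK_eq_of_mem {x y : E3} (h : y ∈ orbitK x) : orbitK y = orbitK x := by
  obtain ⟨k, hk, rfl⟩ := h
  ext z
  constructor
  · rintro ⟨l, hl, rfl⟩
    exact act_mem_orbitK hl ⟨k, hk, rfl⟩
  · rintro ⟨l, hl, rfl⟩
    exact ⟨l * k⁻¹, mul_mem hl (inv_mem hk), by rw [act_mul, act_inv_act]⟩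

lemma verts_hessian {t : ℂ} (ht : t ≠ 0) :
    (hessianModel.system t ht).poly.verts = orbitK !₂[0, t, -t] := by
  rw [verts_system, baseV_hessian]
  ext v
  constructor
  · rintro ⟨g, hg, rfl⟩
    obtain ⟨k, hk, e⟩ := exists_act_hessian hg
    exact ⟨k, hk, e _⟩
  · rintro ⟨k, hk, rfl⟩
    obtain ⟨g, hg, e⟩ := groupK_le_realized hk
    exact ⟨g, hg, e _⟩

lemma neg_vec (t : ℂ) : (!₂[0, -t, - -t] : E3) = -!₂[0, t, -t] := by
  apply ext_E3 <;> simp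

lemma mem_orbitK_swap (t : ℂ) : !₂[-t, t, 0] ∈ orbitK (-!₂[0, t, -t]) := by
  refine ⟨mono rot 0, mono_mem _ _, ?_⟩
  rw [← neg_vec]
  apply ext_E3 <;> rw [act_mono, sg_rot, Pi.zero_apply, w_zero, one_mul, one_mul]
  · rfl
  · exact (neg_neg t).symm
  · rfl

lemma t_real_apply (t : ℂ) : Gen.t.real !₂[0, t, -t] = !₂[-t, t, 0] := by
  rw [Gen.t_apply]; rfl

lemma t_real_mem : Gen.t.real ∈ Subgroup.closure doubleHessianModel.gens := by
  rw [gens_doubleHessian]; exact Subgroup.subset_closure (by simp)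

lemma verts_doubleHessian {t : ℂ} (ht : t ≠ 0) : (doubleHessianModel.system t ht).poly.verts =
    orbitK !₂[0, t, -t] ∪ orbitK (-!₂[0, t, -t]) := by
  rw [verts_system, baseV_doubleHessian]
  ext v
  constructor
  · rintro ⟨g, hg, rfl⟩
    obtain ⟨k, hk, e | e⟩ := exists_act_doubleHessian hg
    · exact .inl ⟨k, hk, e _⟩
    · exact .inr ⟨k, hk, by rw [e, act_neg]⟩
  · rintro (⟨k, hk, rfl⟩ | h)
    · obtain ⟨g, hg, e⟩ := groupK_le_realized_doubleHessian hk
      exact ⟨g, hg, e _⟩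
    · rw [← orbitK_eq_of_mem (mem_orbitK_swap t)] at h
      obtain ⟨k, hk, rfl⟩ := h
      obtain ⟨g, hg, e⟩ := groupK_le_realized_doubleHessian hk
      exact ⟨g * Gen.t.real, mul_mem hg t_real_mem, by
        rw [e, LinearIsometryEquiv.coe_mul, Function.comp_apply, t_real_apply]⟩

lemma exists_hessian_vec {t : ℂ} (ht : t ≠ 0) {v : E3} (hv : v ∈ orbitK !₂[0, t, -t]) :
    ∃ u ∈ hessianVerts, v = t • u.val := by
  rw [← verts_hessian ht, verts_system] at hv
  obtain ⟨g, hg, rfl⟩ := hv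
  exact hessianModel.exists_vec_v t hg

/-- The vertices of the second Hessian polyhedron, up to scaling. -/
def negHessianVerts : List Vec := hessianVerts.map fun v => -v

lemma exists_negHessian_vec {t : ℂ} (ht : t ≠ 0) {v : E3} (hv : v ∈ orbitK (-!₂[0, t, -t])) :
    ∃ u ∈ negHessianVerts, v = t • u.val := by
  have h := neg_mem_orbitK hv
  rw [neg_neg] at h
  obtain ⟨u, hu, e⟩ := exists_hessian_vec ht h
  exact ⟨-u, List.mem_map_of_mem hu, by rw [Vec.val_neg, smul_neg, ← e, neg_neg]⟩

lemma smul_val_injective {t : ℂ} (ht : t ≠ 0) : Function.Injective fun u : Vec => t • u.val :=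
  fun _ _ h => Vec.val_injective (smul_right_injective _ ht h)

lemma disjoint_orbitK {t : ℂ} (ht : t ≠ 0) :
    Disjoint (orbitK !₂[0, t, -t]) (orbitK (-!₂[0, t, -t])) := by
  refine Set.disjoint_left.2 fun v h h' => ?_
  obtain ⟨u, hu, e⟩ := exists_hessian_vec ht h
  obtain ⟨u', hu', e'⟩ := exists_negHessian_vec ht h'
  have key : ∀ u ∈ hessianVerts, u ∉ negHessianVerts := by decide +kernel
  rw [smul_val_injective ht (e.symm.trans e')] at hu
  exact key _ hu hu'

/-- The point `v` is joined by edges of `P` to exactly eight points of `B`, and no point of `B` is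
closer to it than these. -/
def JoinAt (P : ComplexPolyhedron) (B : Set E3) (v : E3) : Prop :=
  {w | w ∈ B ∧ line[ℂ, v, w] ∈ P.edges}.ncard = 8 ∧
    ∀ w ∈ B, line[ℂ, v, w] ∈ P.edges → ∀ w' ∈ B, dist v w ≤ dist v w'

lemma RegularSystem.line_mem_edges_iff (D : RegularSystem) {g : E3 ≃ₗᵢ[ℂ] E3} (hg : g ∈ D.G)
    (v w : E3) : line[ℂ, g v, g w] ∈ D.poly.edges ↔ line[ℂ, v, w] ∈ D.poly.edges := by
  have key : ∀ g ∈ D.G, ∀ v w, line[ℂ, v, w] ∈ D.poly.edges → line[ℂ, g v, g w] ∈ D.poly.edges := by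
    intro g hg v w h
    rw [D.edges_poly] at *
    obtain ⟨k, hk, e⟩ := h
    refine ⟨g * k, mul_mem hg hk, ?_⟩
    rw [← D.map_edge, ← e, mapFlat_line]; rfl
  refine ⟨fun h => ?_, key g hg v w⟩
  have h1 : ∀ x, g⁻¹ (g x) = x := fun x => g.symm_apply_apply x
  have := key g⁻¹ (inv_mem hg) _ _ h
  rwa [h1, h1] at this

lemma JoinAt.map {D : RegularSystem} {g : E3 ≃ₗᵢ[ℂ] E3} (hg : g ∈ D.G) {B : Set E3} {v : E3}
    (h : JoinAt D.poly B v) : JoinAt D.poly (g '' B) (g v) := by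
  constructor
  · have : {w | w ∈ g '' B ∧ line[ℂ, g v, w] ∈ D.poly.edges} =
        g '' {w | w ∈ B ∧ line[ℂ, v, w] ∈ D.poly.edges} := by
      ext w
      constructor
      · rintro ⟨⟨w, hw, rfl⟩, he⟩
        exact ⟨w, ⟨hw, (D.line_mem_edges_iff hg v w).1 he⟩, rfl⟩
      · rintro ⟨w, ⟨hw, he⟩, rfl⟩
        exact ⟨⟨w, hw, rfl⟩, (D.line_mem_edges_iff hg v w).2 he⟩
    rw [this, Set.ncard_image_of_injective _ g.injective, h.1]
  · rintro _ ⟨w, hw, rfl⟩ he _ ⟨w', hw', rfl⟩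
    rw [g.dist_map, g.dist_map]
    exact h.2 w hw ((D.line_mem_edges_iff hg v w).1 he) w' hw'

lemma JoinAt.act {D : RegularSystem} (hD : groupK ≤ realized D.G) {k : GL (Fin 3) ℂ}
    (hk : k ∈ groupK) {x v : E3} (h : JoinAt D.poly (orbitK x) v) :
    JoinAt D.poly (orbitK x) (act k v) := by
  obtain ⟨g, hg, e⟩ := hD hk
  have := h.map hg
  rw [← e] at this
  convert this
  ext y
  constructor
  · intro hy
    refine ⟨Qutrit.act k⁻¹ y, act_mem_orbitK (inv_mem hk) hy, ?_⟩
    rw [← e, ← act_mul, mul_inv_cancel, act_one]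
  · rintro ⟨z, hz, rfl⟩
    rw [← e]
    exact act_mem_orbitK hk hz

lemma vertsOn_doubleHessian {t : ℂ} (ht : t ≠ 0) {g : E3 ≃ₗᵢ[ℂ] E3}
    (hg : g ∈ Subgroup.closure doubleHessianModel.gens) :
    (doubleHessianModel.system t ht).poly.vertsOn ((doubleHessianModel.system t ht).edge g) =
      {g !₂[0, t, -t], g !₂[-t, t, 0]} := by
  rw [(doubleHessianModel.system t ht).vertsOn_edge hg]
  have h2 : Gen.t.real ^ 2 = 1 := orderOf_dvd_iff_pow_eq_one.1 Gen.orderOf_t.dvd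
  have h := range_pow_two h2 (doubleHessianModel.baseV t)
  rw [baseV_doubleHessian, t_real_apply] at h
  have hv : (doubleHessianModel.system t ht).v₀ = !₂[0, t, -t] := baseV_doubleHessian t
  have hR : (doubleHessianModel.system t ht).R₁ = Gen.t.real := rfl
  rw [hv, hR, h, Set.image_pair]

/-- Each edge of the spanned polyhedron has one vertex on each of the two Hessian polyhedra. -/
lemma exists_vertsOn_eq {t : ℂ} (ht : t ≠ 0) {e : Flat}
    (he : e ∈ (doubleHessianModel.system t ht).poly.edges) :
    ∃ v ∈ orbitK !₂[0, t, -t], ∃ w ∈ orbitK (-!₂[0, t, -t]),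
      (doubleHessianModel.system t ht).poly.vertsOn e = {v, w} := by
  rw [RegularSystem.edges_poly] at he
  obtain ⟨g, hg, rfl⟩ := he
  rw [vertsOn_doubleHessian ht hg]
  obtain ⟨k, hk, h | h⟩ := exists_act_doubleHessian hg
  · exact ⟨_, ⟨k, hk, h _⟩, _, h _ ▸ act_mem_orbitK hk (mem_orbitK_swap t), rfl⟩
  · refine ⟨g !₂[-t, t, 0], ?_, g !₂[0, t, -t], ⟨k, hk, by rw [h, act_neg]⟩, Set.pair_comm _ _⟩
    have := neg_mem_orbitK (act_mem_orbitK hk (mem_orbitK_swap t))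
    rwa [neg_neg, ← h] at this

lemma smul_v (t : ℂ) : t • doubleHessianModel.v.val = !₂[0, t, -t] := baseV_doubleHessian t

lemma smul_w (t : ℂ) : t • (Gen.model .t doubleHessianModel.v).val = !₂[-t, t, 0] := by
  rw [← Gen.real_val, ← map_smul, smul_v, t_real_apply]

/-- The neighbours of a vertex are permuted transitively by the stabilizer of the vertex. -/
lemma exists_stabilizer {t : ℂ} {u : Vec} (hu : u ∈ negHessianVerts)
    (h : doubleHessianModel.v.ip u = doubleHessianModel.v.ip (Gen.model .t doubleHessianModel.v)) :
    ∃ g ∈ Subgroup.closure {Gen.d0.real, Gen.s.real}, t • u.val = g !₂[-t, t, 0] := by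
  have key : ∀ u ∈ negHessianVerts,
      doubleHessianModel.v.ip u = doubleHessianModel.v.ip (Gen.model .t doubleHessianModel.v) →
      u ∈ Gen.reach [.d0, .s] (Gen.model .t doubleHessianModel.v) 4 := by decide +kernel
  obtain ⟨g, hg, e⟩ := ModelSystem.exists_of_reach (s := t) (key u hu h)
  exact ⟨g, hg, by rw [e, smul_w]⟩

lemma line_mem_edges_iff_ip {t : ℂ} (ht : t ≠ 0) {u : Vec} (hu : u ∈ negHessianVerts)
    (hw : t • u.val ∈ orbitK (-!₂[0, t, -t])) :
    line[ℂ, !₂[0, t, -t], t • u.val] ∈ (doubleHessianModel.system t ht).poly.edges ↔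
    doubleHessianModel.v.ip u = doubleHessianModel.v.ip (Gen.model .t doubleHessianModel.v) := by
  set D := doubleHessianModel.system t ht with hD
  have hv : D.v₀ = !₂[0, t, -t] := baseV_doubleHessian t
  have hR : D.R₁ D.v₀ = !₂[-t, t, 0] := by rw [hv]; exact t_real_apply t
  constructor
  · intro h
    have h1 : !₂[0, t, -t] ∈ D.poly.vertsOn (line[ℂ, !₂[0, t, -t], t • u.val]) :=
      ⟨(verts_doubleHessian ht).symm ▸ .inl (self_mem_orbitK _), left_mem_affineSpan_pair ℂ _ _⟩
    have h2 : t • u.val ∈ D.poly.vertsOn (line[ℂ, !₂[0, t, -t], t • u.val]) :=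
      ⟨(verts_doubleHessian ht).symm ▸ .inr hw, right_mem_affineSpan_pair ℂ _ _⟩
    rw [RegularSystem.edges_poly] at h
    obtain ⟨g, hg, e⟩ := h
    rw [e, vertsOn_doubleHessian ht hg] at h1 h2
    have hne : !₂[0, t, -t] ≠ t • u.val := fun h =>
      Set.disjoint_left.1 (disjoint_orbitK ht) (self_mem_orbitK _) (h ▸ hw)
    rw [← ModelSystem.ip_eq_iff ht, smul_v, smul_w]
    rcases h1 with h1 | h1 <;> rcases h2 with h2 | h2
    · exact absurd (h1.trans h2.symm) hne
    · rw [h2]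
      conv_lhs => rw [h1]
      exact g.inner_map_map _ _
    · have h3 := g.inner_map_map !₂[-t, t, 0] !₂[0, t, -t]
      rw [← h1, ← h2] at h3
      rw [h3, inner_E3, inner_E3]
      simp
    · exact absurd (h1.trans h2.symm) hne
  · intro h
    obtain ⟨g, hg, e⟩ := exists_stabilizer (t := t) hu h
    rw [RegularSystem.edges_poly]
    refine ⟨g, D.closure₂₃_le hg, ?_⟩
    have h1 : g D.v₀ = D.v₀ := by
      have := D.vert_mul_of_mem 1 g hg
      rw [one_mul] at this
      exact ptFlat_injective this
    rw [RegularSystem.edge, h1, hR, e, hv]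

lemma closure_le_hessian : Subgroup.closure {Gen.d0.real, Gen.s.real} ≤
    Subgroup.closure hessianModel.gens := by
  rw [gens_hessian]
  exact Subgroup.closure_mono (by rintro x (rfl | rfl) <;> simp)

lemma joinAt_base {t : ℂ} (ht : t ≠ 0) : JoinAt (doubleHessianModel.system t ht).poly
    (orbitK (-!₂[0, t, -t])) !₂[0, t, -t] := by
  constructor
  · let L := negHessianVerts.filter fun u =>
      doubleHessianModel.v.ip u = doubleHessianModel.v.ip (Gen.model .t doubleHessianModel.v)
    have hL : L.toFinset.card = 8 := by decide +kernel
    rw [← hL, ← Set.ncard_coe_finset, ← Set.ncard_image_of_injective _ (smul_val_injective ht)]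
    congr 1
    ext w
    constructor
    · rintro ⟨hw, he⟩
      obtain ⟨u, hu, rfl⟩ := exists_negHessian_vec ht hw
      refine ⟨u, ?_, rfl⟩
      simp only [L, List.coe_toFinset, Set.mem_ofPred_eq, List.mem_filter, decide_eq_true_eq]
      exact ⟨hu, (line_mem_edges_iff_ip ht hu hw).1 he⟩
    · rintro ⟨u, hu, rfl⟩
      simp only [L, List.coe_toFinset, Set.mem_ofPred_eq, List.mem_filter, decide_eq_true_eq] at hu
      obtain ⟨g, hg, e⟩ := exists_stabilizer (t := t) hu.1 hu.2
      obtain ⟨k, hk, e'⟩ := exists_act_hessian (closure_le_hessian hg)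
      have hw : t • u.val ∈ orbitK (-!₂[0, t, -t]) := by
        rw [e, e']; exact act_mem_orbitK hk (mem_orbitK_swap t)
      exact ⟨hw, (line_mem_edges_iff_ip ht hu.1 hw).2 hu.2⟩
  · intro w hw he w' hw'
    have hnorm : ∀ w ∈ orbitK (-!₂[0, t, -t]), ‖w‖ = ‖(!₂[0, t, -t] : E3)‖ := by
      rintro _ ⟨k, hk, rfl⟩
      obtain ⟨g, -, e⟩ := groupK_le_realized hk
      rw [e, g.norm_map, norm_neg]
    have n1 := hnorm w hw
    have n2 := hnorm w' hw'
    obtain ⟨u, hu, rfl⟩ := exists_negHessian_vec ht hw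
    obtain ⟨u', hu', rfl⟩ := exists_negHessian_vec ht hw'
    have hip := (line_mem_edges_iff_ip ht hu hw).1 he
    have key : ∀ u ∈ negHessianVerts, 2 * (doubleHessianModel.v.ip u).1 -
        (doubleHessianModel.v.ip u).2 ≤ 2 := by decide +kernel
    have hone : doubleHessianModel.v.ip (Gen.model .t doubleHessianModel.v) = (1, 0) := by
      decide +kernel
    -- the nearest points are those with the largest real part of the inner product
    have hre : ∀ u : Vec, (inner ℂ (!₂[0, t, -t] : E3) (t • u.val)).re =
        ‖t‖ ^ 2 * (doubleHessianModel.v.ip u).val.re := fun u => by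
      rw [← smul_v, inner_smul_left, inner_smul_right, Vec.inner_val, ← mul_assoc, Complex.conj_mul',
        ← Complex.ofReal_pow, Complex.re_ofReal_mul]
    rw [dist_eq_norm, dist_eq_norm, ← sq_le_sq₀ (norm_nonneg _) (norm_nonneg _),
      norm_sub_sq (𝕜 := ℂ), norm_sub_sq (𝕜 := ℂ), n1, n2]
    have h1 : (doubleHessianModel.v.ip u').val.re ≤ (doubleHessianModel.v.ip u).val.re := by
      rw [hip, hone, Eis.val_re, Eis.val_re]
      have h2 : (2 * (doubleHessianModel.v.ip u').1 - (doubleHessianModel.v.ip u').2 : ℝ) ≤ 2 := by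
        exact_mod_cast key u' hu'
      push_cast
      linarith
    have h3 := mul_le_mul_of_nonneg_left h1 (sq_nonneg ‖t‖)
    rw [← hre, ← hre] at h3
    have h4 : RCLike.re (inner ℂ (!₂[0, t, -t] : E3) (t • u'.val)) ≤
      RCLike.re (inner ℂ (!₂[0, t, -t] : E3) (t • u.val)) := h3
    linarith

/-- The polyhedron `2{4}3{3}3` is spanned by two reciprocal Hessian polyhedra. -/
lemma isSpannedBy_hessian {t : ℂ} (ht : t ≠ 0) :
    (doubleHessianModel.system t ht).poly.IsSpannedBy (hessianModel.system t ht).poly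
      (hessianModel.system (-t) (neg_ne_zero.2 ht)).poly := by
  have hv : (hessianModel.system (-t) (neg_ne_zero.2 ht)).poly.verts = orbitK (-!₂[0, t, -t]) := by
    rw [verts_hessian, neg_vec]
  refine ⟨isRegularOfType_hessian _, isRegularOfType_hessian _, isReciprocal_hessian ht _, ?_, ?_, ?_,
    ?_, ?_⟩
  · rw [verts_hessian, hv]; exact disjoint_orbitK ht
  · rw [verts_hessian, hv]; exact verts_doubleHessian ht
  · rw [verts_hessian, hv]; exact fun e he => exists_vertsOn_eq ht he
  · rintro _ hw
    rw [verts_hessian] at hw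
    obtain ⟨k, hk, rfl⟩ := hw
    rw [hv]
    exact JoinAt.act (D := doubleHessianModel.system t ht) groupK_le_realized_doubleHessian hk
      (joinAt_base ht)
  · rintro _ hw
    rw [hv, ← orbitK_eq_of_mem (mem_orbitK_swap t)] at hw
    obtain ⟨k, hk, rfl⟩ := hw
    rw [verts_hessian]
    refine JoinAt.act (D := doubleHessianModel.system t ht) groupK_le_realized_doubleHessian hk ?_
    have h := JoinAt.map (D := doubleHessianModel.system t ht) t_real_mem (joinAt_base ht)
    rw [t_real_apply] at h
    -- the reflection interchanges the two Hessian polyhedra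
    have hsw : ∀ x, Gen.t.real x = -act (mono (Equiv.swap 0 2) 0) x := fun x => by
      rw [Gen.act_t, neg_neg]
    have htt : ∀ x, Gen.t.real (Gen.t.real x) = x := fun x => by
      rw [Gen.t_apply, Gen.t_apply]; apply ext_E3 <;> rfl
    convert h
    ext y
    constructor
    · intro hy
      refine ⟨Gen.t.real y, ?_, htt y⟩
      rw [hsw]
      exact neg_mem_orbitK (act_mem_orbitK (mono_mem _ _) hy)
    · rintro ⟨z, hz, rfl⟩
      rw [hsw]
      have := neg_mem_orbitK (act_mem_orbitK (mono_mem (Equiv.swap 0 2) 0) hz)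
      rwa [neg_neg] at this

end Qutrit

end

theorem theorem4 (a b c : ℂ) :
    -- the generic number of solutions
    ((b ^ 3 - c ^ 2) * (a ^ 3 - 3 * a * b + 2 * c) ≠ 0 →
      (Qutrit.solutions a b c).ncard = 1296) ∧
    -- the explicit chain of equations for the solutions
    (b ≠ 0 → ∀ x : Qutrit.E3, x ∈ Qutrit.solutions a b c ↔
      ∃ X s : ℂ, 27 * X ^ 4 - 18 * b * X ^ 2 - 8 * c * X - b ^ 2 = 0 ∧ s ^ 2 = X ∧
        ∀ T : ℂ, (T - x 0 ^ 3) * (T - x 1 ^ 3) * (T - x 2 ^ 3) =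
          T ^ 3 - s * T ^ 2 + (s ^ 2 - a) / 12 * T - (b - s ^ 4) / (216 * s)) ∧
    -- all solutions are reached by successively solving equations of degree at most four
    (∃ F : Subfield ℂ, Qutrit.ChainField (Subfield.closure {a, b, c}) F ∧
      ∀ x ∈ Qutrit.solutions a b c, ∀ i, x i ∈ F) ∧
    -- the solutions with the correct sign of the invariant of degree nine
    ∀ d : ℂ, 432 * d ^ 2 = a ^ 3 - 3 * a * b + 2 * c →
      (∀ x ∈ Qutrit.solutions a b c, Qutrit.C9 x = d ∨ Qutrit.C9 x = -d) ∧
      (∀ x ∈ Qutrit.signedSolutions a b c d,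
        Qutrit.signedSolutions a b c d = Qutrit.orbitK x) ∧
      (b ^ 3 ≠ c ^ 2 →
        (Qutrit.signedSolutions a b c d).ncard = 648 ∧
        ∀ x ∈ Qutrit.signedSolutions a b c d, Qutrit.isotropy x = ⊥) ∧
      (b ^ 3 = c ^ 2 → b ≠ 0 → ¬ (b = a ^ 2 ∧ c = a ^ 3) →
        (Qutrit.signedSolutions a b c d).ncard = 216 ∧
        ∀ x ∈ Qutrit.signedSolutions a b c d,
          Nonempty (Qutrit.isotropy x ≃* Multiplicative (ZMod 3))) ∧
      (b = a ^ 2 → c = a ^ 3 → a ≠ 0 →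
        (Qutrit.signedSolutions a b c d).ncard = 72 ∧
        ∀ x ∈ Qutrit.signedSolutions a b c d,
          Nonempty (Qutrit.isotropy x ≃* Multiplicative (ZMod 3) × Multiplicative (ZMod 3))) ∧
      (b = 0 → c = 0 → a ≠ 0 →
        (Qutrit.signedSolutions a b c d).ncard = 27 ∧
        ∀ x ∈ Qutrit.signedSolutions a b c d, Qutrit.HasIsotropyG4 x) ∧
      (a = 0 → b = 0 → c = 0 →
        Qutrit.signedSolutions a b c d = {0} ∧ Qutrit.isotropy 0 = Qutrit.groupK) ∧
      -- the configurations of the degenerate orbits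
      (b = a ^ 2 / 4 → c = -a ^ 3 / 8 → a ≠ 0 →
        ∃ P H H' : Qutrit.ComplexPolyhedron, P.IsRegularOfType 2 4 3 3 3 ∧
          P.IsSpannedBy H H' ∧ Qutrit.signedSolutions a b c d = P.edgeCenters) ∧
      (b = a ^ 2 → c = a ^ 3 → a ≠ 0 →
        (∃ H : Qutrit.ComplexPolyhedron, H.IsHessian ∧
          Qutrit.signedSolutions a b c d = H.edgeCenters) ∧
        ∃ P : Qutrit.ComplexPolyhedron, P.IsRegularOfType 3 3 3 4 2 ∧
          Qutrit.signedSolutions a b c d = P.verts) ∧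
      (b = 0 → c = 0 → a ≠ 0 →
        ∃ H : Qutrit.ComplexPolyhedron, H.IsHessian ∧
          Qutrit.signedSolutions a b c d = H.verts) := by
  refine ⟨Qutrit.ncard_solutions, fun hb x => Qutrit.mem_solutions_iff_chain hb x,
    Qutrit.exists_chainField a b c, fun d hd => ?_⟩
  obtain ⟨h₁, h₂, h₃, h₄, h₅⟩ := Qutrit.orbit_types hd
  refine ⟨fun x hx => Qutrit.C9_eq_or hd hx, fun x hx => Qutrit.signedSolutions_eq_orbitK hx,
    h₁, h₂, h₃, h₄, h₅, fun hb hc ha => ?_, fun hb hc ha =>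
      ⟨Qutrit.exists_hessian_edgeCenters hd hb hc ha, Qutrit.exists_axis_verts hd hb hc ha⟩,
    fun hb hc ha => Qutrit.exists_hessian_verts hd hb hc ha⟩
  obtain ⟨t, ht, h⟩ := Qutrit.exists_doubleHessian_edgeCenters hd hb hc ha
  exact ⟨_, _, _, Qutrit.isRegularOfType_doubleHessian ht, Qutrit.isSpannedBy_hessian ht, h⟩
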